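/- **Setting.** There are $M=2^L$ processes ($L\ge 1$), the leaves of a complete binary tree with levels $l=0$ (leaves), $\dots,L$ (root). Exactly $K$ of them ($1\le K\le M$, $K$ known) are anomalous; $H$ denotes the set of anomalous processes, with an arbitrary prior $p$ on the $K$-subsets. One observation of a node of level $l$ has density $f_l(\cdot\mid\theta)$, where $\theta=\theta_0^{(l)}$ (known) if the node contains no anomaly, and $\theta\in\Theta_j^{(l)}$ is unknown if it contains exactly $j\ge1$ anomalies; observations are independent. A process that has been declared anomalous can be removed from the tree and then no longer counts as contained in its ancestors. $D_l(\theta\|\theta')$ is the Kullback–Leibler divergence between $f_l(\cdot\mid\theta)$ and $f_l(\cdot\mid\theta')$. The families $f_l,\theta_0^{(l)},\Theta_j^{(l)}$ are given for all $l\in\mathbb N$ and do not depend on $M$. **Hierarchical Dynamic Search (HDS)** with sampling cost $c\in(0,1)$ performs $K$ random walks on the tree, one after the other. Each starts at the root, ends by declaring a leaf anomalous, and this leaf is then removed; later walks only visit and sample nodes that still contain processes. At a node of level $l+1$, $n_l$ samples are drawn from each child that still contains processes, and the statistic $\sum_{i\le n_l}\log\frac{f_l(y(i)\mid\hat\theta)}{f_l(y(i)\mid\theta_0^{(l)})}$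 is computed for each, where $\hat\theta$ is the maximum likelihood estimate in $\Theta_1^{(l)}$ from these samples; the walk moves to the child with the larger statistic if some statistic is positive, and otherwise to the parent (the parent of the root is the root). At a leaf, $N$ initial samples are drawn, and then samples $y(1),y(2),\dots$ are drawn one by one; after each, $S(n)=\sum_{i\le n}\log\frac{f_0(y(i)\mid\hat\theta(i-1))}{f_0(y(i)\mid\theta_0^{(0)})}$ is computed, where $\hat\theta(i-1)$ is the maximum likelihood estimate in $\Theta_1^{(0)}$ from all samples of this test before $y(i)$; if $S(n)>\log\frac{\log_2M}{c}$ the leaf is declared anomalous, if $S(n)<0$ the walk moves to the parent, and otherwise sampling goes on. The sample sizes $(n_l)$ are called *admissible* if they are bounded and there is $p>\frac12$ such that for all $l$ an internal test on children of level $l$ moves towards the closest anomaly with probability at least $p$, whatever the children contain (i.e. to a child with an anomaly if there is one, and to the parent otherwise). The Bayesian risk $R$ is the probability that the declared set is not $H$, plus $c$ times the expected total number of samples, both averaged over the prior. **Assumptions.** There is $\Delta>0$ such that for all $l\ge 0$ and $\theta\in\Theta_1^{(l)}$: $D_l(\theta_0^{(l)}\|\theta)\ge\Delta$ and $D_l(\theta\|\theta_0^{(l)})\ge\Delta$;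 and for all $l\ge1$, $1\le j\le 2^l$, $\theta_j\in\Theta_j^{(l)}$ there is $\theta_1\in\Theta_1^{(l)}$ with $D_l(\theta_j\|\theta_1)<\infty$ and $D_l(\theta_j\|\theta_0^{(l)})-D_l(\theta_j\|\theta_1)\ge\Delta$. (If there are never more than $K_{\max}$ anomalies, take $\Theta_j^{(l)}=\emptyset$ for $j>K_{\max}$.) The sets $\Theta_1^{(l)}$ are finite and non-empty, with cardinality bounded in $l$. The divergences $D_l(\theta_0^{(l)}\|\theta)$ and $D_l(\theta\|\theta_0^{(l)})$, $\theta\in\Theta_1^{(l)}$, are finite, and the log-likelihood ratios $\log\frac{f_l(y\mid\theta)}{f_l(y\mid\theta_0^{(l)})}$, $\theta\in\Theta_1^{(l)}$, have finite second moments under $\theta_0^{(l)}$ and under every $\theta'\in\Theta_j^{(l)}$, $1\le j\le2^l$, with variances bounded uniformly in $l$, $j$, $\theta$ and $\theta'$. **Theorem 2.** Under these assumptions, admissible sample sizes exist. Moreover there is $N_0$ such that for every $N\ge N_0$ and all admissible sample sizes $(n_l)$ there are constants $C,C'$, independent of $M$, $c$ and $K$ (and of the prior and the true parameters), with $$R(\mathrm{HDS})\le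 c\,K\,C\log_2M+\frac{c\,K\log\frac{\log_2M}{c}}{D_0(\theta_1^{(0)}\|\theta_0^{(0)})}+C'c$$ for all $L\ge1$, $M=2^L$, $1\le K\le M$ and $c\in(0,1)$. Here $\theta_1^{(0)}\in\Theta_1^{(0)}$ is the true parameter of the anomalous leaves or, if these have different parameters, any element of $\Theta_1^{(0)}$ with $D_0(\theta_1^{(0)}\|\theta_0^{(0)})\le D_0(\theta\|\theta_0^{(0)})$ for the true parameter $\theta$ of each anomalous leaf. -/

import Mathlib

open MeasureTheory ProbabilityTheory InformationTheory
open scoped ENNReal NNReal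

noncomputable section

namespace HDS

/-! Hierarchical statistical model on a binary tree. -/

/-- A hierarchical parametric statistical model. At level `l` the observations have density
`f l θ` with respect to the reference measure `μ l`; `θ₀ l` is the known parameter of a normal node
of level `l`, and `params l j` is the set of the possible parameters of a node of level `l` that
contains exactly `j ≥ 1` anomalies. The number of levels of the tree is not part of the model. -/
structure Model (Y Θ : Type*) [MeasurableSpace Y] where
  μ : ℕ → Measure Y
  sigmaFinite_μ : ∀ l, SigmaFinite (μ l)
  f : ℕ → Θ → Y → ℝ≥0
  measurable_f : ∀ l θ, Measurable (f l θ)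
  lintegral_f : ∀ l θ, ∫⁻ y, (f l θ y : ℝ≥0∞) ∂(μ l) = 1
  θ₀ : ℕ → Θ
  params : ℕ → ℕ → Set Θ

variable {Y Θ : Type*} [MeasurableSpace Y]

namespace Model

/-- The law of one observation at level `l` with parameter `θ`. -/
def law (m : Model Y Θ) (l : ℕ) (θ : Θ) : Measure Y :=
  (m.μ l).withDensity (fun y => (m.f l θ y : ℝ≥0∞))

instance instIsProbabilityMeasureLaw (m : Model Y Θ) (l : ℕ) (θ : Θ) :
    IsProbabilityMeasure (m.law l θ) :=
  ⟨by rw [law, withDensity_apply _ MeasurableSet.univ, Measure.restrict_univ, m.lintegral_f]⟩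

/-- The Kullback-Leibler divergence `D_l(θ ‖ θ')`. -/
def kl (m : Model Y Θ) (l : ℕ) (θ θ' : Θ) : ℝ≥0∞ := klDiv (m.law l θ) (m.law l θ')

/-- The log-likelihood ratio of `θ` against the normal parameter, for one observation. -/
def logRatio (m : Model Y Θ) (l : ℕ) (θ : Θ) (y : Y) : ℝ :=
  Real.log ((m.f l θ y : ℝ) / (m.f l (m.θ₀ l) y : ℝ))

/-- Distinguishability with margin `Δ` at all levels. -/
def Distinguishable (m : Model Y Θ) (Δ : ℝ≥0) : Prop :=
  ∀ l, ∀ θ ∈ m.params l 1, (Δ : ℝ≥0∞) ≤ m.kl l (m.θ₀ l) θ ∧ (Δ : ℝ≥0∞) ≤ m.kl l θ (m.θ₀ l)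

/-- A node with several anomalies is, by the margin `Δ`, more similar to a node with a single
anomaly than to a normal node: for some single-anomaly parameter `θ₁`,
`D_l(θ ‖ θ₀) - D_l(θ ‖ θ₁) ≥ Δ`. -/
def MultiDistinguishable (m : Model Y Θ) (Δ : ℝ≥0) : Prop :=
  ∀ l, 1 ≤ l → ∀ j, 1 ≤ j → j ≤ 2 ^ l → ∀ θ ∈ m.params l j, ∃ θ₁ ∈ m.params l 1,
    m.kl l θ θ₁ ≠ ⊤ ∧ m.kl l θ θ₁ + (Δ : ℝ≥0∞) ≤ m.kl l θ (m.θ₀ l)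

/-- The moment conditions: normal and single-anomaly laws have finite divergences from each other,
and the single-observation log-likelihood ratios have, under every law that an observation can
have, a finite second moment, with variances that are bounded uniformly in the level. -/
def FiniteMoments (m : Model Y Θ) : Prop :=
  (∀ l, ∀ θ ∈ m.params l 1, m.kl l (m.θ₀ l) θ ≠ ⊤ ∧ m.kl l θ (m.θ₀ l) ≠ ⊤) ∧
  ∃ V : ℝ≥0, ∀ l, ∀ θ₁ ∈ m.params l 1, ∀ θ : Θ,
    (θ = m.θ₀ l ∨ ∃ j, 1 ≤ j ∧ j ≤ 2 ^ l ∧ θ ∈ m.params l j) →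
      evariance (m.logRatio l θ₁) (m.law l θ) ≤ (V : ℝ≥0∞)

/-- `mle l xs` is a maximum likelihood estimate in the single-anomaly set of level `l`, from the
sample `xs`, measurable in the sample (ties may be broken in any measurable way). -/
def IsMLE (m : Model Y Θ) (mle : ℕ → List Y → Θ) : Prop :=
  (∀ l xs, mle l xs ∈ m.params l 1 ∧
    ∀ θ ∈ m.params l 1, (xs.map (m.f l θ)).prod ≤ (xs.map (m.f l (mle l xs))).prod) ∧
  ∀ l n θ, MeasurableSet {x : Fin n → Y | mle l (List.ofFn x) = θ}

end Model

/-! The tree, search policies and the Bayesian risk. -/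

/-- The leaves (processes) below node `(l, j)`. The tree with `2 ^ L` leaves `0, …, 2 ^ L - 1` has
the nodes `(l, j)`, `l ≤ L`, `j < 2 ^ (L - l)`; the children of `(l + 1, j)` are `(l, 2 * j)` and
`(l, 2 * j + 1)`. -/
def leaves (l j : ℕ) : Finset ℕ := Finset.Ico (j * 2 ^ l) ((j + 1) * 2 ^ l)

/-- What can be sampled: node `(level, index)` of the tree from which the processes in `removed`
have been removed. -/
structure Query where
  removed : Finset ℕ
  level : ℕ
  index : ℕ

/-- A deterministic search policy: from the data collected so far it selects either what to sample
next, or to stop and to declare a set of processes anomalous. -/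
abbrev Policy (Y : Type*) := List Y → Query ⊕ Finset ℕ

/-- The data collected by the policy `π` before time `t`, where `ω (t, q)` is the observation
obtained if `q` is sampled at time `t`. -/
def history (π : Policy Y) (ω : ℕ × Query → Y) : ℕ → List Y
  | 0 => []
  | t + 1 =>
    match π (history π ω t) with
    | Sum.inl q => history π ω t ++ [ω (t, q)]
    | Sum.inr _ => history π ω t

/-- The stopping time (the number of samples drawn). -/
def stopTime (π : Policy Y) (ω : ℕ × Query → Y) : ℝ≥0∞ :=
  ⨅ (t : ℕ) (_ : (π (history π ω t)).isRight), (t : ℝ≥0∞)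

/-- The anomalous processes are those in `H`, and `ϑ` gives the true parameter of every node (of
every tree from which some processes were removed), which is determined, up to the unknown choice
in `params l k`, by the number `k` of the anomalies which the node still contains. -/
def IsTruth (m : Model Y Θ) (L : ℕ) (H : Finset ℕ) (ϑ : Query → Θ) : Prop :=
  ∀ D ⊆ Finset.range (2 ^ L), ∀ l ≤ L, ∀ j < 2 ^ (L - l),
    (((H \ D) ∩ leaves l j).card = 0 → ϑ ⟨D, l, j⟩ = m.θ₀ l) ∧
    (((H \ D) ∩ leaves l j).card ≠ 0 → ϑ ⟨D, l, j⟩ ∈ m.params l ((H \ D) ∩ leaves l j).card)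

/-- The law of all observations: independent, with the law of the sampled node. -/
def obsLaw (m : Model Y Θ) (ϑ : Query → Θ) : Measure (ℕ × Query → Y) :=
  Measure.infinitePi (fun i : ℕ × Query => m.law i.2.level (ϑ i.2))

/-- The error probability: not (stopping and) declaring exactly `H`. -/
def errorProb (m : Model Y Θ) (π : Policy Y) (H : Finset ℕ) (ϑ : Query → Θ) : ℝ≥0∞ :=
  obsLaw m ϑ {ω | ¬ ∃ t, π (history π ω t) = Sum.inr H}

/-- The expected number of samples. -/
def sampleComplexity (m : Model Y Θ) (π : Policy Y) (ϑ : Query → Θ) : ℝ≥0∞ :=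
  ∫⁻ ω, stopTime π ω ∂(obsLaw m ϑ)

/-- The Bayesian risk (error probability plus `c` times sample complexity) with `2 ^ L` processes,
`K` of them anomalous, and prior `p` on the set of the anomalous processes. `ϑ H` are the true
parameters when `H` is the set of the anomalous processes. -/
def bayesRisk (m : Model Y Θ) (L K : ℕ) (c : ℝ) (p : Finset ℕ → ℝ≥0∞)
    (ϑ : Finset ℕ → Query → Θ) (π : Policy Y) : ℝ≥0∞ :=
  ∑ H ∈ (Finset.range (2 ^ L)).powersetCard K, p H * errorProb m π H (ϑ H) +
    ENNReal.ofReal c *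
      ∑ H ∈ (Finset.range (2 ^ L)).powersetCard K, p H * sampleComplexity m π (ϑ H)

/-! Hierarchical Dynamic Search. -/

/-- The generalized log-likelihood ratio of the sample `xs` from a node of level `l`. -/
def gllr (m : Model Y Θ) (mle : ℕ → List Y → Θ) (l : ℕ) (xs : List Y) : ℝ :=
  (xs.map (m.logRatio l (mle l xs))).sum

/-- The adaptive log-likelihood ratio of the leaf test: the first `N` samples only initialize the
estimate, and every later sample is evaluated at the estimate from all the samples before it. -/
def allr (m : Model Y Θ) (mle : ℕ → List Y → Θ) (N : ℕ) (xs : List Y) : ℝ :=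
  ∑ i : Fin xs.length, if N ≤ (i : ℕ) then m.logRatio 0 (mle 0 (xs.take i)) (xs.get i) else 0

/-- Outcome of an internal test. -/
inductive Move where
  | left
  | right
  | up

/-- The internal test, from the statistics of the two children; `none` stands for a child whose
processes have all been removed, which is not sampled. -/
def decideMove : Option ℝ → Option ℝ → Move
  | some a, some b => if 0 < a ∨ 0 < b then (if b ≤ a then Move.left else Move.right) else Move.up
  | some a, none => if 0 < a then Move.left else Move.up
  | none, some b => if 0 < b then Move.right else Move.up
  | none, none => Move.up

/-- The state of a child of the tested node: `none` if all of its processes have been removed, and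
otherwise the number of the anomalies it contains, with its true parameter. -/
abbrev Child (Θ : Type*) := Option (ℕ × Θ)

/-- The states that a child of level `l` can be in. -/
def Child.Possible (m : Model Y Θ) (l : ℕ) : Child Θ → Prop
  | none => True
  | some (k, θ) => (k = 0 ∧ θ = m.θ₀ l) ∨ (1 ≤ k ∧ k ≤ 2 ^ l ∧ θ ∈ m.params l k)

/-- The child contains an anomaly. -/
def Child.Anomalous : Child Θ → Prop
  | none => False
  | some (k, _) => 1 ≤ k

/-- The law of a sample of size `n` from a child of level `l` (irrelevant if the child is not
sampled). -/
def Child.sampleLaw (m : Model Y Θ) (l n : ℕ) (a : Child Θ) : Measure (Fin n → Y) :=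
  Measure.pi (fun _ : Fin n => m.law l (a.elim (m.θ₀ l) Prod.snd))

/-- The move is one towards the closest anomaly. -/
def Move.Correct (a b : Child Θ) : Move → Prop
  | Move.left => a.Anomalous
  | Move.right => b.Anomalous
  | Move.up => ¬ a.Anomalous ∧ ¬ b.Anomalous

/-- Admissible sample sizes `n l` (per child of level `l`) for the internal tests: they are bounded,
and the probability of moving towards the closest anomaly exceeds `1 / 2`, by some margin that is
independent of the level, whatever the children of the tested node contain. -/
def AdmissibleSizes (m : Model Y Θ) (mle : ℕ → List Y → Θ) (n : ℕ → ℕ) : Prop :=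
  (∃ B, ∀ l, n l ≤ B) ∧
  ∃ p : ℝ, 1 / 2 < p ∧ ∀ (l : ℕ) (a b : Child Θ), a.Possible m l → b.Possible m l →
    (a.isSome ∨ b.isSome) →
      ENNReal.ofReal p ≤ ((a.sampleLaw m l (n l)).prod (b.sampleLaw m l (n l)))
        {x | Move.Correct a b (decideMove
          (a.map fun _ => gllr m mle l (List.ofFn x.1))
          (b.map fun _ => gllr m mle l (List.ofFn x.2)))}

/-- State of the search: the processes declared (and removed) so far, the current node, and the
samples drawn so far in the current test. -/
structure State (Y : Type*) where
  declared : Finset ℕ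
  level : ℕ
  index : ℕ
  buf : List Y

/-- Node `(l, j)` still contains a process that is not removed. -/
def Present (D : Finset ℕ) (l j : ℕ) : Prop := ¬ leaves l j ⊆ D

instance instDecidablePresent (D : Finset ℕ) (l j : ℕ) : Decidable (Present D l j) := by
  unfold Present; infer_instance

/-- Start of a random walk: at the root of the tree of height `L`. -/
def atRoot (L : ℕ) (D : Finset ℕ) : State Y := ⟨D, L, 0, []⟩

/-- Move to the parent (the parent of the root is the root). -/
def toParent (L : ℕ) (s : State Y) : State Y :=
  if s.level < L then ⟨s.declared, s.level + 1, s.index / 2, []⟩ else atRoot L s.declared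

/-- The next node to sample: the current leaf, or a child of the current internal node, first `n l`
times the left one and then `n l` times the right one; a child without processes is skipped. -/
def nextQuery (n : ℕ → ℕ) (s : State Y) : Query :=
  match s.level with
  | 0 => ⟨s.declared, 0, s.index⟩
  | l + 1 =>
    if Present s.declared l (2 * s.index) ∧
        (Present s.declared l (2 * s.index + 1) → s.buf.length < n l) then
      ⟨s.declared, l, 2 * s.index⟩
    else ⟨s.declared, l, 2 * s.index + 1⟩

/-- End of an internal test at a node of level `l + 1`, with the samples `xs`. -/
def finishInternal (m : Model Y Θ) (mle : ℕ → List Y → Θ) (n : ℕ → ℕ) (L l : ℕ) (s : State Y)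
    (xs : List Y) : State Y :=
  match decideMove
      (if Present s.declared l (2 * s.index) then some (gllr m mle l (xs.take (n l))) else none)
      (if Present s.declared l (2 * s.index + 1) then
        some (gllr m mle l
          (if Present s.declared l (2 * s.index) then xs.drop (n l) else xs)) else none) with
  | Move.left => ⟨s.declared, l, 2 * s.index, []⟩
  | Move.right => ⟨s.declared, l, 2 * s.index + 1, []⟩
  | Move.up => toParent L s

/-- The number of samples of an internal test at a node of level `l + 1`. -/
def testSize (n : ℕ → ℕ) (l : ℕ) (s : State Y) : ℕ :=
  if Present s.declared l (2 * s.index) ∧ Present s.declared l (2 * s.index + 1) then 2 * n l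
  else n l

/-- One step of the search: process the observation `y` of `nextQuery n s`. -/
def step (m : Model Y Θ) (mle : ℕ → List Y → Θ) (n : ℕ → ℕ) (N L : ℕ) (c : ℝ)
    (s : State Y) (y : Y) : State Y :=
  let xs := s.buf ++ [y]
  match s.level with
  | 0 =>
    if xs.length ≤ N then ⟨s.declared, 0, s.index, xs⟩
    else if Real.log ((L : ℝ) / c) < allr m mle N xs then atRoot L (insert s.index s.declared)
    else if allr m mle N xs < 0 then toParent L s
    else ⟨s.declared, 0, s.index, xs⟩
  | l + 1 =>
    if xs.length < testSize n l s then ⟨s.declared, l + 1, s.index, xs⟩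
    else finishInternal m mle n L l s xs

/-- Hierarchical Dynamic Search for `K` anomalies among `2 ^ L` processes with sampling cost `c`,
internal sample sizes `n`, and `N` initial samples in the leaf tests: `K` random walks, one after
the other, each of which starts at the root and ends with the declaration and removal of a leaf. -/
def hds (m : Model Y Θ) (mle : ℕ → List Y → Θ) (n : ℕ → ℕ) (N L K : ℕ) (c : ℝ) : Policy Y :=
  fun h =>
    let s := h.foldl (step m mle n N L c) (atRoot L ∅)
    if s.declared.card = K then Sum.inr s.declared else Sum.inl (nextQuery n s)

end HDS

end

/-! The search is a Markov chain on its states (declared processes, current node, samples of the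
current test), and the whole proof is the construction of one potential `V ≥ 0` of these states with
`1 + E[V (next state)] ≤ V (state)` until `K` leaves are declared, and `V ≥ 1 / c` on a wrong final
declaration. Summing up, the expected number of samples plus `1 / c` times the error probability is
at most `V` at the start (`errorProb_add_le_potential`), so that the risk is at most `c` times it.

`V` is the sum of `nodeCost a r L` for every walk still to come, of `1 / c` if a false declaration
has been made, and of a potential of the current test, which starts at most at
`nodeCost a r d = a * d + r`, where `d` is the distance from the current node to the closest anomaly
(`treeDist`) and `r = log (L / c) / D + const`. There are three kinds of tests:

* At an internal node, a correct move decreases `d` by one, any other move increases it by at most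
  one. As the correct move has probability at least `p > 1 / 2`, the expected decrease of `a * d` is
  at least `a * (2 * p - 1)`, which for large `a` pays for the samples of the test
  (`exists_internalTest_potential`).
* At a normal leaf, the statistic `S` has a drift of at most `-Δ` and `exp S` is a supermartingale,
  whatever the estimates. So the test takes a bounded expected number of samples, and it declares
  the leaf with probability at most `c / L`; the expected penalty is at most `1 / L ≤ 1`
  (`exists_normalLeaf_potential`).
* At an anomalous leaf with parameter `θ`, the estimate differs from `θ` with exponentially small
  probability in the number of samples, by a bound with Hellinger affinities. With the estimate equal
  to `θ`, the statistic is a random walk with drift `D_0(θ ‖ θ₀)`, which passes the threshold after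
  `log (L / c) / D_0(θ ‖ θ₀)` samples up to a constant: the overshoot is handled by a potential in
  the manner of Lorden's inequality. The walk leaves the leaf with probability at most some `h < 1`
  once `N` is large; the cost of coming back enters as a geometric series with ratio `h`
  (`exists_anomalousLeaf_potential`).

Admissible sample sizes exist because the generalized log-likelihood ratio of a large sample has,
by Chebyshev's inequality and finiteness of the parameter sets, the right sign with high probability,
uniformly in the level (`exists_admissibleSizes`).
-/

noncomputable section

namespace HDS

/-! ### Potentials of a controlled Markov chain -/

section Chain

variable {S Q Y : Type*}

open Classical in
/-- The trajectory of a chain that is driven by observations: while its state `s` is not terminal,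
the chain moves to `step s y`, where `y` is the current observation from the source `query s`;
`ω (t, q)` is the observation at time `t` from the source `q`. -/
def trajectory (terminal : Set S) (query : S → Q) (step : S → Y → S) (s₀ : S) (ω : ℕ × Q → Y) :
    ℕ → S
  | 0 => s₀
  | t + 1 =>
    if trajectory terminal query step s₀ ω t ∈ terminal then trajectory terminal query step s₀ ω t
    else step (trajectory terminal query step s₀ ω t)
      (ω (t, query (trajectory terminal query step s₀ ω t)))

variable {terminal : Set S} {query : S → Q} {step : S → Y → S} {s₀ : S}

lemma trajectory_invariant {Inv : S → Prop} (h0 : Inv s₀)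
    (hinv : ∀ s, Inv s → s ∉ terminal → ∀ y, Inv (step s y)) (ω : ℕ × Q → Y) (t : ℕ) :
    Inv (trajectory terminal query step s₀ ω t) := by
  induction t with
  | zero => exact h0
  | succ t ih =>
    rw [trajectory]
    split_ifs with h
    · exact ih
    · exact hinv _ ih h _

/-- The σ-algebra of the observations before time `t`. -/
@[reducible] def past (Q Y : Type*) [MeasurableSpace Y] (t : ℕ) : MeasurableSpace (ℕ × Q → Y) :=
  ⨆ i ∈ {i : ℕ × Q | i.1 < t}, MeasurableSpace.comap (fun ω : ℕ × Q → Y => ω i) inferInstance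

variable [MeasurableSpace Y]

lemma past_mono {t t' : ℕ} (h : t ≤ t') : past Q Y t ≤ past Q Y t' :=
  biSup_mono fun _ hi => lt_of_lt_of_le hi h

lemma measurable_eval_past {i : ℕ × Q} {t : ℕ} (h : i.1 < t) :
    Measurable[past Q Y t] (fun ω : ℕ × Q → Y => ω i) := by
  rw [measurable_iff_comap_le]
  exact le_biSup (fun i : ℕ × Q => MeasurableSpace.comap (fun ω : ℕ × Q → Y => ω i) inferInstance)
    (show i ∈ {i : ℕ × Q | i.1 < t} from h)

lemma past_le (t : ℕ) : past Q Y t ≤ MeasurableSpace.pi := by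
  refine iSup₂_le fun i _ => ?_
  rw [← measurable_iff_comap_le]
  exact measurable_pi_apply i

variable [MeasurableSpace S] [Countable Q]

lemma measurable_trajectory_past (hterm : MeasurableSet terminal)
    (hquery : ∀ q, MeasurableSet {s | query s = q})
    (hstep : Measurable fun z : S × Y => step z.1 z.2) (t : ℕ) :
    Measurable[past Q Y t] fun ω : ℕ × Q → Y => trajectory terminal query step s₀ ω t := by
  induction t with
  | zero => exact measurable_const
  | succ t ih =>
    have h1 : Measurable[past Q Y (t + 1)]
        fun ω : ℕ × Q → Y => trajectory terminal query step s₀ ω t :=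
      ih.mono (past_mono (Nat.le_succ t)) le_rfl
    have h2 : Measurable[past Q Y (t + 1)]
        fun ω : ℕ × Q → Y => ω (t, query (trajectory terminal query step s₀ ω t)) := by
      intro B hB
      have : (fun ω : ℕ × Q → Y => ω (t, query (trajectory terminal query step s₀ ω t))) ⁻¹' B
          = ⋃ q, ((fun ω => trajectory terminal query step s₀ ω t) ⁻¹' {s | query s = q}) ∩
            ((fun ω : ℕ × Q → Y => ω (t, q)) ⁻¹' B) := by
        ext ω
        simp
      rw [this]
      exact MeasurableSet.iUnion fun q => (h1 (hquery q)).inter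
        (measurable_eval_past (Nat.lt_succ_self t) hB)
    simp only [trajectory]
    exact Measurable.ite (h1 hterm) h1 (hstep.comp (h1.prodMk h2))

lemma measurable_trajectory (hterm : MeasurableSet terminal)
    (hquery : ∀ q, MeasurableSet {s | query s = q})
    (hstep : Measurable fun z : S × Y => step z.1 z.2) (t : ℕ) :
    Measurable fun ω : ℕ × Q → Y => trajectory terminal query step s₀ ω t :=
  (measurable_trajectory_past hterm hquery hstep t).mono (past_le t) le_rfl

variable (law : Q → Measure Y) [∀ q, IsProbabilityMeasure (law q)]

/-- The current state is independent of the observations at the current time. -/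
lemma lintegral_trajectory_eval (hterm : MeasurableSet terminal)
    (hquery : ∀ q, MeasurableSet {s | query s = q})
    (hstep : Measurable fun z : S × Y => step z.1 z.2) (t : ℕ) (q : Q)
    {g : S × Y → ℝ≥0∞} (hg : Measurable g) :
    ∫⁻ ω, g (trajectory terminal query step s₀ ω t, ω (t, q))
        ∂(Measure.infinitePi fun i : ℕ × Q => law i.2) =
      ∫⁻ ω, ∫⁻ y, g (trajectory terminal query step s₀ ω t, y) ∂(law q)
        ∂(Measure.infinitePi fun i : ℕ × Q => law i.2) := by
  set P := Measure.infinitePi fun i : ℕ × Q => law i.2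
  have hX := measurable_trajectory (s₀ := s₀) hterm hquery hstep t
  have hE : Measurable fun ω : ℕ × Q → Y => ω (t, q) := measurable_pi_apply _
  have hind : IndepFun (fun ω => trajectory terminal query step s₀ ω t)
      (fun ω : ℕ × Q → Y => ω (t, q)) P := by
    have hi : iIndepFun (fun (i : ℕ × Q) (ω : ℕ × Q → Y) => ω i) P :=
      iIndepFun_infinitePi (X := fun _ => id) (fun _ => measurable_id)
    have h := indep_iSup_of_disjoint (fun i => (measurable_pi_apply i).comap_le) hi
      (S := {i : ℕ × Q | i.1 < t}) (T := {(t, q)}) (by simp)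
    rw [IndepFun_iff_Indep]
    refine indep_of_indep_of_le_left (indep_of_indep_of_le_right h ?_) ?_
    · simp
    · exact (measurable_trajectory_past hterm hquery hstep t).comap_le
  have hmap := (indepFun_iff_map_prod_eq_prod_map_map hX.aemeasurable hE.aemeasurable).1 hind
  have hlaw : P.map (fun ω : ℕ × Q → Y => ω (t, q)) = law q :=
    Measure.infinitePi_map_eval (fun i : ℕ × Q => law i.2) (t, q)
  have : IsProbabilityMeasure (P.map fun ω => trajectory terminal query step s₀ ω t) :=
    Measure.isProbabilityMeasure_map hX.aemeasurable
  rw [← lintegral_map (f := g) hg (hX.prodMk hE), hmap, hlaw, lintegral_prod _ hg.aemeasurable,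
    lintegral_map hg.lintegral_prod_right' hX]

/-- One step of the chain lowers the expected potential by the probability that it was not yet in a
terminal state. -/
lemma lintegral_potential_succ (hterm : MeasurableSet terminal)
    (hquery : ∀ q, MeasurableSet {s | query s = q})
    (hstep : Measurable fun z : S × Y => step z.1 z.2)
    {Inv : S → Prop} (h0 : Inv s₀) (hinv : ∀ s, Inv s → s ∉ terminal → ∀ y, Inv (step s y))
    {V : S → ℝ≥0∞} (hV : Measurable V)
    (hdrift : ∀ s, Inv s → s ∉ terminal → 1 + ∫⁻ y, V (step s y) ∂(law (query s)) ≤ V s) (t : ℕ) :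
    (Measure.infinitePi fun i : ℕ × Q => law i.2)
        {ω | trajectory terminal query step s₀ ω t ∉ terminal} +
      ∫⁻ ω, V (trajectory terminal query step s₀ ω (t + 1))
        ∂(Measure.infinitePi fun i : ℕ × Q => law i.2) ≤
      ∫⁻ ω, V (trajectory terminal query step s₀ ω t)
        ∂(Measure.infinitePi fun i : ℕ × Q => law i.2) := by
  classical
  set P := Measure.infinitePi fun i : ℕ × Q => law i.2
  have hX := measurable_trajectory (s₀ := s₀) hterm hquery hstep t
  have hVs : Measurable fun z : S × Y => V (step z.1 z.2) := hV.comp hstep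
  -- the part of the next potential where the chain is not terminal and samples the source `q`
  let g : Q → S × Y → ℝ≥0∞ := fun q z =>
    Set.indicator {z : S × Y | z.1 ∉ terminal ∧ query z.1 = q} (fun z => V (step z.1 z.2)) z
  have hgm : ∀ q, Measurable (g q) := fun q => hVs.indicator
    ((measurable_fst hterm.compl).inter (measurable_fst (hquery q)))
  have hsplit : ∀ ω : ℕ × Q → Y, V (trajectory terminal query step s₀ ω (t + 1)) =
      Set.indicator terminal V (trajectory terminal query step s₀ ω t) +
        ∑' q, g q (trajectory terminal query step s₀ ω t, ω (t, q)) := by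
    intro ω
    rw [trajectory]
    split_ifs with h
    · simp [g, h]
    · rw [tsum_eq_single (query (trajectory terminal query step s₀ ω t))]
      · simp [g, h]
      · intro q hq
        simp [g, hq.symm]
  have hsum : ∀ ω : ℕ × Q → Y,
      ∑' q, ∫⁻ y, g q (trajectory terminal query step s₀ ω t, y) ∂(law q) =
        Set.indicator terminalᶜ (fun s => ∫⁻ y, V (step s y) ∂(law (query s)))
          (trajectory terminal query step s₀ ω t) := by
    intro ω
    by_cases h : trajectory terminal query step s₀ ω t ∈ terminal
    · simp [g, h]
    · rw [tsum_eq_single (query (trajectory terminal query step s₀ ω t))]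
      · simp [g, h]
      · intro q hq
        simp [g, hq.symm]
  have hset : MeasurableSet {ω | trajectory terminal query step s₀ ω t ∉ terminal} :=
    hX hterm.compl
  simp_rw [hsplit]
  have hVX : Measurable fun ω : ℕ × Q → Y =>
      Set.indicator terminal V (trajectory terminal query step s₀ ω t) :=
    (hV.indicator hterm).comp hX
  have hgX : ∀ q, AEMeasurable (fun ω : ℕ × Q → Y =>
      g q (trajectory terminal query step s₀ ω t, ω (t, q))) P := fun q =>
    ((hgm q).comp (hX.prodMk (measurable_pi_apply _))).aemeasurable
  have hgI : ∀ q, AEMeasurable (fun ω : ℕ × Q → Y =>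
      ∫⁻ y, g q (trajectory terminal query step s₀ ω t, y) ∂(law q)) P := fun q =>
    ((hgm q).lintegral_prod_right'.comp hX).aemeasurable
  rw [lintegral_add_left hVX, lintegral_tsum hgX]
  rw [tsum_congr fun q => lintegral_trajectory_eval law hterm hquery hstep t q (hgm q),
    ← lintegral_tsum hgI, lintegral_congr hsum, ← lintegral_indicator_one hset, ← lintegral_add_left hVX,
    ← lintegral_add_left (measurable_one.indicator hset)]
  refine lintegral_mono fun ω => ?_
  by_cases h : trajectory terminal query step s₀ ω t ∈ terminal
  · simp [h]
  · simpa [h] using hdrift _ (trajectory_invariant h0 hinv ω t) h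

/-- Dynkin's inequality: a potential that drops by at least one per step before the chain reaches a
terminal state bounds the expected number of steps plus the expected terminal potential. -/
theorem tsum_measure_add_le_potential (hterm : MeasurableSet terminal)
    (hquery : ∀ q, MeasurableSet {s | query s = q})
    (hstep : Measurable fun z : S × Y => step z.1 z.2)
    {Inv : S → Prop} (h0 : Inv s₀) (hinv : ∀ s, Inv s → s ∉ terminal → ∀ y, Inv (step s y))
    {V : S → ℝ≥0∞} (hV : Measurable V)
    (hdrift : ∀ s, Inv s → s ∉ terminal → 1 + ∫⁻ y, V (step s y) ∂(law (query s)) ≤ V s)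
    {bad : Set S} {r : ℝ≥0∞} (hbad : ∀ s ∈ terminal ∩ bad, r ≤ V s) (hr : r ≠ ⊤)
    (hVfin : V s₀ ≠ ⊤) :
    ∑' t, (Measure.infinitePi fun i : ℕ × Q => law i.2)
        {ω | trajectory terminal query step s₀ ω t ∉ terminal} +
      r * (Measure.infinitePi fun i : ℕ × Q => law i.2)
        {ω | ∀ t, trajectory terminal query step s₀ ω t ∈ terminal →
          trajectory terminal query step s₀ ω t ∈ bad} ≤ V s₀ := by
  set P := Measure.infinitePi fun i : ℕ × Q => law i.2
  set X := fun (t : ℕ) (ω : ℕ × Q → Y) => trajectory terminal query step s₀ ω t with hXdef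
  have hX : ∀ t, Measurable (X t) := fun t => measurable_trajectory hterm hquery hstep t
  have hsum : ∀ t, ∑ i ∈ Finset.range t, P {ω | X i ω ∉ terminal} + ∫⁻ ω, V (X t ω) ∂P ≤ V s₀ := by
    intro t
    induction t with
    | zero => simp [X, trajectory]
    | succ t ih =>
      refine le_trans ?_ ih
      rw [Finset.sum_range_succ, add_assoc]
      gcongr
      exact lintegral_potential_succ law hterm hquery hstep h0 hinv hV hdrift t
  have hfin : ∑' t, P {ω | X t ω ∉ terminal} ≠ ⊤ := by
    refine ne_top_of_le_ne_top hVfin (ENNReal.tsum_le_of_sum_range_le fun t => ?_)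
    exact le_trans le_self_add (hsum t)
  have hlim : Filter.Tendsto (fun t => r * P {ω | X t ω ∉ terminal}) Filter.atTop (nhds 0) := by
    simpa using ENNReal.Tendsto.const_mul (ENNReal.tendsto_atTop_zero_of_tsum_ne_top hfin)
      (Or.inr hr)
  have hle : ∀ t, r * P {ω | ∀ t, X t ω ∈ terminal → X t ω ∈ bad} ≤
      r * P {ω | X t ω ∉ terminal} + ∫⁻ ω, V (X t ω) ∂P := by
    intro t
    have hset : MeasurableSet {ω | X t ω ∉ terminal} := hX t hterm.compl
    calc r * P {ω | ∀ t, X t ω ∈ terminal → X t ω ∈ bad}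
        ≤ r * (P {ω | X t ω ∉ terminal} + P {ω | r ≤ V (X t ω)}) := by
          gcongr
          refine (measure_mono fun ω hω => ?_).trans (measure_union_le _ _)
          by_cases h : X t ω ∈ terminal
          · exact Or.inr (hbad _ ⟨h, hω t h⟩)
          · exact Or.inl h
      _ ≤ _ := by
          rw [mul_add]
          gcongr
          exact mul_meas_ge_le_lintegral (hV.comp (hX t)) r
  have hmain : ∀ t, ∑ i ∈ Finset.range t, P {ω | X i ω ∉ terminal} +
      r * P {ω | ∀ t, X t ω ∈ terminal → X t ω ∈ bad} ≤
        V s₀ + r * P {ω | X t ω ∉ terminal} := by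
    intro t
    calc _ ≤ ∑ i ∈ Finset.range t, P {ω | X i ω ∉ terminal} +
          (r * P {ω | X t ω ∉ terminal} + ∫⁻ ω, V (X t ω) ∂P) := by gcongr; exact hle t
      _ = (∑ i ∈ Finset.range t, P {ω | X i ω ∉ terminal} + ∫⁻ ω, V (X t ω) ∂P) +
          r * P {ω | X t ω ∉ terminal} := by ring
      _ ≤ _ := by gcongr; exact hsum t
  have h1 := (ENNReal.tendsto_nat_tsum fun t => P {ω | X t ω ∉ terminal}).add_const
    (r * P {ω | ∀ t, X t ω ∈ terminal → X t ω ∈ bad})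
  have h2 : Filter.Tendsto (fun t => V s₀ + r * P {ω | X t ω ∉ terminal}) Filter.atTop
      (nhds (V s₀)) := by simpa using hlim.const_add (V s₀)
  exact le_of_tendsto_of_tendsto' h1 h2 hmain

end Chain

/-! ### Densities, divergences and likelihood ratios -/

namespace Model

variable {Y Θ : Type*} [MeasurableSpace Y] (m : Model Y Θ) (l : ℕ)

lemma measurable_logRatio (θ : Θ) : Measurable (m.logRatio l θ) :=
  Real.measurable_log.comp ((m.measurable_f l θ).coe_nnreal_real.div
    (m.measurable_f l (m.θ₀ l)).coe_nnreal_real)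

lemma measurable_density (θ : Θ) : Measurable fun y => (m.f l θ y : ℝ≥0∞) :=
  (m.measurable_f l θ).coe_nnreal_ennreal

lemma ae_law_density_ne_zero (θ : Θ) : ∀ᵐ y ∂m.law l θ, m.f l θ y ≠ 0 := by
  rw [law, ae_withDensity_iff (m.measurable_density l θ)]
  exact Filter.Eventually.of_forall fun y hy => by simpa using hy

lemma ae_density_ne_zero_of_ac {θ θ' : Θ} (h : m.law l θ ≪ m.law l θ') :
    ∀ᵐ y ∂m.law l θ, m.f l θ' y ≠ 0 :=
  h.ae_le (m.ae_law_density_ne_zero l θ')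

/-- Likelihood ratios against the true parameter have mean at most one. -/
lemma lintegral_ratio_le_one (a b : Θ) :
    ∫⁻ y, ((m.f l b y / m.f l a y : ℝ≥0) : ℝ≥0∞) ∂m.law l a ≤ 1 := by
  have hr : Measurable fun y => ((m.f l b y / m.f l a y : ℝ≥0) : ℝ≥0∞) :=
    ((m.measurable_f l b).div (m.measurable_f l a)).coe_nnreal_ennreal
  rw [law, lintegral_withDensity_eq_lintegral_mul _ (m.measurable_density l a) hr,
    ← m.lintegral_f l b]
  refine lintegral_mono fun y => ?_
  simp only [Pi.mul_apply]
  rw [← ENNReal.coe_mul]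
  refine ENNReal.coe_le_coe.2 ?_
  by_cases h : m.f l a y = 0
  · simp [h]
  · rw [mul_div_cancel₀ _ h]

lemma law_eq_withDensity {a b : Θ} (h : m.law l a ≪ m.law l b) :
    m.law l a = (m.law l b).withDensity fun y => ((m.f l a y / m.f l b y : ℝ≥0) : ℝ≥0∞) := by
  have hr : Measurable fun y => ((m.f l a y / m.f l b y : ℝ≥0) : ℝ≥0∞) :=
    ((m.measurable_f l a).div (m.measurable_f l b)).coe_nnreal_ennreal
  have hae := m.ae_density_ne_zero_of_ac l h
  conv_rhs => rw [law, ← withDensity_mul _ (m.measurable_density l b) hr]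
  rw [law] at hae ⊢
  refine withDensity_congr_ae ?_
  rw [ae_withDensity_iff (m.measurable_density l a)] at hae
  filter_upwards [hae] with y hy
  simp only [Pi.mul_apply]
  rw [← ENNReal.coe_mul]
  by_cases hb : m.f l b y = 0
  · by_cases ha : m.f l a y = 0
    · simp [ha]
    · exact absurd hb (hy (by simpa using ha))
  · rw [mul_div_cancel₀ _ hb]

lemma llr_ae_eq {a b : Θ} (h : m.law l a ≪ m.law l b) :
    llr (m.law l a) (m.law l b) =ᵐ[m.law l a]
      fun y => Real.log ((m.f l a y : ℝ) / (m.f l b y : ℝ)) := by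
  have hr : Measurable fun y => ((m.f l a y / m.f l b y : ℝ≥0) : ℝ≥0∞) :=
    ((m.measurable_f l a).div (m.measurable_f l b)).coe_nnreal_ennreal
  have h1 : (m.law l a).rnDeriv (m.law l b) =ᵐ[m.law l b]
      fun y => ((m.f l a y / m.f l b y : ℝ≥0) : ℝ≥0∞) := by
    conv_lhs => rw [m.law_eq_withDensity l h]
    exact Measure.rnDeriv_withDensity _ hr
  filter_upwards [h.ae_le h1] with y hy
  simp [llr, hy]

/-- Every parameter that a node of level `l` can have. -/
def IsParam (θ : Θ) : Prop := θ = m.θ₀ l ∨ ∃ j, 1 ≤ j ∧ j ≤ 2 ^ l ∧ θ ∈ m.params l j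

lemma isParam_single {θ : Θ} (h : θ ∈ m.params l 1) : m.IsParam l θ :=
  Or.inr ⟨1, le_rfl, Nat.one_le_two_pow, h⟩

variable {m l}

lemma FiniteMoments.memLp (h : m.FiniteMoments) {θ₁ θ : Θ} (h₁ : θ₁ ∈ m.params l 1)
    (hθ : m.IsParam l θ) : MemLp (m.logRatio l θ₁) 2 (m.law l θ) := by
  obtain ⟨-, V, hV⟩ := h
  rw [← evariance_lt_top_iff_memLp (m.measurable_logRatio l θ₁).aestronglyMeasurable]
  exact (hV l θ₁ h₁ θ hθ).trans_lt ENNReal.coe_lt_top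

lemma FiniteMoments.integrable (h : m.FiniteMoments) {θ₁ θ : Θ} (h₁ : θ₁ ∈ m.params l 1)
    (hθ : m.IsParam l θ) : Integrable (m.logRatio l θ₁) (m.law l θ) :=
  (h.memLp h₁ hθ).integrable (by norm_num)

lemma FiniteMoments.normal_ac (h : m.FiniteMoments) {θ₁ : Θ} (h₁ : θ₁ ∈ m.params l 1) :
    m.law l (m.θ₀ l) ≪ m.law l θ₁ :=
  (klDiv_ne_top_iff.1 (h.1 l θ₁ h₁).1).1

lemma FiniteMoments.ac_normal (h : m.FiniteMoments) {θ₁ : Θ} (h₁ : θ₁ ∈ m.params l 1) :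
    m.law l θ₁ ≪ m.law l (m.θ₀ l) :=
  (klDiv_ne_top_iff.1 (h.1 l θ₁ h₁).2).1

variable (m l) in
lemma toReal_kl {a b : Θ} (h : m.law l a ≪ m.law l b) :
    (m.kl l a b).toReal = ∫ y, Real.log ((m.f l a y : ℝ) / (m.f l b y : ℝ)) ∂m.law l a := by
  rw [kl, toReal_klDiv_of_measure_eq h (by simp), integral_congr_ae (m.llr_ae_eq l h)]

lemma FiniteMoments.integral_logRatio_normal (h : m.FiniteMoments) {θ₁ : Θ}
    (h₁ : θ₁ ∈ m.params l 1) :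
    ∫ y, m.logRatio l θ₁ y ∂m.law l (m.θ₀ l) = -(m.kl l (m.θ₀ l) θ₁).toReal := by
  rw [m.toReal_kl l (h.normal_ac h₁), ← integral_neg]
  refine integral_congr_ae (Filter.Eventually.of_forall fun y => ?_)
  simp only [logRatio]
  rw [← Real.log_inv, inv_div]

lemma FiniteMoments.integral_logRatio_self (h : m.FiniteMoments) {θ₁ : Θ}
    (h₁ : θ₁ ∈ m.params l 1) :
    ∫ y, m.logRatio l θ₁ y ∂m.law l θ₁ = (m.kl l θ₁ (m.θ₀ l)).toReal :=
  (m.toReal_kl l (h.ac_normal h₁)).symm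

lemma FiniteMoments.integral_logRatio_normal_le (h : m.FiniteMoments) {Δ : ℝ≥0}
    (hΔ : m.Distinguishable Δ) {θ₁ : Θ} (h₁ : θ₁ ∈ m.params l 1) :
    ∫ y, m.logRatio l θ₁ y ∂m.law l (m.θ₀ l) ≤ -Δ := by
  rw [h.integral_logRatio_normal h₁]
  have := ENNReal.toReal_mono (h.1 l θ₁ h₁).1 (hΔ l θ₁ h₁).1
  simpa using this

lemma FiniteMoments.le_toReal_kl (h : m.FiniteMoments) {Δ : ℝ≥0}
    (hΔ : m.Distinguishable Δ) {θ₁ : Θ} (h₁ : θ₁ ∈ m.params l 1) :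
    (Δ : ℝ) ≤ (m.kl l θ₁ (m.θ₀ l)).toReal := by
  simpa using ENNReal.toReal_mono (h.1 l θ₁ h₁).2 (hΔ l θ₁ h₁).2

/-- Under a law with at least one anomaly, some single-anomaly parameter has a log-likelihood ratio
with drift at least `Δ`. -/
lemma FiniteMoments.exists_le_integral_logRatio (h : m.FiniteMoments) {Δ : ℝ≥0}
    (hΔ : m.Distinguishable Δ) (hΔ' : m.MultiDistinguishable Δ) {j : ℕ} (hj : 1 ≤ j)
    (hj' : j ≤ 2 ^ l) {θ : Θ} (hθ : θ ∈ m.params l j) :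
    ∃ θ₁ ∈ m.params l 1, (Δ : ℝ) ≤ ∫ y, m.logRatio l θ₁ y ∂m.law l θ ∧
      m.law l θ ≪ m.law l θ₁ := by
  rcases Nat.eq_zero_or_pos l with rfl | hl
  · obtain rfl : j = 1 := by simp at hj'; omega
    refine ⟨θ, hθ, ?_, Measure.AbsolutelyContinuous.rfl⟩
    rw [h.integral_logRatio_self hθ]
    exact h.le_toReal_kl hΔ hθ
  · obtain ⟨θ₁, h₁, hfin, hle⟩ := hΔ' l hl j hj hj' θ hθ
    have hP : m.IsParam l θ := Or.inr ⟨j, hj, hj', hθ⟩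
    have hac := (klDiv_ne_top_iff.1 hfin).1
    have hac0 := hac.trans (h.ac_normal h₁)
    refine ⟨θ₁, h₁, ?_, hac⟩
    have hint := h.integrable h₁ hP
    have hint1 : Integrable (fun y => Real.log ((m.f l θ y : ℝ) / (m.f l θ₁ y : ℝ))) (m.law l θ) :=
      (integrable_congr (m.llr_ae_eq l hac)).1 (klDiv_ne_top_iff.1 hfin).2
    -- the log-likelihood ratio of `θ` against `θ₀` splits at `θ₁`, so it is integrable as well
    have hsplit : (fun y => Real.log ((m.f l θ y : ℝ) / (m.f l (m.θ₀ l) y : ℝ))) =ᵐ[m.law l θ]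
        fun y => Real.log ((m.f l θ y : ℝ) / (m.f l θ₁ y : ℝ)) + m.logRatio l θ₁ y := by
      filter_upwards [m.ae_law_density_ne_zero l θ, m.ae_density_ne_zero_of_ac l hac,
        m.ae_density_ne_zero_of_ac l hac0] with y h0 h1 h2
      have h0' : (m.f l θ y : ℝ) ≠ 0 := by exact_mod_cast h0
      have h1' : (m.f l θ₁ y : ℝ) ≠ 0 := by exact_mod_cast h1
      have h2' : (m.f l (m.θ₀ l) y : ℝ) ≠ 0 := by exact_mod_cast h2
      rw [logRatio, Real.log_div h0' h2', Real.log_div h0' h1', Real.log_div h1' h2']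
      ring
    have hfin0 : m.kl l θ (m.θ₀ l) ≠ ⊤ := by
      refine klDiv_ne_top hac0 ((integrable_congr ?_).2 (hint1.add hint))
      exact (m.llr_ae_eq l hac0).trans hsplit
    have hreal := ENNReal.toReal_mono hfin0 hle
    rw [ENNReal.toReal_add hfin ENNReal.coe_ne_top, m.toReal_kl l hac, m.toReal_kl l hac0,
      integral_congr_ae hsplit, integral_add hint1 hint] at hreal
    simp only [ENNReal.coe_toReal] at hreal
    linarith

/-- The Hellinger affinity of two parameters. -/
def affinity (m : Model Y Θ) (l : ℕ) (a b : Θ) : ℝ≥0∞ :=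
  ∫⁻ y, ((NNReal.sqrt (m.f l b y / m.f l a y) : ℝ≥0) : ℝ≥0∞) ∂m.law l a

variable (m l)

lemma measurable_sqrt_ratio (a b : Θ) :
    Measurable fun y => NNReal.sqrt (m.f l b y / m.f l a y) :=
  NNReal.continuous_sqrt.measurable.comp ((m.measurable_f l b).div (m.measurable_f l a))

/-- Parameters of affinity one are indistinguishable under the first of them. -/
lemma density_ae_eq_of_affinity {a b : Θ} (h : 1 ≤ m.affinity l a b) :
    ∀ᵐ y ∂m.law l a, m.f l b y = m.f l a y := by
  have hr : Measurable fun y => (m.f l b y / m.f l a y : ℝ≥0) :=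
    (m.measurable_f l b).div (m.measurable_f l a)
  have hs := m.measurable_sqrt_ratio l a b
  -- the defect in `2 √r ≤ 1 + r` is `(√r - 1)²`, and it integrates to zero
  let d : Y → ℝ≥0 := fun y => Real.toNNReal (((NNReal.sqrt (m.f l b y / m.f l a y) : ℝ) - 1) ^ 2)
  have hd : Measurable d := ((hs.coe_nnreal_real.sub_const 1).pow_const 2).real_toNNReal
  have hpt : ∀ y, (d y : ℝ≥0∞) + 2 * ((NNReal.sqrt (m.f l b y / m.f l a y) : ℝ≥0) : ℝ≥0∞) =
      1 + ((m.f l b y / m.f l a y : ℝ≥0) : ℝ≥0∞) := by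
    intro y
    have : d y + 2 * NNReal.sqrt (m.f l b y / m.f l a y) = 1 + m.f l b y / m.f l a y := by
      rw [← NNReal.coe_inj]
      have hq : (NNReal.sqrt (m.f l b y / m.f l a y) : ℝ) ^ 2 = (m.f l b y / m.f l a y : ℝ≥0) := by
        exact_mod_cast NNReal.sq_sqrt _
      simp only [d, NNReal.coe_add, Real.coe_toNNReal _ (sq_nonneg _), NNReal.coe_mul,
        NNReal.coe_one, NNReal.coe_ofNat]
      linarith
    exact_mod_cast congrArg (fun x : ℝ≥0 => (x : ℝ≥0∞)) this
  have hint : ∫⁻ y, (d y : ℝ≥0∞) ∂m.law l a + 2 * m.affinity l a b ≤ 2 := by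
    rw [affinity, ← lintegral_const_mul _ hs.coe_nnreal_ennreal,
      ← lintegral_add_left hd.coe_nnreal_ennreal, lintegral_congr hpt,
      lintegral_add_left measurable_const]
    simp only [lintegral_const, measure_univ, mul_one]
    rw [← one_add_one_eq_two]
    gcongr
    exact m.lintegral_ratio_le_one l a b
  have hzero : ∫⁻ y, (d y : ℝ≥0∞) ∂m.law l a = 0 := by
    have h2 : ∫⁻ y, (d y : ℝ≥0∞) ∂m.law l a + 2 ≤ 0 + 2 := by
      rw [zero_add]
      refine le_trans ?_ hint
      gcongr
      calc (2 : ℝ≥0∞) = 2 * 1 := (mul_one _).symm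
        _ ≤ _ := by gcongr
    exact le_antisymm ((ENNReal.add_le_add_iff_right (by simp)).1 h2) zero_le
  rw [lintegral_eq_zero_iff hd.coe_nnreal_ennreal] at hzero
  filter_upwards [hzero, m.ae_law_density_ne_zero l a] with y hy ha
  have h0 : d y = 0 := by simpa using hy
  have h1 : (NNReal.sqrt (m.f l b y / m.f l a y) : ℝ) = 1 := by
    have := Real.toNNReal_eq_zero.1 h0
    nlinarith [sq_nonneg ((NNReal.sqrt (m.f l b y / m.f l a y) : ℝ) - 1)]
  have h2 : m.f l b y / m.f l a y = 1 := by
    have h3 : NNReal.sqrt (m.f l b y / m.f l a y) = 1 := by exact_mod_cast h1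
    simpa using h3
  rwa [div_eq_one_iff_eq ha] at h2

end Model

/-! ### Measurability of statistics of finite samples -/

section ListMeasurable

variable {Y β : Type*} [MeasurableSpace Y] [MeasurableSpace β]

/-- A statistic of finite samples is measurable if it is so on the samples of each fixed size. -/
def ListMeasurable (g : List Y → β) : Prop := ∀ n, Measurable fun x : Fin n → Y => g (List.ofFn x)

namespace ListMeasurable

lemma of_length (g : ℕ → β) : ListMeasurable fun xs : List Y => g xs.length := fun n => by
  simp only [List.length_ofFn]
  exact measurable_const

lemma take {g : List Y → β} (hg : ListMeasurable g) (k : ℕ) :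
    ListMeasurable fun xs => g (xs.take k) := fun n => by
  have h : ∀ x : Fin n → Y, (List.ofFn x).take k =
      List.ofFn fun i : Fin (min k n) => x ⟨i, lt_of_lt_of_le i.2 (min_le_right _ _)⟩ := by
    intro x
    apply List.ext_get <;> simp
  simp_rw [h]
  exact (hg (min k n)).comp (measurable_pi_lambda _ fun i => measurable_pi_apply _)

lemma drop {g : List Y → β} (hg : ListMeasurable g) (k : ℕ) :
    ListMeasurable fun xs => g (xs.drop k) := fun n => by
  have h : ∀ x : Fin n → Y, (List.ofFn x).drop k =
      List.ofFn fun i : Fin (n - k) => x ⟨k + i, by omega⟩ := by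
    intro x
    apply List.ext_get <;> simp
  simp_rw [h]
  exact (hg (n - k)).comp (measurable_pi_lambda _ fun i => measurable_pi_apply _)

lemma append {g : List Y → β} (hg : ListMeasurable g) (n k : ℕ) :
    Measurable fun z : (Fin n → Y) × (Fin k → Y) => g (List.ofFn z.1 ++ List.ofFn z.2) := by
  simp_rw [← List.ofFn_fin_append]
  refine (hg (n + k)).comp (measurable_pi_lambda _ fun i => ?_)
  refine Fin.addCases (fun i => ?_) (fun i => ?_) i
  · simp only [Fin.append_left]
    exact (measurable_pi_apply i).comp measurable_fst
  · simp only [Fin.append_right]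
    exact (measurable_pi_apply i).comp measurable_snd

lemma append_singleton {g : List Y → β} (hg : ListMeasurable g) (n : ℕ) :
    Measurable fun z : (Fin n → Y) × Y => g (List.ofFn z.1 ++ [z.2]) :=
  (hg.append n 1).comp (measurable_fst.prodMk (measurable_pi_lambda _ fun _ => measurable_snd))

lemma append_singleton_right {g : List Y → β} (hg : ListMeasurable g) (xs : List Y) :
    Measurable fun y => g (xs ++ [y]) := by
  have h := (hg.append_singleton xs.length).comp (measurable_prodMk_left (x := xs.get))
  simpa [Function.comp_def] using h

lemma map_prod {M : Type*} [CommMonoid M] [MeasurableSpace M] [MeasurableMul₂ M] {φ : Y → M}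
    (hφ : Measurable φ) : ListMeasurable fun xs => (xs.map φ).prod := fun n => by
  simp only [List.map_ofFn, List.prod_ofFn, Function.comp_apply]
  exact Finset.measurable_fun_prod _ fun i _ => hφ.comp (measurable_pi_apply i)

lemma map_sum {M : Type*} [AddCommMonoid M] [MeasurableSpace M] [MeasurableAdd₂ M] {φ : Y → M}
    (hφ : Measurable φ) : ListMeasurable fun xs => (xs.map φ).sum := fun n => by
  simp only [List.map_ofFn, List.sum_ofFn, Function.comp_apply]
  exact Finset.measurable_fun_sum _ fun i _ => hφ.comp (measurable_pi_apply i)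

end ListMeasurable

variable {Θ : Type*} {m : Model Y Θ} {mle : ℕ → List Y → Θ}

/-- A statistic that uses the maximum likelihood estimate is measurable, since the estimate takes
finitely many values. -/
lemma Model.IsMLE.measurable_comp (h : m.IsMLE mle) {l n : ℕ} (hfin : (m.params l 1).Finite)
    {α : Type*} [MeasurableSpace α] {e : α → Fin n → Y} (he : Measurable e) {g : Θ → α → ℝ}
    (hg : ∀ θ, Measurable (g θ)) : Measurable fun a => g (mle l (List.ofFn (e a))) a := by
  intro B hB
  have : (fun a => g (mle l (List.ofFn (e a))) a) ⁻¹' B =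
      ⋃ θ ∈ m.params l 1, e ⁻¹' {x | mle l (List.ofFn x) = θ} ∩ g θ ⁻¹' B := by
    ext x
    simp only [Set.mem_preimage, Set.mem_iUnion, Set.mem_inter_iff, Set.mem_ofPred_eq, exists_prop]
    exact ⟨fun hx => ⟨_, (h.1 l (List.ofFn (e x))).1, rfl, hx⟩,
      by rintro ⟨θ, -, rfl, hx⟩; exact hx⟩
  rw [this]
  exact hfin.measurableSet_biUnion fun θ _ => (he (h.2 l n θ)).inter (hg θ hB)

lemma listMeasurable_gllr (h : m.IsMLE mle) {l : ℕ} (hfin : (m.params l 1).Finite) :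
    ListMeasurable (gllr m mle l) := fun n =>
  h.measurable_comp hfin measurable_id (g := fun θ x => ((List.ofFn x).map (m.logRatio l θ)).sum)
    fun θ => ListMeasurable.map_sum (m.measurable_logRatio l θ) n

variable (m mle) in
lemma allr_nil (N : ℕ) : allr m mle N [] = 0 := by simp [allr]

variable (m mle) in
lemma allr_append_singleton (N : ℕ) (xs : List Y) (y : Y) :
    allr m mle N (xs ++ [y]) =
      allr m mle N xs + if N ≤ xs.length then m.logRatio 0 (mle 0 xs) y else 0 := by
  have hlen : xs.length + 1 = (xs ++ [y]).length := by simp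
  rw [allr, ← (finCongr hlen).sum_comp, Fin.sum_univ_castSucc]
  congr 1
  · refine Finset.sum_congr rfl fun i _ => ?_
    simp [List.take_append_of_le_length i.2.le]
  · simp

variable (m mle) in
lemma allr_eq_zero {N : ℕ} {xs : List Y} (h : xs.length ≤ N) : allr m mle N xs = 0 := by
  refine Finset.sum_eq_zero fun i _ => ?_
  rw [if_neg]
  have := i.2
  omega

lemma listMeasurable_allr (h : m.IsMLE mle) (hfin : (m.params 0 1).Finite) (N : ℕ) :
    ListMeasurable (allr m mle N) := fun n => by
  induction n with
  | zero => simp [allr_nil, measurable_const]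
  | succ n ih =>
    have hs : ∀ x : Fin (n + 1) → Y, allr m mle N (List.ofFn x) =
        allr m mle N (List.ofFn (Fin.init x)) +
          if N ≤ n then m.logRatio 0 (mle 0 (List.ofFn (Fin.init x))) (x (Fin.last n)) else 0 := by
      intro x
      have : List.ofFn x = List.ofFn (Fin.init x) ++ [x (Fin.last n)] := by
        rw [List.ofFn_succ', List.concat_eq_append]
        rfl
      rw [this, allr_append_singleton]
      simp
    have hinit : Measurable (Fin.init : (Fin (n + 1) → Y) → Fin n → Y) :=
      measurable_pi_lambda _ fun i => measurable_pi_apply _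
    simp_rw [hs]
    refine (ih.comp hinit).add ?_
    split_ifs with hN
    · exact h.measurable_comp hfin hinit (g := fun θ x => m.logRatio 0 θ (x (Fin.last n)))
        fun θ => (m.measurable_logRatio 0 θ).comp (measurable_pi_apply _)
    · exact measurable_const

end ListMeasurable

/-! ### Existence of admissible sample sizes -/

section Admissible

/-- Chebyshev's inequality for the event that a sum with positive drift is not positive. -/
lemma measure_pi_sum_nonpos_le {Y : Type*} [MeasurableSpace Y] {ν : Measure Y}
    [IsProbabilityMeasure ν] {X : Y → ℝ} (hX : MemLp X 2 ν) {V : ℝ≥0}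
    (hV : evariance X ν ≤ V) {Δ : ℝ} (hΔ : 0 < Δ) (hmean : Δ ≤ ∫ y, X y ∂ν) {n : ℕ} (hn : 1 ≤ n) :
    (Measure.pi fun _ : Fin n => ν) {x | ∑ i, X (x i) ≤ 0} ≤
      ENNReal.ofReal (V / (n * Δ ^ 2)) := by
  set P := Measure.pi fun _ : Fin n => ν
  have hn' : (0 : ℝ) < n := by exact_mod_cast hn
  have hi : ∀ i : Fin n, MemLp (fun x : Fin n → Y => X (x i)) 2 P := fun i =>
    hX.comp_measurePreserving (measurePreserving_eval (fun _ : Fin n => ν) i)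
  have hT : MemLp (∑ i : Fin n, fun x : Fin n → Y => X (x i)) 2 P := memLp_finsetSum' _ fun i _ => hi i
  have hmeanT : ∫ x, (∑ i : Fin n, fun x : Fin n → Y => X (x i)) x ∂P = n * ∫ y, X y ∂ν := by
    simp only [Finset.sum_apply]
    rw [integral_finsetSum _ fun i _ => (hi i).integrable (by norm_num)]
    have : ∀ i : Fin n, ∫ x, X (x i) ∂P = ∫ y, X y ∂ν := fun i =>
      integral_comp_eval (μ := fun _ : Fin n => ν) hX.1
    simp [this]
  have hvar : variance (∑ i : Fin n, fun x : Fin n → Y => X (x i)) P ≤ n * V := by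
    rw [variance_sum_pi (μ := fun _ : Fin n => ν) (X := fun _ => X) fun _ => hX]
    simp only [Finset.sum_const, Finset.card_univ, Fintype.card_fin, nsmul_eq_mul]
    gcongr
    exact ENNReal.toReal_le_coe_of_le_coe hV
  have hc : 0 < n * Δ := by positivity
  calc P {x | ∑ i, X (x i) ≤ 0}
      ≤ P {x | n * Δ ≤ |(∑ i : Fin n, fun x : Fin n → Y => X (x i)) x -
          ∫ x, (∑ i : Fin n, fun x : Fin n → Y => X (x i)) x ∂P|} := by
        refine measure_mono fun x hx => ?_
        simp only [Set.mem_ofPred_eq] at hx ⊢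
        rw [hmeanT, Finset.sum_apply, abs_sub_comm]
        refine le_trans ?_ (le_abs_self _)
        have : n * Δ ≤ n * ∫ y, X y ∂ν := by gcongr
        linarith
    _ ≤ _ := meas_ge_le_variance_div_sq hT hc
    _ ≤ ENNReal.ofReal (n * V / (n * Δ) ^ 2) := by gcongr
    _ = _ := by
        congr 1
        field_simp

variable {Y Θ : Type*} [MeasurableSpace Y] {m : Model Y Θ} {mle : ℕ → List Y → Θ} {l : ℕ}

/-- The maximal likelihood ratio dominates the likelihood ratio of every single-anomaly parameter
under which, and under the normal parameter, the sample is possible. -/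
lemma Model.IsMLE.sum_logRatio_le_gllr (h : m.IsMLE mle) {θ₁ : Θ} (h₁ : θ₁ ∈ m.params l 1)
    {xs : List Y} (hpos : ∀ y ∈ xs, m.f l θ₁ y ≠ 0) (hpos0 : ∀ y ∈ xs, m.f l (m.θ₀ l) y ≠ 0) :
    (xs.map (m.logRatio l θ₁)).sum ≤ gllr m mle l xs := by
  have hlog : ∀ θ, (∀ y ∈ xs, m.f l θ y ≠ 0) → (xs.map (m.logRatio l θ)).sum =
      Real.log ((xs.map (m.f l θ)).prod : ℝ≥0) -
        (xs.map fun y => Real.log (m.f l (m.θ₀ l) y)).sum := by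
    intro θ hθ
    clear hpos
    induction xs with
    | nil => simp
    | cons y xs ih =>
      have hy : (m.f l θ y : ℝ) ≠ 0 := by exact_mod_cast hθ y (by simp)
      have hy0 : (m.f l (m.θ₀ l) y : ℝ) ≠ 0 := by exact_mod_cast hpos0 y (by simp)
      have hprod : (((xs.map (m.f l θ)).prod : ℝ≥0) : ℝ) ≠ 0 := by
        have : (xs.map (m.f l θ)).prod ≠ 0 := by
          rw [Ne, List.prod_eq_zero_iff]
          simp only [List.mem_map, not_exists, not_and]
          exact fun z hz => hθ z (by simp [hz])
        exact_mod_cast this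
      rw [List.map_cons, List.sum_cons, List.map_cons, List.prod_cons, List.map_cons,
        List.sum_cons, NNReal.coe_mul, Real.log_mul hy hprod,
        ih (fun z hz => hpos0 z (by simp [hz])) fun z hz => hθ z (by simp [hz]), Model.logRatio,
        Real.log_div hy hy0]
      ring
  have hmax := (h.1 l xs).2 θ₁ h₁
  have hp1 : (0 : ℝ≥0) < (xs.map (m.f l θ₁)).prod := by
    rw [pos_iff_ne_zero, Ne, List.prod_eq_zero_iff]
    simpa using hpos
  have hne : ∀ y ∈ xs, m.f l (mle l xs) y ≠ 0 := by
    have h2 := (hp1.trans_le hmax).ne'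
    rw [Ne, List.prod_eq_zero_iff] at h2
    simpa using h2
  rw [gllr, hlog _ hpos, hlog _ hne]
  have : Real.log ((xs.map (m.f l θ₁)).prod : ℝ≥0) ≤
      Real.log ((xs.map (m.f l (mle l xs))).prod : ℝ≥0) :=
    Real.log_le_log (by exact_mod_cast hp1) (by exact_mod_cast hmax)
  linarith

/-- The event that the statistic of a child has the wrong sign. -/
def Child.WrongSign (m : Model Y Θ) (mle : ℕ → List Y → Θ) (l n : ℕ) (a : Child Θ) :
    Set (Fin n → Y) :=
  {x | (a.isSome ∧ ¬ a.Anomalous ∧ 0 < gllr m mle l (List.ofFn x)) ∨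
    (a.Anomalous ∧ gllr m mle l (List.ofFn x) ≤ 0)}

lemma Child.measure_wrongSign_le (hmle : m.IsMLE mle) (hmom : m.FiniteMoments)
    {V : ℝ≥0} (hV : ∀ l, ∀ θ₁ ∈ m.params l 1, ∀ θ : Θ, m.IsParam l θ →
      evariance (m.logRatio l θ₁) (m.law l θ) ≤ (V : ℝ≥0∞))
    {B : ℕ} (hB : (m.params l 1).encard ≤ (B : ℕ∞)) {Δ : ℝ≥0} (hΔ : 0 < Δ)
    (hdist : m.Distinguishable Δ) (hmulti : m.MultiDistinguishable Δ) {a : Child Θ}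
    (ha : a.Possible m l) {n : ℕ} (hn : 1 ≤ n) :
    a.sampleLaw m l n (a.WrongSign m mle l n) ≤
      (B + 1) * ENNReal.ofReal (V / (n * (Δ : ℝ) ^ 2)) := by
  have hΔ' : (0 : ℝ) < Δ := by exact_mod_cast hΔ
  set E := ENNReal.ofReal (V / (n * (Δ : ℝ) ^ 2))
  match a, ha with
  | none, _ => simp [Child.WrongSign, Child.Anomalous]
  | some (k, θ), Or.inl ⟨hk, hθ⟩ =>
    subst hk hθ
    have hF : (m.params l 1).Finite := Set.finite_of_encard_le_coe hB
    have hcard : hF.toFinset.card ≤ B := by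
      have := hF.encard_eq_coe_toFinset_card ▸ hB
      exact_mod_cast this
    simp only [Child.sampleLaw, Option.elim_some]
    calc _ ≤ (Measure.pi fun _ : Fin n => m.law l (m.θ₀ l))
          (⋃ θ₁ ∈ hF.toFinset, {x | ∑ i, (fun y => - m.logRatio l θ₁ y) (x i) ≤ 0}) := by
          refine measure_mono fun x hx => ?_
          simp only [Child.WrongSign, Child.Anomalous, Set.mem_ofPred_eq, Option.isSome_some,
            nonpos_iff_eq_zero, one_ne_zero, not_false_eq_true, true_and, false_and,
            or_false] at hx
          simp only [Set.mem_iUnion, Set.mem_ofPred_eq, exists_prop, Set.Finite.mem_toFinset]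
          refine ⟨_, (hmle.1 l (List.ofFn x)).1, ?_⟩
          rw [Finset.sum_neg_distrib]
          simp only [gllr, List.map_ofFn, List.sum_ofFn, Function.comp_apply] at hx
          linarith
      _ ≤ ∑ θ₁ ∈ hF.toFinset, E := by
          refine (measure_biUnion_finset_le _ _).trans (Finset.sum_le_sum fun θ₁ hθ₁ => ?_)
          rw [Set.Finite.mem_toFinset] at hθ₁
          have h0 : m.IsParam l (m.θ₀ l) := Or.inl rfl
          refine measure_pi_sum_nonpos_le (hmom.memLp hθ₁ h0).neg ?_ hΔ' ?_ hn
          · have := evariance_mul (-1) (m.logRatio l θ₁) (m.law l (m.θ₀ l))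
            simp only [neg_mul, one_mul, even_two, Even.neg_pow, one_pow, ENNReal.ofReal_one]
              at this
            exact this.trans_le <| hV l θ₁ hθ₁ _ h0
          · simp only [Pi.neg_apply]
            rw [integral_neg]
            linarith [hmom.integral_logRatio_normal_le hdist hθ₁]
      _ ≤ B * E := by
          rw [Finset.sum_const, nsmul_eq_mul]
          gcongr
      _ ≤ (B + 1) * E := by gcongr; exact le_self_add
  | some (k, θ), Or.inr ⟨hk, hk', hθ⟩ =>
    simp only [Child.sampleLaw, Option.elim_some]
    obtain ⟨θ₁, h₁, hmean, hac⟩ := hmom.exists_le_integral_logRatio hdist hmulti hk hk' hθ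
    have hP : m.IsParam l θ := Or.inr ⟨k, hk, hk', hθ⟩
    have hae : ∀ᵐ x ∂(Measure.pi fun _ : Fin n => m.law l θ), ∀ i : Fin n,
        m.f l θ₁ (x i) ≠ 0 ∧ m.f l (m.θ₀ l) (x i) ≠ 0 := by
      rw [ae_all_iff]
      intro i
      exact (measurePreserving_eval (fun _ : Fin n => m.law l θ) i).quasiMeasurePreserving.ae
        ((m.ae_density_ne_zero_of_ac l hac).and
          (m.ae_density_ne_zero_of_ac l (hac.trans (hmom.ac_normal h₁))))
    calc _ ≤ (Measure.pi fun _ : Fin n => m.law l θ) {x | ∑ i, m.logRatio l θ₁ (x i) ≤ 0} := by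
          refine measure_mono_ae ?_
          filter_upwards [hae] with x hx hw
          have h2 : gllr m mle l (List.ofFn x) ≤ 0 := by
            rcases hw with hw | hw
            · exact absurd hk hw.2.1
            · exact hw.2
          have h3 := hmle.sum_logRatio_le_gllr h₁ (xs := List.ofFn x)
            (by simpa [List.mem_ofFn] using fun i => (hx i).1)
            (by simpa [List.mem_ofFn] using fun i => (hx i).2)
          simp only [List.map_ofFn, List.sum_ofFn, Function.comp_apply] at h3
          exact h3.trans h2
      _ ≤ E := measure_pi_sum_nonpos_le (hmom.memLp h₁ hP) (hV l θ₁ h₁ θ hP) hΔ' hmean hn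
      _ ≤ (B + 1) * E := le_mul_of_one_le_left' le_add_self

lemma Child.correct_of_notMem_wrongSign {n n' : ℕ} {a b : Child Θ} {x : Fin n → Y}
    {y : Fin n' → Y} (hx : x ∉ a.WrongSign m mle l n) (hy : y ∉ b.WrongSign m mle l n') :
    Move.Correct a b (decideMove
      (a.map fun _ => gllr m mle l (List.ofFn x)) (b.map fun _ => gllr m mle l (List.ofFn y))) := by
  simp only [Child.WrongSign, Set.mem_ofPred_eq, not_or, not_and, not_lt, not_le] at hx hy
  rcases a with _ | ⟨k, θ⟩ <;> rcases b with _ | ⟨k', θ'⟩ <;>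
    simp only [Child.Anomalous, Option.isSome_some, Option.isSome_none, Option.map_some,
      Option.map_none, decideMove, true_implies, not_le, Nat.lt_one_iff] at hx hy ⊢ <;>
    grind [Move.Correct, Child.Anomalous]

theorem exists_admissibleSizes (hmle : m.IsMLE mle)
    (hfin : ∃ B : ℕ, ∀ l, (m.params l 1).encard ≤ (B : ℕ∞)) (hmom : m.FiniteMoments)
    (hdist : ∃ Δ : ℝ≥0, 0 < Δ ∧ m.Distinguishable Δ ∧ m.MultiDistinguishable Δ) :
    ∃ n : ℕ → ℕ, AdmissibleSizes m mle n := by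
  obtain ⟨B, hB⟩ := hfin
  obtain ⟨Δ, hΔ, hd, hm⟩ := hdist
  obtain ⟨V, hV⟩ := hmom.2
  have hΔ' : (0 : ℝ) < Δ := by exact_mod_cast hΔ
  obtain ⟨n, hn⟩ := exists_nat_gt (8 * (B + 1) * V / (Δ : ℝ) ^ 2)
  have hn0 : (0 : ℝ) < n := lt_of_le_of_lt (by positivity) hn
  have hn1 : 1 ≤ n := by exact_mod_cast hn0
  have hsmall : (B + 1) * ENNReal.ofReal (V / (n * (Δ : ℝ) ^ 2)) ≤ ENNReal.ofReal (1 / 8) := by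
    have : ((B : ℝ≥0∞) + 1) = ENNReal.ofReal (B + 1) := by
      rw [ENNReal.ofReal_add (by positivity) zero_le_one, ENNReal.ofReal_natCast,
        ENNReal.ofReal_one]
    rw [this, ← ENNReal.ofReal_mul (by positivity)]
    refine ENNReal.ofReal_le_ofReal ?_
    rw [div_lt_iff₀ (by positivity)] at hn
    rw [← mul_div_assoc, div_le_div_iff₀ (by positivity) (by norm_num)]
    linarith
  refine ⟨fun _ => n, ⟨n, fun _ => le_rfl⟩, 3 / 4, by norm_num, fun l a b ha hb _ => ?_⟩
  have : IsProbabilityMeasure (a.sampleLaw m l n) := by unfold Child.sampleLaw; infer_instance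
  have : IsProbabilityMeasure (b.sampleLaw m l n) := by unfold Child.sampleLaw; infer_instance
  set P := (a.sampleLaw m l n).prod (b.sampleLaw m l n)
  set C := {x : (Fin n → Y) × (Fin n → Y) | Move.Correct a b (decideMove
    (a.map fun _ => gllr m mle l (List.ofFn x.1)) (b.map fun _ => gllr m mle l (List.ofFn x.2)))}
  have h1 : P (a.WrongSign m mle l n ×ˢ Set.univ) ≤ ENNReal.ofReal (1 / 8) := by
    rw [Measure.prod_prod, measure_univ, mul_one]
    exact (Child.measure_wrongSign_le hmle hmom hV (hB l) hΔ hd hm ha hn1).trans hsmall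
  have h2 : P (Set.univ ×ˢ b.WrongSign m mle l n) ≤ ENNReal.ofReal (1 / 8) := by
    rw [Measure.prod_prod, measure_univ, one_mul]
    exact (Child.measure_wrongSign_le hmle hmom hV (hB l) hΔ hd hm hb hn1).trans hsmall
  have hcover : (1 : ℝ≥0∞) ≤ P C + (ENNReal.ofReal (1 / 8) + ENNReal.ofReal (1 / 8)) := by
    calc (1 : ℝ≥0∞) = P Set.univ := measure_univ.symm
      _ ≤ P (C ∪ (a.WrongSign m mle l n ×ˢ Set.univ ∪ Set.univ ×ˢ b.WrongSign m mle l n)) := by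
          refine measure_mono fun x _ => ?_
          by_contra hx
          simp only [Set.mem_union, Set.mem_prod, Set.mem_univ, and_true, true_and, not_or] at hx
          exact hx.1 (Child.correct_of_notMem_wrongSign hx.2.1 hx.2.2)
      _ ≤ P C + P (a.WrongSign m mle l n ×ˢ Set.univ ∪ Set.univ ×ˢ b.WrongSign m mle l n) :=
          measure_union_le _ _
      _ ≤ _ := by
          gcongr
          exact (measure_union_le _ _).trans (add_le_add h1 h2)
  rw [← ENNReal.ofReal_add (by norm_num) (by norm_num)] at hcover
  have h34 : ENNReal.ofReal (3 / 4) + ENNReal.ofReal (1 / 8 + 1 / 8) = 1 := by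
    rw [← ENNReal.ofReal_add (by norm_num) (by norm_num)]
    norm_num
  rw [← h34] at hcover
  exact (ENNReal.add_le_add_iff_right ENNReal.ofReal_ne_top).1 hcover

end Admissible

/-! ### A potential for the overshoot of a random walk -/

section Overshoot

/-- `∫ t in 0..u, max (w - max t 0) 0`, the area under the tail of an overshoot `w ≥ 0`, as an
explicit concave function of `u`. -/
def overshootArea (w u : ℝ) : ℝ := if u ≤ 0 then w * u else (w ^ 2 - max (w - u) 0 ^ 2) / 2

lemma overshootArea_le_tangent {w : ℝ} (hw : 0 ≤ w) {u : ℝ} (hu : 0 ≤ u) (v : ℝ) :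
    overshootArea w v ≤ overshootArea w u + max (w - u) 0 * (v - u) := by
  rcases eq_or_lt_of_le hu with rfl | hu0
  · simp only [overshootArea, le_refl, if_true, sub_zero, max_eq_left hw]
    split_ifs with hv
    · simp
    · rcases max_cases (w - v) 0 with ⟨h, h'⟩ | ⟨h, h'⟩ <;> rw [h] <;> nlinarith
  · simp only [overshootArea, not_le.2 hu0, if_false]
    split_ifs with hv
    · rcases max_cases (w - u) 0 with ⟨h, h'⟩ | ⟨h, h'⟩ <;> rw [h] <;>
        nlinarith [mul_nonneg hw (neg_nonneg.2 hv), mul_nonneg hu (neg_nonneg.2 hv)]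
    · rcases max_cases (w - u) 0 with ⟨h, h'⟩ | ⟨h, h'⟩ <;>
        rcases max_cases (w - v) 0 with ⟨k, k'⟩ | ⟨k, k'⟩ <;> rw [h, k] <;>
        nlinarith [sq_nonneg (u - v), sq_nonneg (w - u), sq_nonneg (w - v)]

lemma overshootArea_le {w : ℝ} (hw : 0 ≤ w) (u : ℝ) : overshootArea w u ≤ w ^ 2 / 2 := by
  rw [overshootArea]
  split_ifs with h
  · nlinarith [sq_nonneg w, mul_nonneg hw (neg_nonneg.2 h)]
  · nlinarith [sq_nonneg (max (w - u) 0)]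

lemma overshootArea_nonneg {w : ℝ} (hw : 0 ≤ w) {u : ℝ} (hu : 0 ≤ u) : 0 ≤ overshootArea w u := by
  rw [overshootArea]
  split_ifs with h
  · exact mul_nonneg hw hu
  · rcases max_cases (w - u) 0 with ⟨k, k'⟩ | ⟨k, k'⟩ <;> rw [k] <;> nlinarith

lemma overshootArea_sub_le {w : ℝ} (hw : 0 ≤ w) {u v : ℝ} (huv : u ≤ v) :
    overshootArea w v - overshootArea w u ≤ w * (v - u) := by
  simp only [overshootArea]
  split_ifs with h h' h'
  · nlinarith
  · nlinarith
  · rcases max_cases (w - v) 0 with ⟨k, k'⟩ | ⟨k, k'⟩ <;> rw [k] <;> nlinarith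
  · rcases max_cases (w - u) 0 with ⟨h, h'⟩ | ⟨h, h'⟩ <;>
        rcases max_cases (w - v) 0 with ⟨k, k'⟩ | ⟨k, k'⟩ <;> rw [h, k] <;> nlinarith

lemma overshootArea_mono {w : ℝ} (hw : 0 ≤ w) : Monotone (overshootArea w) := by
  intro u v huv
  simp only [overshootArea]
  split_ifs with h h' h'
  · nlinarith
  · have : max (w - v) 0 ^ 2 ≤ w ^ 2 := by
      rcases max_cases (w - v) 0 with ⟨k, k'⟩ | ⟨k, k'⟩ <;> rw [k] <;> nlinarith
    nlinarith [mul_nonneg hw (neg_nonneg.2 h)]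
  · linarith
  · have : max (w - v) 0 ^ 2 ≤ max (w - u) 0 ^ 2 := by gcongr
    linarith

lemma measurable_overshootArea : Measurable fun z : ℝ × ℝ => overshootArea z.1 z.2 := by
  unfold overshootArea
  refine Measurable.ite (measurableSet_le measurable_snd measurable_const) ?_ ?_ <;> fun_prop

variable {Y : Type*} [MeasurableSpace Y] {ν : Measure Y} [IsProbabilityMeasure ν]

lemma integrable_overshoot {Z : Y → ℝ} (hZ : MemLp Z 2 ν) (r : ℝ) :
    Integrable (fun y => max (Z y - r) 0) ν :=
  ((hZ.integrable (by norm_num)).sub (integrable_const r)).pos_part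

lemma integral_overshoot_le {Z : Y → ℝ} (hZ : MemLp Z 2 ν) {r : ℝ} (hr : 0 < r) :
    ∫ y, max (Z y - r) 0 ∂ν ≤ (∫ y, Z y ^ 2 ∂ν) / (4 * r) := by
  have hpt : ∀ y, max (Z y - r) 0 ≤ Z y ^ 2 * (1 / (4 * r)) := fun y => by
    rw [mul_one_div, le_div_iff₀ (by positivity)]
    rcases max_cases (Z y - r) 0 with ⟨h, h'⟩ | ⟨h, h'⟩ <;> rw [h]
    · nlinarith [sq_nonneg (Z y - 2 * r)]
    · nlinarith [sq_nonneg (Z y)]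
  calc _ ≤ ∫ y, Z y ^ 2 * (1 / (4 * r)) ∂ν :=
        integral_mono (integrable_overshoot hZ r) (hZ.integrable_sq.mul_const _) hpt
    _ = _ := by rw [integral_mul_const, mul_one_div]

/-- For a random walk with increments of mean `D > 0` and finite variance, the expected time to
climb by `r` is at most `r / D` plus a constant that does not depend on `r`. This is the bound of
Lorden, in the form of a potential `g` of the remaining climb. -/
theorem exists_climb_potential {Z : Y → ℝ} (hZm : Measurable Z) (hZ : MemLp Z 2 ν)
    {D : ℝ} (hD : 0 < D) (hmean : ∫ y, Z y ∂ν = D) :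
    ∃ (g : ℝ → ℝ) (s G : ℝ), 0 ≤ s ∧ 0 ≤ G ∧ Monotone g ∧ (∀ r, 0 ≤ g r) ∧
      (∀ r u, g (r + u) ≤ g r + s * |u|) ∧ (∀ r, 0 ≤ r → r / D ≤ g r ∧ g r ≤ r / D + G) ∧
      ∀ r, 0 ≤ r → ∫⁻ y, ENNReal.ofReal (g (r - Z y)) ∂ν + 1 ≤ ENNReal.ofReal (g r) := by
  have hZi : Integrable Z ν := hZ.integrable (by norm_num)
  have hZ2 : Integrable (fun y => Z y ^ 2) ν := hZ.integrable_sq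
  set M := ∫ y, Z y ^ 2 ∂ν
  -- beyond the distance `r₀` the expected overshoot is at most `D / 2`
  set r₀ : ℝ := M / (2 * D) + 1
  have hM : 0 ≤ M := integral_nonneg fun y => sq_nonneg _
  have hr₀ : 0 < r₀ := by positivity
  set w : Y → ℝ := fun y => max (Z y - r₀) 0
  have hw0 : ∀ y, 0 ≤ w y := fun y => le_max_right _ _
  have hwm : Measurable w := (hZm.sub_const _).max measurable_const
  have hwle : ∀ y, w y ≤ |Z y| := fun y => max_le (by linarith [le_abs_self (Z y)]) (abs_nonneg _)
  have hwi : Integrable w ν := hZi.abs.mono' hwm.aestronglyMeasurable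
    (Filter.Eventually.of_forall fun y => by rw [Real.norm_of_nonneg (hw0 y)]; exact hwle y)
  have hw2le : ∀ y, w y ^ 2 ≤ Z y ^ 2 := fun y => by
    rw [← sq_abs (Z y)]
    exact pow_le_pow_left₀ (hw0 y) (hwle y) 2
  have hw2i : Integrable (fun y => w y ^ 2) ν := hZ2.mono' (hwm.pow_const 2).aestronglyMeasurable
    (Filter.Eventually.of_forall fun y => by
      rw [Real.norm_of_nonneg (sq_nonneg _)]; exact hw2le y)
  set wbar := ∫ y, w y ∂ν
  have hwbar0 : 0 ≤ wbar := integral_nonneg hw0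
  have hwbar : wbar ≤ D / 2 := by
    calc wbar ≤ M / (4 * r₀) := integral_overshoot_le hZ hr₀
      _ ≤ D / 2 := by
          rw [div_le_div_iff₀ (by positivity) (by norm_num)]
          have : D * r₀ = M / 2 + D := by simp only [r₀]; field_simp
          nlinarith
  -- the mean area, and the mean overshoot at remaining distance `r₀ + u`
  have hAm : ∀ u, Measurable fun y => overshootArea (w y) u := fun u =>
    measurable_overshootArea.comp (hwm.prodMk measurable_const)
  have hAabs : ∀ u y, |overshootArea (w y) u| ≤ w y ^ 2 / 2 + w y * |u| := by
    intro u y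
    rw [abs_le]
    constructor
    · rcases le_total 0 u with hu | hu
      · have := overshootArea_nonneg (hw0 y) hu
        have := mul_nonneg (hw0 y) (abs_nonneg u)
        nlinarith [sq_nonneg (w y)]
      · simp only [overshootArea, hu, if_true, abs_of_nonpos hu]
        nlinarith [sq_nonneg (w y)]
    · have := overshootArea_le (hw0 y) u
      have := mul_nonneg (hw0 y) (abs_nonneg u)
      linarith
  have hAi : ∀ u, Integrable (fun y => overshootArea (w y) u) ν := fun u =>
    ((hw2i.div_const 2).add (hwi.mul_const |u|)).mono' (hAm u).aestronglyMeasurable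
      (Filter.Eventually.of_forall fun y => hAabs u y)
  set ψ : ℝ → ℝ := fun u => ∫ y, overshootArea (w y) u ∂ν
  set φ : ℝ → ℝ := fun u => ∫ y, max (w y - u) 0 ∂ν
  have hφi : ∀ u, 0 ≤ u → Integrable (fun y => max (w y - u) 0) ν := fun u hu =>
    hwi.mono' ((hwm.sub_const u).max measurable_const).aestronglyMeasurable
      (Filter.Eventually.of_forall fun y => by
        rw [Real.norm_of_nonneg (le_max_right _ _)]
        exact max_le (by linarith) (hw0 y))
  have hφ0 : ∀ u, 0 ≤ φ u := fun u => integral_nonneg fun y => le_max_right _ _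
  have hψmono : Monotone ψ := fun u v huv =>
    integral_mono (hAi u) (hAi v) fun y => overshootArea_mono (hw0 y) huv
  have hψ0 : ∀ u, 0 ≤ u → 0 ≤ ψ u := fun u hu =>
    integral_nonneg fun y => overshootArea_nonneg (hw0 y) hu
  have hψle : ∀ u, ψ u ≤ M / 2 := fun u => by
    calc ψ u ≤ ∫ y, Z y ^ 2 / 2 ∂ν := integral_mono (hAi u) (hZ2.div_const 2) fun y => by
          have := overshootArea_le (hw0 y) u
          have := hw2le y
          simp only
          linarith
      _ = M / 2 := integral_div _ _
  have hψtan : ∀ u, 0 ≤ u → ∀ v, ψ v ≤ ψ u + φ u * (v - u) := fun u hu v => by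
    simp only [ψ, φ]
    rw [← integral_mul_const, ← integral_add (hAi u) ((hφi u hu).mul_const _)]
    exact integral_mono (hAi v) ((hAi u).add ((hφi u hu).mul_const _))
      fun y => overshootArea_le_tangent (hw0 y) hu v
  have hψlip : ∀ u v, u ≤ v → ψ v - ψ u ≤ wbar * (v - u) := fun u v huv => by
    simp only [ψ, wbar]
    rw [← integral_sub (hAi v) (hAi u), ← integral_mul_const]
    exact integral_mono ((hAi v).sub (hAi u)) (hwi.mul_const _)
      fun y => overshootArea_sub_le (hw0 y) huv
  have hψneg : ∀ u, u ≤ 0 → ψ u = wbar * u := fun u hu => by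
    simp only [ψ, wbar]
    rw [← integral_mul_const]
    refine integral_congr_ae (Filter.Eventually.of_forall fun y => ?_)
    simp [overshootArea, hu]
  set κ : ℝ := 2 / D ^ 2
  have hκ : 0 < κ := by positivity
  have hκD : κ * D = 2 / D := by simp only [κ]; field_simp
  -- the potential before it is cut off at zero; it is concave with slope at most `s`
  set F : ℝ → ℝ := fun u => (r₀ + u) / D + κ * (wbar * r₀ + ψ u)
  set s : ℝ := 1 / D + κ * wbar
  have hs : 0 ≤ s := by positivity
  have hsle : s ≤ κ * D := by
    have : κ * wbar ≤ 1 / D := by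
      calc κ * wbar ≤ κ * (D / 2) := by gcongr
        _ = 1 / D := by simp only [κ]; field_simp
    rw [hκD]
    calc s ≤ 1 / D + 1 / D := by simp only [s]; linarith
      _ = 2 / D := by ring
  have hFmono : Monotone F := fun u v huv => by
    have := hψmono huv
    simp only [F]
    gcongr
  have hFlip : ∀ u v, u ≤ v → F v ≤ F u + s * (v - u) := fun u v huv => by
    have h := mul_le_mul_of_nonneg_left (hψlip u v huv) hκ.le
    have : F v - F u = (v - u) / D + κ * (ψ v - ψ u) := by simp only [F]; ring
    have : s * (v - u) = (v - u) / D + κ * (wbar * (v - u)) := by simp only [s]; ring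
    linarith
  have hFnonneg : ∀ u, -r₀ ≤ u → 0 ≤ F u := fun u hu => by
    have h1 : 0 ≤ wbar * r₀ + ψ u := by
      rcases le_total 0 u with h | h
      · have := hψ0 u h
        positivity
      · rw [hψneg u h]
        nlinarith
    have h2 : 0 ≤ (r₀ + u) / D := div_nonneg (by linarith) hD.le
    have := mul_nonneg hκ.le h1
    simp only [F]
    linarith
  have hFneg : ∀ u, u ≤ -r₀ → F u = s * (r₀ + u) := fun u hu => by
    simp only [F, s]
    rw [hψneg u (by linarith)]
    ring
  refine ⟨fun u => max (F u) 0, s, r₀ / D + κ * (wbar * r₀ + M / 2), hs, by positivity,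
    hFmono.max monotone_const, fun u => le_max_right _ _, ?_, ?_, ?_⟩
  · intro r u
    refine max_le ?_ (add_nonneg (le_max_right _ _) (by positivity))
    rcases le_total 0 u with hu | hu
    · have := hFlip r (r + u) (by linarith)
      rw [abs_of_nonneg hu]
      have := le_max_left (F r) 0
      linarith
    · have := hFmono (show r + u ≤ r by linarith)
      have := le_max_left (F r) 0
      have : 0 ≤ s * |u| := by positivity
      linarith
  · intro r hr
    have hF0 := hFnonneg r (by linarith)
    have h1 := hψ0 r hr
    have h2 := hψle r
    simp only [max_eq_left hF0, F]
    have h3 : (r₀ + r) / D = r₀ / D + r / D := add_div _ _ _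
    constructor
    · have : 0 ≤ r₀ / D + κ * (wbar * r₀ + ψ r) := by positivity
      linarith
    · have := mul_le_mul_of_nonneg_left h2 hκ.le
      linarith
  · intro r hr
    have hF0 := hFnonneg r (by linarith)
    have hpt : ∀ y, max (F (r - Z y)) 0 ≤
        F r - (1 / D + κ * φ r) * Z y + s * max (w y - r) 0 := by
      intro y
      have h1 : F (r - Z y) ≤ F r - (1 / D + κ * φ r) * Z y := by
        have h := mul_le_mul_of_nonneg_left (hψtan r hr (r - Z y)) hκ.le
        have h3 : F (r - Z y) - F r = - Z y / D + κ * (ψ (r - Z y) - ψ r) := by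
          simp only [F]; ring
        have h4 : (1 / D + κ * φ r) * Z y = Z y / D + κ * (φ r * Z y) := by ring
        have h5 : - Z y / D = -(Z y / D) := by ring
        nlinarith
      have h2 : 0 ≤ s * max (w y - r) 0 := mul_nonneg hs (le_max_right _ _)
      refine max_le (by linarith) ?_
      rcases le_total (-r₀) (r - Z y) with h | h
      · have := hFnonneg _ h
        linarith
      · have h3 := hFneg _ h
        have h4 : w y = Z y - r₀ := max_eq_left (by linarith)
        have h5 : max (w y - r) 0 = w y - r := max_eq_left (by rw [h4]; linarith)
        rw [h5, h4]
        nlinarith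
    have hint : Integrable (fun y => F r - (1 / D + κ * φ r) * Z y + s * max (w y - r) 0) ν :=
      ((integrable_const _).sub (hZi.const_mul _)).add ((hφi r hr).const_mul s)
    have hval : ∫ y, (F r - (1 / D + κ * φ r) * Z y + s * max (w y - r) 0) ∂ν ≤ F r - 1 := by
      have hlin : Integrable (fun y => F r - (1 / D + κ * φ r) * Z y) ν :=
        (integrable_const _).sub (hZi.const_mul _)
      rw [integral_add hlin ((hφi r hr).const_mul s),
        integral_sub (integrable_const _) (hZi.const_mul _), integral_const_mul,
        integral_const_mul, hmean]
      simp only [integral_const, probReal_univ, one_smul]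
      have h1 : (1 / D + κ * φ r) * D = 1 + κ * D * φ r := by field_simp
      have h2 := mul_le_mul_of_nonneg_right hsle (hφ0 r)
      rw [h1]
      change F r - (1 + κ * D * φ r) + s * φ r ≤ F r - 1
      linarith
    have hpos : ∀ y, 0 ≤ F r - (1 / D + κ * φ r) * Z y + s * max (w y - r) 0 := fun y =>
      (le_max_right _ _).trans (hpt y)
    have h1 : 0 ≤ F r - 1 := (integral_nonneg hpos).trans hval
    calc _ ≤ ∫⁻ y, ENNReal.ofReal (F r - (1 / D + κ * φ r) * Z y + s * max (w y - r) 0) ∂ν + 1 := by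
          gcongr with y
          exact hpt y
      _ = ENNReal.ofReal (∫ y, (F r - (1 / D + κ * φ r) * Z y + s * max (w y - r) 0) ∂ν) + 1 := by
          rw [ofReal_integral_eq_lintegral_ofReal hint (Filter.Eventually.of_forall hpos)]
      _ ≤ ENNReal.ofReal (F r - 1) + 1 := by gcongr
      _ = ENNReal.ofReal (F r) := by
          rw [← ENNReal.ofReal_one, ← ENNReal.ofReal_add h1 zero_le_one, sub_add_cancel]
      _ ≤ _ := ENNReal.ofReal_le_ofReal (le_max_left _ _)

end Overshoot

/-! ### The test at a leaf -/

section LeafTest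

variable {Y Θ : Type*} [MeasurableSpace Y] {m : Model Y Θ} {mle : ℕ → List Y → Θ} {l : ℕ}

/-- Under the normal law the likelihood ratio has mean at most one. -/
lemma Model.FiniteMoments.lintegral_exp_logRatio_le (hmom : m.FiniteMoments) {θ : Θ}
    (hθ : θ ∈ m.params l 1) :
    ∫⁻ y, ENNReal.ofReal (Real.exp (m.logRatio l θ y)) ∂m.law l (m.θ₀ l) ≤ 1 := by
  refine le_trans (lintegral_mono_ae ?_) (m.lintegral_ratio_le_one l (m.θ₀ l) θ)
  filter_upwards [m.ae_law_density_ne_zero l (m.θ₀ l),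
    m.ae_density_ne_zero_of_ac l (hmom.normal_ac hθ)] with y h0 h1
  rw [Model.logRatio, ← NNReal.coe_div, Real.exp_log
    (by exact_mod_cast pos_iff_ne_zero.2 (div_ne_zero h1 h0)), ENNReal.ofReal_coe_nnreal]

/-- Under an anomalous law the inverse of the likelihood ratio has mean at most one. -/
lemma Model.FiniteMoments.lintegral_exp_neg_logRatio_le (hmom : m.FiniteMoments) {θ : Θ}
    (hθ : θ ∈ m.params l 1) :
    ∫⁻ y, ENNReal.ofReal (Real.exp (-m.logRatio l θ y)) ∂m.law l θ ≤ 1 := by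
  refine le_trans (lintegral_mono_ae ?_) (m.lintegral_ratio_le_one l θ (m.θ₀ l))
  filter_upwards [m.ae_law_density_ne_zero l θ,
    m.ae_density_ne_zero_of_ac l (hmom.ac_normal hθ)] with y h0 h1
  rw [Model.logRatio, ← Real.log_inv, inv_div, ← NNReal.coe_div, Real.exp_log
    (by exact_mod_cast pos_iff_ne_zero.2 (div_ne_zero h1 h0)), ENNReal.ofReal_coe_nnreal]

/-- The potential of the test at a normal leaf: the expected number of samples is bounded, and a
penalty `pen` for declaring the leaf, which happens if the statistic exceeds `A`, costs at most
`pen * exp (-A)` in expectation, because the exponential of the statistic is a supermartingale. -/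
theorem exists_normalLeaf_potential (hmle : m.IsMLE mle) (hfin : (m.params 0 1).Finite)
    (hmom : m.FiniteMoments) {Δ : ℝ≥0} (hΔ : 0 < Δ) (hdist : m.Distinguishable Δ) :
    ∃ T : ℝ≥0, ∀ (N : ℕ) (A pen : ℝ), 0 ≤ pen → ∃ Φ : List Y → ℝ≥0∞, ListMeasurable Φ ∧
      Φ [] ≤ N + T + ENNReal.ofReal (pen * Real.exp (-A)) ∧
      (∀ xs, A < allr m mle N xs → ENNReal.ofReal pen ≤ Φ xs) ∧
      ∀ xs, 0 ≤ allr m mle N xs →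
        1 + ∫⁻ y, Φ (xs ++ [y]) ∂m.law 0 (m.θ₀ 0) ≤ Φ xs := by
  have hΔ' : (0 : ℝ) < Δ := by exact_mod_cast hΔ
  set P := m.law 0 (m.θ₀ 0)
  have h0 : m.IsParam 0 (m.θ₀ 0) := Or.inl rfl
  -- a common bound of the second moments
  set M : ℝ := ∑ θ ∈ hfin.toFinset, ∫ y, m.logRatio 0 θ y ^ 2 ∂P
  have hM : ∀ θ ∈ m.params 0 1, ∫ y, m.logRatio 0 θ y ^ 2 ∂P ≤ M := fun θ hθ =>
    Finset.single_le_sum (f := fun θ => ∫ y, m.logRatio 0 θ y ^ 2 ∂P)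
      (fun θ _ => integral_nonneg fun y => sq_nonneg _) (hfin.mem_toFinset.2 hθ)
  have hM0 : 0 ≤ M := Finset.sum_nonneg fun θ _ => integral_nonneg fun y => sq_nonneg _
  set r₀ : ℝ := M / (2 * Δ) + 1
  have hr₀ : 0 < r₀ := by positivity
  have htail : ∀ θ ∈ m.params 0 1, ∫ y, max (-m.logRatio 0 θ y - r₀) 0 ∂P ≤ Δ / 2 := by
    intro θ hθ
    have h := integral_overshoot_le (hmom.memLp hθ h0).neg hr₀
    simp only [Pi.neg_apply, neg_sq] at h
    refine h.trans ((div_le_div_of_nonneg_right (hM θ hθ) (by positivity)).trans ?_)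
    rw [div_le_div_iff₀ (by positivity) (by norm_num)]
    have : Δ * r₀ = M / 2 + Δ := by simp only [r₀]; field_simp
    nlinarith
  refine ⟨Real.toNNReal (2 / Δ * r₀), fun N A pen hpen => ?_⟩
  set Φ : List Y → ℝ≥0∞ := fun xs => ((N - xs.length : ℕ) : ℝ≥0∞) +
    ENNReal.ofReal (2 / Δ * max (allr m mle N xs + r₀) 0) +
    ENNReal.ofReal (pen * Real.exp (allr m mle N xs - A))
  have hS := listMeasurable_allr hmle hfin N
  refine ⟨Φ, ?_, ?_, ?_, ?_⟩
  · intro n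
    have h1 := hS n
    exact ((ListMeasurable.of_length (fun k => ((N - k : ℕ) : ℝ≥0∞)) n).add
      (((h1.add_const r₀).max measurable_const).const_mul _).ennreal_ofReal).add
      ((Real.measurable_exp.comp (h1.sub_const A)).const_mul _).ennreal_ofReal
  · simp only [Φ, allr_nil, List.length_nil, Nat.sub_zero, zero_add, zero_sub,
      max_eq_left hr₀.le]
    rfl
  · intro xs hxs
    refine le_trans ?_ le_add_self
    refine ENNReal.ofReal_le_ofReal (le_mul_of_one_le_right hpen ?_)
    exact Real.one_le_exp (by linarith)
  · intro xs hxs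
    rcases lt_or_ge xs.length N with hN | hN
    · have h1 : ∀ y, Φ (xs ++ [y]) = ((N - (xs.length + 1) : ℕ) : ℝ≥0∞) +
          ENNReal.ofReal (2 / Δ * max (allr m mle N xs + r₀) 0) +
          ENNReal.ofReal (pen * Real.exp (allr m mle N xs - A)) := fun y => by
        simp only [Φ, allr_append_singleton, not_le.2 hN, if_false, add_zero, List.length_append,
          List.length_singleton]
      simp only [h1, lintegral_const, measure_univ, mul_one, Φ]
      rw [← add_assoc, ← add_assoc]
      gcongr
      have : N - xs.length = 1 + (N - (xs.length + 1)) := by omega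
      rw [this]
      push_cast
      rfl
    · set S := allr m mle N xs
      set X := m.logRatio 0 (mle 0 xs)
      have hmem := (hmle.1 0 xs).1
      have hXm : Measurable X := m.measurable_logRatio 0 _
      have hXL : MemLp X 2 P := hmom.memLp hmem h0
      have hXi : Integrable X P := hmom.integrable hmem h0
      have h1 : ∀ y, Φ (xs ++ [y]) = ENNReal.ofReal (2 / Δ * max (S + X y + r₀) 0) +
          ENNReal.ofReal (pen * Real.exp (S - A)) * ENNReal.ofReal (Real.exp (X y)) := fun y => by
        have : N - (xs.length + 1) = 0 := by omega
        simp only [Φ, allr_append_singleton, hN, if_true, List.length_append,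
          List.length_singleton, this, Nat.cast_zero, zero_add]
        rw [← ENNReal.ofReal_mul (by positivity), mul_assoc, ← Real.exp_add]
        congr 4
        ring
      have hΦ : Φ xs = ENNReal.ofReal (2 / Δ * (S + r₀)) +
          ENNReal.ofReal (pen * Real.exp (S - A)) := by
        have : N - xs.length = 0 := by omega
        simp only [Φ, this, Nat.cast_zero, zero_add]
        rw [max_eq_left (by linarith)]
      have hmeas : Measurable fun y => ENNReal.ofReal (2 / Δ * max (S + X y + r₀) 0) :=
        ((((hXm.const_add S).add_const r₀).max measurable_const).const_mul _).ennreal_ofReal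
      have hdrift : 1 + ∫⁻ y, ENNReal.ofReal (2 / Δ * max (S + X y + r₀) 0) ∂P ≤
          ENNReal.ofReal (2 / Δ * (S + r₀)) := by
        have hov : Integrable (fun y => max (-X y - r₀) 0) P := integrable_overshoot hXL.neg r₀
        have hpt : ∀ y, 2 / Δ * max (S + X y + r₀) 0 ≤
            2 / Δ * (S + r₀ + X y + max (-X y - r₀) 0) := fun y => by
          gcongr
          rcases max_cases (-X y - r₀) 0 with ⟨h, h'⟩ | ⟨h, h'⟩ <;> rw [h] <;>
            exact max_le (by linarith) (by linarith)
        have hlin : Integrable (fun y => S + r₀ + X y) P := (integrable_const _).add hXi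
        have hint : Integrable (fun y => 2 / Δ * (S + r₀ + X y + max (-X y - r₀) 0)) P :=
          (hlin.add hov).const_mul _
        have hpos : ∀ y, 0 ≤ 2 / Δ * (S + r₀ + X y + max (-X y - r₀) 0) := fun y =>
          le_trans (by positivity) (hpt y)
        have hval : ∫ y, 2 / Δ * (S + r₀ + X y + max (-X y - r₀) 0) ∂P ≤
            2 / Δ * (S + r₀) - 1 := by
          rw [integral_const_mul, integral_add hlin hov, integral_add (integrable_const _) hXi]
          simp only [integral_const, probReal_univ, one_smul]
          have h2 := hmom.integral_logRatio_normal_le hdist hmem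
          have h3 := htail _ hmem
          have h4 : 2 / (Δ : ℝ) * (S + r₀) - 1 = 2 / Δ * (S + r₀ - Δ / 2) := by field_simp
          rw [h4]
          gcongr
          change S + r₀ + ∫ y, m.logRatio 0 (mle 0 xs) y ∂m.law 0 (m.θ₀ 0) +
            ∫ y, max (-m.logRatio 0 (mle 0 xs) y - r₀) 0 ∂P ≤ _
          linarith
        have hv0 : 0 ≤ 2 / Δ * (S + r₀) - 1 := (integral_nonneg hpos).trans hval
        calc _ ≤ 1 + ∫⁻ y, ENNReal.ofReal (2 / Δ * (S + r₀ + X y + max (-X y - r₀) 0)) ∂P := by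
              exact add_le_add le_rfl (lintegral_mono fun y => ENNReal.ofReal_le_ofReal (hpt y))
          _ = 1 + ENNReal.ofReal (∫ y, 2 / Δ * (S + r₀ + X y + max (-X y - r₀) 0) ∂P) := by
              rw [ofReal_integral_eq_lintegral_ofReal hint (Filter.Eventually.of_forall hpos)]
          _ ≤ ENNReal.ofReal 1 + ENNReal.ofReal (2 / Δ * (S + r₀) - 1) := by
              rw [ENNReal.ofReal_one]
              gcongr
          _ = _ := by
              rw [← ENNReal.ofReal_add zero_le_one hv0]
              congr 1
              ring
      simp_rw [h1]
      rw [hΦ, lintegral_add_left hmeas, lintegral_const_mul' _ _ ENNReal.ofReal_ne_top, ← add_assoc]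
      gcongr
      exact mul_le_of_le_one_right' (hmom.lintegral_exp_logRatio_le hmem)

/-- One step of a random walk with drift upwards goes up with positive probability. -/
lemma lintegral_min_exp_neg_lt_one {ν : Measure Y} [IsProbabilityMeasure ν] {Z : Y → ℝ}
    (hZm : Measurable Z) (hmean : 0 < ∫ y, Z y ∂ν) :
    ∫⁻ y, ENNReal.ofReal (min 1 (Real.exp (-Z y))) ∂ν < 1 := by
  have hm : Measurable fun y => min 1 (Real.exp (-Z y)) :=
    measurable_const.min (Real.measurable_exp.comp hZm.neg)
  have hle : ∫⁻ y, ENNReal.ofReal (min 1 (Real.exp (-Z y))) ∂ν ≤ 1 := by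
    calc _ ≤ ∫⁻ _, 1 ∂ν := lintegral_mono fun y => by
          rw [← ENNReal.ofReal_one]
          exact ENNReal.ofReal_le_ofReal (min_le_left _ _)
      _ = 1 := by simp
  refine lt_of_le_of_ne hle fun h => ?_
  have hae : (fun y => ENNReal.ofReal (min 1 (Real.exp (-Z y)))) =ᵐ[ν] fun _ => 1 := by
    refine ae_eq_of_ae_le_of_lintegral_le (Filter.Eventually.of_forall fun y => ?_) (by rw [h]; simp)
      aemeasurable_const (by rw [h]; simp)
    rw [← ENNReal.ofReal_one]
    exact ENNReal.ofReal_le_ofReal (min_le_left _ _)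
  have : ∫ y, Z y ∂ν ≤ 0 := by
    refine integral_nonpos_of_ae ?_
    filter_upwards [hae] with y hy
    rw [ENNReal.ofReal_eq_one] at hy
    have h2 : 1 ≤ Real.exp (-Z y) := hy ▸ min_le_right _ _
    have := Real.one_le_exp_iff.1 h2
    simp only [Pi.zero_apply]
    linarith
  linarith

end LeafTest

section AnomalousLeaf

variable {Y Θ : Type*} [MeasurableSpace Y] {m : Model Y Θ} {mle : ℕ → List Y → Θ}

/-- The sum of the square roots of the likelihood ratios, against the true parameter `θ`, of the
parameters in `s`. It is at least one whenever the maximum likelihood estimate is in `s`, and it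
contracts in expectation with every further sample. -/
def rootRatioSum (m : Model Y Θ) (θ : Θ) (s : Finset Θ) (xs : List Y) : ℝ≥0 :=
  ∑ θ' ∈ s, (xs.map fun y => NNReal.sqrt (m.f 0 θ' y / m.f 0 θ y)).prod

lemma listMeasurable_rootRatioSum (θ : Θ) (s : Finset Θ) :
    ListMeasurable (rootRatioSum m θ s) := fun n =>
  Finset.measurable_fun_sum _ fun θ' _ =>
    ListMeasurable.map_prod (m.measurable_sqrt_ratio 0 θ θ') n

lemma lintegral_rootRatioSum_le {θ : Θ} {s : Finset Θ} {ρ : ℝ≥0}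
    (hρ : ∀ θ' ∈ s, m.affinity 0 θ θ' ≤ ρ) (xs : List Y) :
    ∫⁻ y, (rootRatioSum m θ s (xs ++ [y]) : ℝ≥0∞) ∂m.law 0 θ ≤ ρ * rootRatioSum m θ s xs := by
  simp only [rootRatioSum, List.map_append, List.prod_append, List.map_cons, List.map_nil,
    List.prod_singleton, ENNReal.ofNNReal_finsetSum, ENNReal.coe_mul, Finset.mul_sum]
  rw [lintegral_finsetSum _ fun θ' _ =>
    ((m.measurable_sqrt_ratio 0 θ θ').coe_nnreal_ennreal).const_mul _]
  refine Finset.sum_le_sum fun θ' hθ' => ?_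
  rw [lintegral_const_mul' _ _ ENNReal.coe_ne_top, mul_comm]
  gcongr
  exact hρ θ' hθ'

lemma one_le_rootRatioSum (hmle : m.IsMLE mle) {θ : Θ} (hθ : θ ∈ m.params 0 1) {s : Finset Θ}
    {xs : List Y} (hpos : ∀ y ∈ xs, m.f 0 θ y ≠ 0) (hs : mle 0 xs ∈ s) :
    1 ≤ rootRatioSum m θ s xs := by
  have hprod : ∀ ys : List Y, (ys.map fun y => NNReal.sqrt (m.f 0 (mle 0 xs) y / m.f 0 θ y)).prod =
      NNReal.sqrt ((ys.map (m.f 0 (mle 0 xs))).prod / (ys.map (m.f 0 θ)).prod) := by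
    intro ys
    induction ys with
    | nil => simp
    | cons y ys ih =>
      rw [List.map_cons, List.prod_cons, ih, ← NNReal.sqrt_mul]
      simp [mul_div_mul_comm]
  have hne : (xs.map (m.f 0 θ)).prod ≠ 0 := by
    rw [Ne, List.prod_eq_zero_iff]
    simpa using hpos
  calc (1 : ℝ≥0) ≤ (xs.map fun y => NNReal.sqrt (m.f 0 (mle 0 xs) y / m.f 0 θ y)).prod := by
        rw [hprod, NNReal.one_le_sqrt, one_le_div (pos_iff_ne_zero.2 hne)]
        exact (hmle.1 0 xs).2 θ hθ
    _ ≤ _ := Finset.single_le_sum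
        (f := fun θ' => (xs.map fun y => NNReal.sqrt (m.f 0 θ' y / m.f 0 θ y)).prod)
        (fun _ _ => zero_le) hs

/-- The potential of the test at an anomalous leaf with true parameter `θ`. The
declaration of the leaf costs nothing, and a move to the parent costs `b + e`, where `b` exceeds the
expected duration `A / D` of a walk of the statistic to `A` by a constant; the excess `e` is charged
only with a factor `h < 1`. -/
theorem exists_anomalousLeaf_potential (hmle : m.IsMLE mle) (hfin : (m.params 0 1).Finite)
    (hmom : m.FiniteMoments) {Δ : ℝ≥0} (hΔ : 0 < Δ) (hdist : m.Distinguishable Δ) {θ : Θ}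
    (hθ : θ ∈ m.params 0 1) :
    ∃ h : ℝ≥0, h < 1 ∧ ∃ (N₀ : ℕ) (G : ℝ≥0), ∀ N : ℕ, N₀ ≤ N → ∀ A : ℝ, 0 ≤ A → ∀ (e : ℝ≥0) (b : ℝ),
      A / (m.kl 0 θ (m.θ₀ 0)).toReal + G ≤ b → ∃ Φ : List Y → ℝ≥0∞, ListMeasurable Φ ∧
      Φ [] ≤ ENNReal.ofReal b + N + G + h * e ∧
      (∀ xs, N < xs.length → allr m mle N xs < 0 → ENNReal.ofReal b + e ≤ Φ xs) ∧
      ∀ xs, 0 ≤ allr m mle N xs → allr m mle N xs ≤ A →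
        1 + ∫⁻ y, Φ (xs ++ [y]) ∂m.law 0 θ ≤ Φ xs := by
  classical
  set P := m.law 0 θ
  have hP : m.IsParam 0 θ := m.isParam_single 0 hθ
  set Z := m.logRatio 0 θ
  have hZm : Measurable Z := m.measurable_logRatio 0 θ
  set D := (m.kl 0 θ (m.θ₀ 0)).toReal
  have hD : 0 < D := lt_of_lt_of_le (by exact_mod_cast hΔ) (hmom.le_toReal_kl hdist hθ)
  have hmean : ∫ y, Z y ∂P = D := hmom.integral_logRatio_self hθ
  obtain ⟨g, s, G₀, hs, hG₀, hgmono, hg0, hglip, hgbd, hgdrift⟩ :=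
    exists_climb_potential hZm (hmom.memLp hθ hP) hD hmean
  lift s to ℝ≥0 using hs
  lift G₀ to ℝ≥0 using hG₀
  -- the parameters that can be told apart from `θ`
  set bad : Finset Θ := hfin.toFinset.filter fun θ' => m.affinity 0 θ θ' < 1
  obtain ⟨ρ, hρ1, hρ⟩ : ∃ ρ : ℝ≥0, ρ < 1 ∧ ∀ θ' ∈ bad, m.affinity 0 θ θ' ≤ ρ := by
    refine ⟨bad.sup fun θ' => (m.affinity 0 θ θ').toNNReal, ?_, fun θ' hθ' => ?_⟩
    · rw [Finset.sup_lt_iff (by simp)]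
      intro θ' hθ'
      have h1 := (Finset.mem_filter.1 hθ').2
      rw [← ENNReal.coe_lt_coe, ENNReal.coe_toNNReal h1.ne_top]
      exact h1
    · have h1 := (Finset.mem_filter.1 hθ').2
      rw [← ENNReal.coe_toNNReal h1.ne_top]
      exact ENNReal.coe_le_coe.2 (Finset.le_sup (f := fun θ' => (m.affinity 0 θ θ').toNNReal) hθ')
  have hρ1' : (0 : ℝ≥0) < 1 - ρ := tsub_pos_of_lt hρ1
  set M : ℝ≥0 := ∑ θ' ∈ hfin.toFinset, (∫⁻ y, ‖m.logRatio 0 θ' y‖ₑ ∂P).toNNReal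
  have hM : ∀ θ' ∈ m.params 0 1, ∫⁻ y, ‖m.logRatio 0 θ' y‖ₑ ∂P ≤ M := fun θ' hθ' => by
    have hne : ∫⁻ y, ‖m.logRatio 0 θ' y‖ₑ ∂P ≠ ⊤ := (hmom.integrable hθ' hP).2.ne
    rw [← ENNReal.coe_toNNReal hne]
    exact ENNReal.coe_le_coe.2 (Finset.single_le_sum
      (f := fun θ' => (∫⁻ y, ‖m.logRatio 0 θ' y‖ₑ ∂P).toNNReal) (fun _ _ => zero_le)
      (hfin.mem_toFinset.2 hθ'))
  obtain ⟨h₀, hh₀, hh₀1⟩ : ∃ h₀ : ℝ≥0,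
      ∫⁻ y, ENNReal.ofReal (min 1 (Real.exp (-Z y))) ∂P ≤ h₀ ∧ h₀ < 1 := by
    have hlt := lintegral_min_exp_neg_lt_one hZm (by rw [hmean]; exact hD)
    refine ⟨_, (ENNReal.coe_toNNReal hlt.ne_top).ge, ?_⟩
    rw [← ENNReal.coe_lt_coe, ENNReal.coe_toNNReal hlt.ne_top]
    exact hlt
  have hh₀1' : (0 : ℝ≥0) < 1 - h₀ := tsub_pos_of_lt hh₀1
  -- after `N₀` samples, the estimate is so reliable that its later errors cost little
  obtain ⟨N₀, hN₀⟩ : ∃ N₀ : ℕ, ∀ N, N₀ ≤ N → ρ ^ N * (bad.card : ℝ≥0) ≤ (1 - h₀) / 2 * (1 - ρ) := by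
    have hlim : Filter.Tendsto (fun N : ℕ => ρ ^ N * (bad.card : ℝ≥0)) Filter.atTop (nhds 0) := by
      simpa using (NNReal.tendsto_pow_atTop_nhds_zero_of_lt_one hρ1).mul_const (bad.card : ℝ≥0)
    have hpos : (0 : ℝ≥0) < (1 - h₀) / 2 * (1 - ρ) := by positivity
    obtain ⟨N₀, h⟩ := Filter.eventually_atTop.1 (hlim.eventually (gt_mem_nhds hpos))
    exact ⟨N₀, fun N hN => (h N hN).le⟩
  have hh : h₀ + (1 - h₀) / 2 < 1 := by
    calc h₀ + (1 - h₀) / 2 < h₀ + (1 - h₀) := by gcongr; exact half_lt_self hh₀1'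
      _ = 1 := add_tsub_cancel_of_le hh₀1.le
  refine ⟨h₀ + (1 - h₀) / 2, hh, N₀, G₀ + (1 + s * M), fun N hN A hA e b hb => ?_⟩
  set κ : ℝ≥0 := (1 + s * M + e) / (1 - ρ)
  have hκ : κ * (1 - ρ) = 1 + s * M + e := div_mul_cancel₀ _ hρ1'.ne'
  have hκρ : κ = κ * ρ + (1 + s * M + e) := by
    rw [← hκ, ← mul_add, add_tsub_cancel_of_le hρ1.le, mul_one]
  have hgA : g A ≤ b := by
    have h1 := (hgbd A hA).2
    push_cast at hb
    have : (0 : ℝ) ≤ 1 + s * M := by positivity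
    linarith
  set S := allr m mle N
  have hSm : ListMeasurable S := listMeasurable_allr hmle hfin N
  set H : List Y → ℝ≥0∞ := fun xs =>
    if xs.length ≤ N then (h₀ : ℝ≥0∞) else ENNReal.ofReal (min 1 (Real.exp (-S xs)))
  set W : List Y → ℝ≥0∞ := fun xs => (rootRatioSum m θ bad xs : ℝ≥0∞)
  -- The terms stand for the part of `b` that is not used yet, the initial samples that are still to
  -- be drawn, the climb to `A`, the later errors of the estimate, and the probability of a move up.
  set Ψ : List Y → ℝ≥0∞ := fun xs => ENNReal.ofReal (b - g A) + (N - xs.length : ℕ) +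
    ENNReal.ofReal (g (A - S xs)) + κ * (ρ : ℝ≥0∞) ^ (N - xs.length) * W xs + e * H xs
  set good : List Y → Prop := fun xs => ∀ y ∈ xs, m.f 0 θ y ≠ 0
  have hHm : ListMeasurable H := fun n => by
    simp only [H, List.length_ofFn]
    split_ifs
    · exact measurable_const
    · exact (measurable_const.min (Real.measurable_exp.comp (hSm n).neg)).ennreal_ofReal
  have hWm : ListMeasurable W := fun n => (listMeasurable_rootRatioSum θ bad n).coe_nnreal_ennreal
  have hΨm : ListMeasurable Ψ := fun n => by
    simp only [Ψ, List.length_ofFn]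
    exact (((measurable_const.add measurable_const).add
      (hgmono.measurable.comp ((hSm n).const_sub A)).ennreal_ofReal).add
      ((hWm n).const_mul _)).add ((hHm n).const_mul _)
  -- samples of density zero under `θ` do not occur
  refine ⟨fun xs => if good xs then Ψ xs else ⊤, ?_, ?_, ?_, ?_⟩
  · intro n
    refine Measurable.ite ?_ (hΨm n) measurable_const
    have : {x : Fin n → Y | good (List.ofFn x)} = ⋂ i, {x | m.f 0 θ (x i) ≠ 0} := by
      ext x
      simp [good, List.mem_ofFn]
    rw [this]
    exact MeasurableSet.iInter fun i =>
      ((m.measurable_f 0 θ).comp (measurable_pi_apply i)) (measurableSet_singleton 0).compl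
  · have hgood : good [] := by simp [good]
    have hW : W [] = (bad.card : ℝ≥0∞) := by simp [W, rootRatioSum]
    have hest : κ * ρ ^ N * (bad.card : ℝ≥0) + e * h₀ ≤ (1 + s * M) + (h₀ + (1 - h₀) / 2) * e := by
      have h1 : (1 - h₀) / 2 ≤ 1 :=
        (half_le_self zero_le).trans tsub_le_self
      calc κ * ρ ^ N * (bad.card : ℝ≥0) + e * h₀ = κ * (ρ ^ N * bad.card) + e * h₀ := by ring
        _ ≤ κ * ((1 - h₀) / 2 * (1 - ρ)) + e * h₀ :=
          add_le_add (mul_le_mul' le_rfl (hN₀ N hN)) le_rfl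
        _ = (κ * (1 - ρ)) * ((1 - h₀) / 2) + e * h₀ := by ring
        _ = (1 + s * M) * ((1 - h₀) / 2) + (h₀ + (1 - h₀) / 2) * e := by rw [hκ]; ring
        _ ≤ (1 + s * M) * 1 + (h₀ + (1 - h₀) / 2) * e := by gcongr
        _ = _ := by rw [mul_one]
    have hest' : (κ : ℝ≥0∞) * (ρ : ℝ≥0∞) ^ N * (bad.card : ℝ≥0∞) + e * h₀ ≤
        ((1 + s * M : ℝ≥0) : ℝ≥0∞) + ((h₀ + (1 - h₀) / 2 : ℝ≥0) : ℝ≥0∞) * e := by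
      exact_mod_cast hest
    simp only [hgood, if_true, Ψ, S, allr_nil, sub_zero, List.length_nil, Nat.sub_zero, hW, H,
      zero_le, add_assoc]
    calc _ = (ENNReal.ofReal (b - g A) + ENNReal.ofReal (g A)) + N +
          (κ * (ρ : ℝ≥0∞) ^ N * (bad.card : ℝ≥0∞) + e * h₀) := by ring
      _ ≤ ENNReal.ofReal b + N + (((1 + s * M : ℝ≥0) : ℝ≥0∞) +
          ((h₀ + (1 - h₀) / 2 : ℝ≥0) : ℝ≥0∞) * e) := by
          rw [← ENNReal.ofReal_add (by linarith) (hg0 A), sub_add_cancel]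
          gcongr
      _ ≤ _ := by
          simp only [add_assoc]
          exact add_le_add le_rfl (add_le_add le_rfl
            (add_le_add (ENNReal.coe_le_coe.2 le_add_self) le_rfl))
  · intro xs hlen hneg
    by_cases hgood : good xs
    · simp only [hgood, if_true, Ψ, H, not_le.2 hlen, if_false]
      have h1 : min 1 (Real.exp (-S xs)) = 1 := by
        rw [min_eq_left]
        exact Real.one_le_exp (by linarith)
      have h2 : ENNReal.ofReal b ≤ ENNReal.ofReal (b - g A) + ENNReal.ofReal (g (A - S xs)) := by
        rw [← ENNReal.ofReal_add (by linarith) (hg0 _)]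
        refine ENNReal.ofReal_le_ofReal ?_
        have := hgmono (show A ≤ A - S xs by linarith)
        linarith
      rw [h1, ENNReal.ofReal_one, mul_one]
      gcongr
      calc _ ≤ _ := h2
        _ ≤ ENNReal.ofReal (b - g A) + (N - xs.length : ℕ) + ENNReal.ofReal (g (A - S xs)) := by
            gcongr; exact le_self_add
        _ ≤ _ := le_self_add
    · simp [hgood]
  · intro xs hS0 hSA
    by_cases hgood : good xs
    swap
    · simp [hgood]
    have hae : ∀ᵐ y ∂P, (if good (xs ++ [y]) then Ψ (xs ++ [y]) else ⊤) = Ψ (xs ++ [y]) := by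
      filter_upwards [m.ae_law_density_ne_zero 0 θ] with y hy
      rw [if_pos]
      intro z hz
      rcases List.mem_append.1 hz with hz | hz
      · exact hgood z hz
      · rw [List.mem_singleton.1 hz]
        exact hy
    rw [lintegral_congr_ae hae]
    simp only [hgood, if_true]
    have hWle := lintegral_rootRatioSum_le hρ xs
    have hWm' : Measurable fun y => W (xs ++ [y]) := hWm.append_singleton_right xs
    have hHm' : Measurable fun y => H (xs ++ [y]) := hHm.append_singleton_right xs
    rcases lt_or_ge xs.length N with hlen | hlen
    · -- initial samples
      have h1 : ∀ y, Ψ (xs ++ [y]) = (ENNReal.ofReal (b - g A) + (N - (xs.length + 1) : ℕ) +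
          ENNReal.ofReal (g (A - S xs)) + e * h₀) +
          κ * (ρ : ℝ≥0∞) ^ (N - (xs.length + 1)) * W (xs ++ [y]) := fun y => by
        have h2 : S (xs ++ [y]) = S xs := by
          simp [S, allr_append_singleton, not_le.2 hlen]
        have h3 : H (xs ++ [y]) = h₀ := if_pos (by simpa using hlen)
        simp only [Ψ, h2, h3, List.length_append, List.length_singleton]
        ring
      have h2 : Ψ xs = (ENNReal.ofReal (b - g A) + (N - (xs.length + 1) : ℕ) +
          ENNReal.ofReal (g (A - S xs)) + e * h₀) +
          κ * (ρ : ℝ≥0∞) ^ (N - (xs.length + 1)) * (ρ * W xs) + 1 := by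
        have h3 : H xs = h₀ := if_pos hlen.le
        have h4 : N - xs.length = N - (xs.length + 1) + 1 := by omega
        simp only [Ψ, h3]
        rw [h4, pow_succ]
        push_cast
        ring
      simp_rw [h1]
      rw [h2, lintegral_add_left measurable_const, lintegral_const, measure_univ, mul_one,
        lintegral_const_mul _ hWm', add_comm]
      gcongr
    · have hsub : N - xs.length = 0 := by omega
      set X := m.logRatio 0 (mle 0 xs)
      have hXm : Measurable X := m.measurable_logRatio 0 _
      have hSy : ∀ y, S (xs ++ [y]) = S xs + X y := fun y => by
        simp [S, allr_append_singleton, hlen, X]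
      have hgm : Measurable fun y => ENNReal.ofReal (g (A - S xs - X y)) :=
        (hgmono.measurable.comp (hXm.const_sub _)).ennreal_ofReal
      have h1 : ∀ y, Ψ (xs ++ [y]) = ENNReal.ofReal (b - g A) +
          ENNReal.ofReal (g (A - S xs - X y)) + κ * W (xs ++ [y]) + e * H (xs ++ [y]) := fun y => by
        have h3 : N - (xs.length + 1) = 0 := by omega
        simp only [Ψ, hSy, List.length_append, List.length_singleton, h3, Nat.cast_zero, add_zero,
          pow_zero, mul_one, sub_sub]
      have h2 : Ψ xs = ENNReal.ofReal (b - g A) +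
          ENNReal.ofReal (g (A - S xs)) + κ * W xs + e * H xs := by
        simp only [Ψ, hsub, Nat.cast_zero, add_zero, pow_zero, mul_one]
      have hm1 : Measurable fun y => ENNReal.ofReal (b - g A) +
          ENNReal.ofReal (g (A - S xs - X y)) := measurable_const.add hgm
      have hm2 : Measurable fun y => ENNReal.ofReal (b - g A) +
          ENNReal.ofReal (g (A - S xs - X y)) + κ * W (xs ++ [y]) := hm1.add (hWm'.const_mul _)
      simp_rw [h1]
      rw [h2, lintegral_add_left hm2, lintegral_add_left hm1, lintegral_add_left measurable_const,
        lintegral_const, measure_univ, mul_one, lintegral_const_mul _ hWm',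
        lintegral_const_mul _ hHm']
      have hHle : ∫⁻ y, H (xs ++ [y]) ∂P ≤ 1 := by
        calc _ ≤ ∫⁻ _, 1 ∂P := lintegral_mono fun y => by
              simp only [H]
              split_ifs
              · exact_mod_cast hh₀1.le
              · rw [← ENNReal.ofReal_one]
                exact ENNReal.ofReal_le_ofReal (min_le_left _ _)
          _ = 1 := by simp
      by_cases hbad : mle 0 xs ∈ bad
      · -- a wrong estimate is paid for by the contraction of `W`
        have hW1 : 1 ≤ W xs := by
          exact ENNReal.one_le_coe_iff.2 (one_le_rootRatioSum hmle hθ hgood hbad)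
        have hg1 : ∫⁻ y, ENNReal.ofReal (g (A - S xs - X y)) ∂P ≤
            ENNReal.ofReal (g (A - S xs)) + s * M := by
          calc _ ≤ ∫⁻ y, (ENNReal.ofReal (g (A - S xs)) + s * ‖X y‖ₑ) ∂P := by
                refine lintegral_mono fun y => ?_
                have h3 := hglip (A - S xs) (-X y)
                rw [abs_neg, ← sub_eq_add_neg] at h3
                refine (ENNReal.ofReal_le_ofReal h3).trans ?_
                rw [ENNReal.ofReal_add (hg0 _) (by positivity), ENNReal.ofReal_mul s.coe_nonneg,
                  ENNReal.ofReal_coe_nnreal, Real.enorm_eq_ofReal_abs]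
            _ = ENNReal.ofReal (g (A - S xs)) + s * ∫⁻ y, ‖X y‖ₑ ∂P := by
                rw [lintegral_add_left measurable_const, lintegral_const_mul _ hXm.enorm]
                simp
            _ ≤ _ := by gcongr; exact hM _ (hmle.1 0 xs).1
        calc _ ≤ 1 + (ENNReal.ofReal (b - g A) + (ENNReal.ofReal (g (A - S xs)) + s * M) +
              κ * (ρ * W xs) + e * 1) := by gcongr
          _ = ENNReal.ofReal (b - g A) + ENNReal.ofReal (g (A - S xs)) +
              (κ * ρ * W xs + (1 + s * M + e) * 1) := by ring
          _ ≤ ENNReal.ofReal (b - g A) + ENNReal.ofReal (g (A - S xs)) +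
              (κ * ρ * W xs + (1 + s * M + e) * W xs) := by gcongr
          _ = ENNReal.ofReal (b - g A) + ENNReal.ofReal (g (A - S xs)) +
              ((κ * ρ + (1 + s * M + e) : ℝ≥0) : ℝ≥0∞) * W xs := by push_cast; ring
          _ = ENNReal.ofReal (b - g A) + ENNReal.ofReal (g (A - S xs)) + κ * W xs := by
              rw [← hκρ]
          _ ≤ _ := le_self_add
      · -- otherwise the increment is almost surely the log-likelihood ratio of `θ`
        have haff : 1 ≤ m.affinity 0 θ (mle 0 xs) := by
          by_contra hlt
          exact hbad (Finset.mem_filter.2 ⟨hfin.mem_toFinset.2 (hmle.1 0 xs).1, not_le.1 hlt⟩)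
        have hXZ : ∀ᵐ y ∂P, X y = Z y := by
          filter_upwards [m.density_ae_eq_of_affinity 0 haff] with y hy
          simp only [X, Z, Model.logRatio, hy]
        have hg1 : ∫⁻ y, ENNReal.ofReal (g (A - S xs - X y)) ∂P + 1 ≤
            ENNReal.ofReal (g (A - S xs)) := by
          have h3 : ∫⁻ y, ENNReal.ofReal (g (A - S xs - X y)) ∂P =
              ∫⁻ y, ENNReal.ofReal (g (A - S xs - Z y)) ∂P :=
            lintegral_congr_ae (hXZ.mono fun y hy => by simp only [hy])
          rw [h3]
          exact hgdrift (A - S xs) (by linarith)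
        have hH1 : ∫⁻ y, H (xs ++ [y]) ∂P ≤ H xs := by
          have h3 : ∫⁻ y, H (xs ++ [y]) ∂P =
              ∫⁻ y, ENNReal.ofReal (min 1 (Real.exp (-(S xs + Z y)))) ∂P := by
            refine lintegral_congr_ae (hXZ.mono fun y hy => ?_)
            have h4 : ¬ xs.length + 1 ≤ N := by omega
            simp only [H, List.length_append, List.length_singleton, h4, if_false, hSy, hy]
          rw [h3]
          rcases eq_or_lt_of_le hlen with h4 | h4
          · have h5 : S xs = 0 := allr_eq_zero m mle h4.ge
            have h6 : H xs = h₀ := if_pos h4.ge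
            rw [h5, h6]
            simpa using hh₀
          · have h5 : H xs = ENNReal.ofReal (Real.exp (-S xs)) := by
              simp only [H, not_le.2 h4, if_false]
              rw [min_eq_right (Real.exp_le_one_iff.2 (by linarith))]
            calc _ ≤ ∫⁻ y, ENNReal.ofReal (Real.exp (-S xs)) *
                  ENNReal.ofReal (Real.exp (-Z y)) ∂P := by
                  refine lintegral_mono fun y => ?_
                  rw [← ENNReal.ofReal_mul (Real.exp_pos _).le, ← Real.exp_add, neg_add]
                  exact ENNReal.ofReal_le_ofReal (min_le_right _ _)
              _ = ENNReal.ofReal (Real.exp (-S xs)) *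
                  ∫⁻ y, ENNReal.ofReal (Real.exp (-Z y)) ∂P :=
                lintegral_const_mul' _ _ ENNReal.ofReal_ne_top
              _ ≤ ENNReal.ofReal (Real.exp (-S xs)) * 1 := by
                gcongr; exact hmom.lintegral_exp_neg_logRatio_le hθ
              _ = H xs := by rw [mul_one, h5]
        have hW2 : ∫⁻ y, W (xs ++ [y]) ∂P ≤ W xs := by
          refine hWle.trans ?_
          exact mul_le_of_le_one_left' (by exact_mod_cast hρ1.le)
        calc _ = ENNReal.ofReal (b - g A) + (∫⁻ y, ENNReal.ofReal (g (A - S xs - X y)) ∂P + 1) +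
              κ * ∫⁻ y, W (xs ++ [y]) ∂P + e * ∫⁻ y, H (xs ++ [y]) ∂P := by ring
          _ ≤ _ := by gcongr

end AnomalousLeaf

/-! ### The test at an internal node -/

section InternalTest

variable {Y : Type*} [MeasurableSpace Y]

/-- The expectation of `G` after `r` more samples, if `xs` are the samples drawn so far and
the sample with index `k` has the law `ν k`. -/
def sampleIntegral (ν : ℕ → Measure Y) (G : List Y → ℝ≥0∞) : ℕ → List Y → ℝ≥0∞
  | 0, xs => G xs
  | r + 1, xs => ∫⁻ y, sampleIntegral ν G r (xs ++ [y]) ∂ν xs.length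

variable {ν : ℕ → Measure Y} {G : List Y → ℝ≥0∞}

lemma ListMeasurable.sampleIntegral [∀ k, IsProbabilityMeasure (ν k)] (hG : ListMeasurable G)
    (r : ℕ) : ListMeasurable (sampleIntegral ν G r) := by
  induction r with
  | zero => exact hG
  | succ r ih =>
    intro n
    simp only [HDS.sampleIntegral, List.length_ofFn]
    exact (ih.append_singleton n).lintegral_prod_right'

lemma sampleIntegral_add (r k : ℕ) (xs : List Y) :
    sampleIntegral ν G (k + r) xs = sampleIntegral ν (sampleIntegral ν G k) r xs := by
  induction r generalizing xs with
  | zero => rfl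
  | succ r ih => exact lintegral_congr fun y => ih _

lemma ListMeasurable.append_left {β : Type*} [MeasurableSpace β] {g : List Y → β}
    (hg : ListMeasurable g) (xs : List Y) : ListMeasurable fun ys => g (xs ++ ys) := fun n => by
  have h := (hg.append xs.length n).comp (measurable_prodMk_left (x := xs.get))
  simpa [Function.comp_def] using h

/-- Identically distributed samples that are drawn one by one form a sample of the product law. -/
lemma sampleIntegral_eq_lintegral_pi {P : Measure Y} [IsProbabilityMeasure P]
    (hG : ListMeasurable G) {n : ℕ} {xs : List Y} (hν : ∀ i < n, ν (xs.length + i) = P) :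
    sampleIntegral ν G n xs = ∫⁻ x : Fin n → Y, G (xs ++ List.ofFn x) ∂Measure.pi fun _ => P := by
  induction n generalizing xs with
  | zero => simp [sampleIntegral]
  | succ n ih =>
    have h0 : ν xs.length = P := hν 0 (Nat.succ_pos n)
    have h1 : ∀ y, sampleIntegral ν G n (xs ++ [y]) =
        ∫⁻ x : Fin n → Y, G (xs ++ [y] ++ List.ofFn x) ∂Measure.pi fun _ => P := fun y =>
      ih fun i hi => by
        rw [List.length_append, List.length_singleton, add_assoc, add_comm 1]
        exact hν (i + 1) (by omega)
    have hm : Measurable fun z : Y × (Fin n → Y) => G (xs ++ [z.1] ++ List.ofFn z.2) := by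
      have h := ((hG.append_left xs).append 1 n).comp
        ((measurable_pi_lambda (fun (z : Y × (Fin n → Y)) (_ : Fin 1) => z.1)
          fun _ => measurable_fst).prodMk measurable_snd)
      simpa [Function.comp_def] using h
    simp only [sampleIntegral, h0, h1]
    rw [← lintegral_prod _ hm.aemeasurable,
      ← (measurePreserving_piFinSuccAbove (fun _ : Fin (n + 1) => P) 0).lintegral_comp hm]
    refine lintegral_congr fun x => ?_
    simp [MeasurableEquiv.piFinSuccAbove, List.ofFn_succ, Fin.tail_def]

variable {Θ : Type*} {m : Model Y Θ} {mle : ℕ → List Y → Θ} {l : ℕ}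

/-- The number of samples of an internal test with children `a` and `b`. -/
def Child.testLength (n : ℕ) (a b : Child Θ) : ℕ := if a.isSome ∧ b.isSome then 2 * n else n

/-- The law of the sample with index `i` of an internal test with children `a` and `b`: first the
left child is sampled, then the right one. -/
def Child.testLaw (m : Model Y Θ) (l n : ℕ) (a b : Child Θ) (i : ℕ) : Measure Y :=
  if a.isSome ∧ (b.isSome → i < n) then m.law l (a.elim (m.θ₀ l) Prod.snd)
  else m.law l (b.elim (m.θ₀ l) Prod.snd)

instance (n : ℕ) (a b : Child Θ) (i : ℕ) : IsProbabilityMeasure (Child.testLaw m l n a b i) := by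
  unfold Child.testLaw
  split_ifs <;> infer_instance

/-- The outcome of an internal test with children `a` and `b` and samples `xs`. -/
def Child.testMove (m : Model Y Θ) (mle : ℕ → List Y → Θ) (l n : ℕ) (a b : Child Θ)
    (xs : List Y) : Move :=
  decideMove (a.map fun _ => gllr m mle l (xs.take n))
    (b.map fun _ => gllr m mle l (if a.isSome then xs.drop n else xs))

lemma measurable_val_decideMove {α γ ι : Type*} [MeasurableSpace α] [MeasurableSpace γ]
    (val : Move → γ) (a b : Option ι) {g₁ g₂ : α → ℝ} (h₁ : Measurable g₁) (h₂ : Measurable g₂) :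
    Measurable fun x => val (decideMove (a.map fun _ => g₁ x) (b.map fun _ => g₂ x)) := by
  have hlt : ∀ {g : α → ℝ}, Measurable g → MeasurableSet {x | 0 < g x} := fun hg =>
    measurableSet_lt measurable_const hg
  rcases a with _ | a <;> rcases b with _ | b <;>
    simp only [Option.map_some, Option.map_none, decideMove, apply_ite val]
  · exact measurable_const
  · exact Measurable.ite (hlt h₂) measurable_const measurable_const
  · exact Measurable.ite (hlt h₁) measurable_const measurable_const
  · exact Measurable.ite ((hlt h₁).union (hlt h₂))
      (Measurable.ite (measurableSet_le h₂ h₁) measurable_const measurable_const) measurable_const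

lemma listMeasurable_val_testMove (hmle : m.IsMLE mle) (hfin : (m.params l 1).Finite)
    {γ : Type*} [MeasurableSpace γ] (val : Move → γ) (n : ℕ) (a b : Child Θ) :
    ListMeasurable fun xs => val (Child.testMove m mle l n a b xs) := fun k => by
  have hg := listMeasurable_gllr hmle hfin
  refine measurable_val_decideMove val a b (hg.take n k) ?_
  split_ifs
  · exact hg.drop n k
  · exact hg k

instance (n : ℕ) (a : Child Θ) : IsProbabilityMeasure (a.sampleLaw m l n) := by
  unfold Child.sampleLaw
  infer_instance

/-- Samples drawn one by one give the same law of the outcome as independent samples from the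
two children. -/
lemma sampleIntegral_testMove (hmle : m.IsMLE mle) (hfin : (m.params l 1).Finite)
    (val : Move → ℝ≥0∞) (n : ℕ) {a b : Child Θ} (hab : a.isSome ∨ b.isSome) :
    sampleIntegral (Child.testLaw m l n a b) (fun xs => val (Child.testMove m mle l n a b xs))
        (Child.testLength n a b) [] =
      ∫⁻ x, val (decideMove (a.map fun _ => gllr m mle l (List.ofFn x.1))
        (b.map fun _ => gllr m mle l (List.ofFn x.2)))
        ∂((a.sampleLaw m l n).prod (b.sampleLaw m l n)) := by
  have hG := listMeasurable_val_testMove hmle hfin val n a b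
  have hg := listMeasurable_gllr hmle hfin n
  have hm : Measurable fun x : (Fin n → Y) × (Fin n → Y) =>
      val (decideMove (a.map fun _ => gllr m mle l (List.ofFn x.1))
        (b.map fun _ => gllr m mle l (List.ofFn x.2))) :=
    measurable_val_decideMove val a b (hg.comp measurable_fst) (hg.comp measurable_snd)
  have htake : ∀ x : Fin n → Y, (List.ofFn x).take n = List.ofFn x := fun x =>
    List.take_of_length_le (by simp)
  rw [lintegral_prod _ hm.aemeasurable]
  rcases a with _ | a <;> rcases b with _ | b
  · simp at hab
  · rw [Child.testLength, if_neg (by simp), sampleIntegral_eq_lintegral_pi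
      (P := m.law l b.2) hG fun i _ => by simp [Child.testLaw]]
    simp [Child.testMove, Child.sampleLaw]
  · rw [Child.testLength, if_neg (by simp), sampleIntegral_eq_lintegral_pi
      (P := m.law l a.2) hG fun i _ => by simp [Child.testLaw]]
    simp [Child.testMove, Child.sampleLaw, htake]
  · rw [Child.testLength, if_pos (by simp), two_mul, sampleIntegral_add,
      sampleIntegral_eq_lintegral_pi (P := m.law l a.2) (hG.sampleIntegral n)
        fun i hi => by simp [Child.testLaw, hi]]
    refine lintegral_congr fun x => ?_
    rw [sampleIntegral_eq_lintegral_pi (P := m.law l b.2) hG fun i _ => by simp [Child.testLaw]]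
    refine lintegral_congr fun x' => ?_
    have h1 : (List.ofFn x ++ List.ofFn x').take n = List.ofFn x := List.take_left' (by simp)
    have h2 : (List.ofFn x ++ List.ofFn x').drop n = List.ofFn x' := List.drop_left' (by simp)
    simp [Child.testMove, h1, h2]

/-- An internal test costs its samples, and then with probability at most `1 - p` the surcharge `d`
for a wrong move on top of the cost `v` after a correct move. -/
theorem exists_internalTest_potential (hmle : m.IsMLE mle) (hfin : (m.params l 1).Finite)
    {n : ℕ} {p : ℝ} (hp : 0 ≤ p) {a b : Child Θ} (hab : a.isSome ∨ b.isSome)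
    (hcorrect : ENNReal.ofReal p ≤ ((a.sampleLaw m l n).prod (b.sampleLaw m l n))
      {x | Move.Correct a b (decideMove (a.map fun _ => gllr m mle l (List.ofFn x.1))
        (b.map fun _ => gllr m mle l (List.ofFn x.2)))})
    {val : Move → ℝ≥0∞} {v d : ℝ≥0∞} (hval : ∀ mv, Move.Correct a b mv → val mv ≤ v)
    (hval' : ∀ mv, val mv ≤ v + d) :
    ∃ Φ : List Y → ℝ≥0∞, ListMeasurable Φ ∧
      Φ [] ≤ Child.testLength n a b + (v + d * ENNReal.ofReal (1 - p)) ∧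
      (∀ xs, xs.length = Child.testLength n a b → val (Child.testMove m mle l n a b xs) ≤ Φ xs) ∧
      ∀ xs, xs.length < Child.testLength n a b →
        1 + ∫⁻ y, Φ (xs ++ [y]) ∂Child.testLaw m l n a b xs.length ≤ Φ xs := by
  classical
  set T := Child.testLength n a b
  set ν := Child.testLaw m l n a b
  set G : List Y → ℝ≥0∞ := fun xs => val (Child.testMove m mle l n a b xs)
  have hG : ListMeasurable G := listMeasurable_val_testMove hmle hfin val n a b
  refine ⟨fun xs => ((T - xs.length : ℕ) : ℝ≥0∞) + sampleIntegral ν G (T - xs.length) xs,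
    ?_, ?_, ?_, ?_⟩
  · intro k
    simp only [List.length_ofFn]
    exact measurable_const.add (hG.sampleIntegral _ k)
  · simp only [List.length_nil, Nat.sub_zero]
    gcongr
    rw [sampleIntegral_testMove hmle hfin val n hab]
    set P := (a.sampleLaw m l n).prod (b.sampleLaw m l n)
    set mv : (Fin n → Y) × (Fin n → Y) → Move := fun x =>
      decideMove (a.map fun _ => gllr m mle l (List.ofFn x.1))
        (b.map fun _ => gllr m mle l (List.ofFn x.2))
    have hg := listMeasurable_gllr hmle hfin n
    have hC : MeasurableSet {x | Move.Correct a b (mv x)} := by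
      have h1 : Measurable fun x => (if Move.Correct a b (mv x) then 1 else 0 : ℝ≥0∞) :=
        measurable_val_decideMove (fun mv => if Move.Correct a b mv then 1 else 0) a b
          (hg.comp measurable_fst) (hg.comp measurable_snd)
      have h2 : {x | Move.Correct a b (mv x)} =
          (fun x => (if Move.Correct a b (mv x) then 1 else 0 : ℝ≥0∞)) ⁻¹' {1} := by
        ext x
        simp
      rw [h2]
      exact h1 (measurableSet_singleton 1)
    have hwrong : P {x | Move.Correct a b (mv x)}ᶜ ≤ ENNReal.ofReal (1 - p) := by
      rw [prob_compl_eq_one_sub hC, ENNReal.ofReal_sub _ hp, ENNReal.ofReal_one]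
      gcongr
    calc ∫⁻ x, val (mv x) ∂P
        ≤ ∫⁻ x, (v + d * Set.indicator {x | Move.Correct a b (mv x)}ᶜ 1 x) ∂P := by
          refine lintegral_mono fun x => ?_
          by_cases hx : Move.Correct a b (mv x)
          · simpa [hx] using hval _ hx
          · simpa [hx] using hval' (mv x)
      _ = v + d * P {x | Move.Correct a b (mv x)}ᶜ := by
          rw [lintegral_add_left measurable_const, lintegral_const_mul _
            (measurable_one.indicator hC.compl), lintegral_indicator_one hC.compl]
          simp
      _ ≤ _ := by gcongr
  · intro xs hxs
    simp [hxs, sampleIntegral, G]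
  · intro xs hxs
    have h1 : T - xs.length = (T - (xs.length + 1)) + 1 := by omega
    simp only [List.length_append, List.length_singleton]
    rw [lintegral_add_left measurable_const, lintegral_const, measure_univ, mul_one, h1,
      sampleIntegral]
    push_cast
    exact le_of_eq (by ring)

end InternalTest

/-! ### Distances in the tree -/

section Tree

lemma leaves_zero (j : ℕ) : leaves 0 j = {j} := by
  ext i
  simp [leaves]

lemma leaves_root (L : ℕ) : leaves L 0 = Finset.range (2 ^ L) := by
  ext i
  simp [leaves]

lemma leaves_succ (l j : ℕ) : leaves (l + 1) j = leaves l (2 * j) ∪ leaves l (2 * j + 1) := by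
  ext i
  simp only [leaves, Finset.mem_union, Finset.mem_Ico, pow_succ]
  have h1 : j * (2 ^ l * 2) = 2 * j * 2 ^ l := by ring
  have h2 : (j + 1) * (2 ^ l * 2) = (2 * j + 1 + 1) * 2 ^ l := by ring
  have h3 : 2 * j * 2 ^ l ≤ (2 * j + 1) * 2 ^ l := by gcongr; omega
  have h4 : (2 * j + 1) * 2 ^ l ≤ (2 * j + 1 + 1) * 2 ^ l := by gcongr; omega
  rw [h1, h2]
  omega

lemma leaves_subset_parent (l j : ℕ) : leaves l j ⊆ leaves (l + 1) (j / 2) := by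
  rw [leaves_succ]
  rcases Nat.even_or_odd' j with ⟨k, rfl | rfl⟩
  · rw [Nat.mul_div_cancel_left _ two_pos]
    exact Finset.subset_union_left
  · have : (2 * k + 1) / 2 = k := by omega
    rw [this]
    exact Finset.subset_union_right

lemma card_leaves (l j : ℕ) : (leaves l j).card = 2 ^ l := by
  rw [leaves, Nat.card_Ico, ← Nat.sub_mul]
  simp

/-- Some process of `U` is below node `(l, j)`. -/
def Contains (U : Finset ℕ) (l j : ℕ) : Prop := (U ∩ leaves l j).Nonempty

variable {U : Finset ℕ} {L l j : ℕ}

lemma Contains.parent (h : Contains U l j) : Contains U (l + 1) (j / 2) :=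
  h.mono (Finset.inter_subset_inter_left (leaves_subset_parent l j))

lemma contains_succ : Contains U (l + 1) j ↔ Contains U l (2 * j) ∨ Contains U l (2 * j + 1) := by
  rw [Contains, leaves_succ, Finset.inter_union_distrib_left, Finset.union_nonempty]
  rfl

lemma contains_root (hU : U.Nonempty) (hL : U ⊆ Finset.range (2 ^ L)) : Contains U L 0 := by
  rw [Contains, leaves_root, Finset.inter_eq_left.2 hL]
  exact hU

/-- The distance from node `(l, j)` to the closest process of `U`: the path goes up to the first
ancestor that contains one, and from there down to the leaf. -/
def treeDist (U : Finset ℕ) (l j : ℕ) : ℕ := l + 2 * sInf {k | Contains U (l + k) (j / 2 ^ k)}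

lemma treeDist_of_contains (h : Contains U l j) : treeDist U l j = l := by
  have h0 : (0 : ℕ) ∈ {k | Contains U (l + k) (j / 2 ^ k)} := by simpa using h
  have : sInf {k | Contains U (l + k) (j / 2 ^ k)} = 0 := Nat.sInf_eq_zero.2 (Or.inl h0)
  rw [treeDist, this]
  rfl

lemma exists_contains_ancestor (hU : Contains U L 0) (hl : l ≤ L) (hj : j < 2 ^ (L - l)) :
    ∃ k, Contains U (l + k) (j / 2 ^ k) :=
  ⟨L - l, by rwa [Nat.add_sub_cancel' hl, Nat.div_eq_of_lt hj]⟩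

lemma treeDist_parent (hU : Contains U L 0) (hl : l ≤ L) (hj : j < 2 ^ (L - l))
    (h : ¬ Contains U l j) : treeDist U (l + 1) (j / 2) + 1 = treeDist U l j := by
  set s := {k | Contains U (l + k) (j / 2 ^ k)}
  set t := {k | Contains U (l + 1 + k) (j / 2 / 2 ^ k)}
  have hst : ∀ k, k + 1 ∈ s ↔ k ∈ t := fun k => by
    simp only [s, t, Set.mem_ofPred_eq, Nat.div_div_eq_div_mul, pow_succ']
    rw [add_right_comm, add_assoc]
  have hs : s.Nonempty := exists_contains_ancestor hU hl hj
  have h0 : 0 ∉ s := by simpa [s] using h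
  obtain ⟨k, hk⟩ : ∃ k, sInf s = k + 1 := Nat.exists_eq_succ_of_ne_zero fun h1 =>
    h0 (h1 ▸ Nat.sInf_mem hs)
  have hkt : k ∈ t := (hst k).1 (hk ▸ Nat.sInf_mem hs)
  have hkinf : sInf t = k := by
    refine le_antisymm (Nat.sInf_le hkt) ?_
    have := Nat.sInf_le ((hst _).2 (Nat.sInf_mem ⟨k, hkt⟩))
    omega
  change l + 1 + 2 * sInf t + 1 = l + 2 * sInf s
  omega

lemma treeDist_parent_le (hU : Contains U L 0) (hl : l ≤ L) (hj : j < 2 ^ (L - l)) :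
    treeDist U (l + 1) (j / 2) ≤ treeDist U l j + 1 := by
  by_cases h : Contains U l j
  · rw [treeDist_of_contains h, treeDist_of_contains h.parent]
  · have := treeDist_parent hU hl hj h
    omega

lemma treeDist_child {i : ℕ} (hU : Contains U L 0) (hl : l + 1 ≤ L) (hj : j < 2 ^ (L - (l + 1)))
    (hi : i / 2 = j) :
    (Contains U l i → treeDist U l i + 1 = treeDist U (l + 1) j) ∧
      treeDist U l i ≤ treeDist U (l + 1) j + 1 := by
  have hi' : i < 2 ^ (L - l) := by
    have : L - l = L - (l + 1) + 1 := by omega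
    rw [this, pow_succ]
    omega
  by_cases h : Contains U l i
  · have h2 := h.parent
    rw [hi] at h2
    rw [treeDist_of_contains h, treeDist_of_contains h2]
    exact ⟨fun _ => rfl, by omega⟩
  · refine ⟨fun h' => absurd h' h, ?_⟩
    have := treeDist_parent hU (by omega) hi' h
    rw [hi] at this
    omega

end Tree

/-! ### The search as a Markov chain on its states -/

section States

instance : Countable Query := by
  have : Function.Injective fun q : Query => (q.removed, q.level, q.index) := by
    rintro ⟨⟩ ⟨⟩ h
    simpa using h
  exact this.countable

variable {Y Θ : Type*}

/-- The state with the samples `x`, and with the declared processes, the level, the index and the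
number of samples given by `i`. -/
def stateOf (i : Finset ℕ × ℕ × ℕ × ℕ) (x : Fin i.2.2.2 → Y) : State Y :=
  ⟨i.1, i.2.1, i.2.2.1, List.ofFn x⟩

lemma exists_stateOf (s : State Y) : ∃ i x, stateOf i x = s :=
  ⟨(s.declared, s.level, s.index, s.buf.length), s.buf.get, by simp [stateOf]⟩

lemma stateOf_injective (i : Finset ℕ × ℕ × ℕ × ℕ) :
    Function.Injective (stateOf i : (Fin i.2.2.2 → Y) → State Y) := fun _ _ h =>
  List.ofFn_injective (congrArg State.buf h)

/-- The state of a child of a tested node. -/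
def childState (H : Finset ℕ) (ϑ : Query → Θ) (D : Finset ℕ) (l j : ℕ) : Child Θ :=
  if Present D l j then some (((H \ D) ∩ leaves l j).card, ϑ ⟨D, l, j⟩) else none

lemma testSize_eq {n : ℕ → ℕ} (H : Finset ℕ) (ϑ : Query → Θ) (D : Finset ℕ) (l j : ℕ) (buf : List Y) :
    testSize n l ⟨D, l + 1, j, buf⟩ =
      Child.testLength (n l) (childState H ϑ D l (2 * j)) (childState H ϑ D l (2 * j + 1)) := by
  simp only [testSize, Child.testLength, childState]
  split_ifs <;> simp_all

variable [MeasurableSpace Y]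

/-- A set of states is measurable if so are its sections at fixed declared processes, node and
number of samples. -/
instance instMeasurableSpaceState : MeasurableSpace (State Y) :=
  ⨅ i : Finset ℕ × ℕ × ℕ × ℕ, MeasurableSpace.map (stateOf i) inferInstance

lemma measurableSet_state_iff {B : Set (State Y)} :
    MeasurableSet B ↔ ∀ i, MeasurableSet (stateOf i ⁻¹' B) := by
  simp only [MeasurableSpace.measurableSet_iInf, MeasurableSpace.map_def]

lemma measurable_stateOf (i : Finset ℕ × ℕ × ℕ × ℕ) :
    Measurable (stateOf i : (Fin i.2.2.2 → Y) → State Y) :=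
  fun _ hB => measurableSet_state_iff.1 hB i

lemma measurableEmbedding_stateOf (i : Finset ℕ × ℕ × ℕ × ℕ) :
    MeasurableEmbedding (stateOf i : (Fin i.2.2.2 → Y) → State Y) := by
  refine ⟨stateOf_injective i, measurable_stateOf i, fun B hB => ?_⟩
  refine measurableSet_state_iff.2 fun k => ?_
  by_cases hk : k = i
  · subst hk
    rwa [Set.preimage_image_eq _ (stateOf_injective k)]
  · have : stateOf k ⁻¹' (stateOf i '' B) = ∅ := by
      ext x
      simp only [Set.mem_preimage, Set.mem_image, Set.mem_empty_iff_false, iff_false]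
      rintro ⟨y, -, hy⟩
      refine hk ?_
      obtain ⟨D, l, j, n⟩ := i
      obtain ⟨D', l', j', n'⟩ := k
      simp only [stateOf, State.mk.injEq] at hy
      obtain ⟨rfl, rfl, rfl, h⟩ := hy
      have := congrArg List.length h
      simp only [List.length_ofFn] at this
      rw [this]
    rw [this]
    exact MeasurableSet.empty

variable {β : Type*} [MeasurableSpace β]

lemma measurable_state_iff {g : State Y → β} :
    Measurable g ↔ ∀ D l j, ListMeasurable fun xs => g ⟨D, l, j, xs⟩ := by
  refine ⟨fun h D l j n => h.comp (measurable_stateOf (D, l, j, n)), fun h B hB => ?_⟩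
  exact measurableSet_state_iff.2 fun i => h i.1 i.2.1 i.2.2.1 i.2.2.2 hB

lemma measurable_state_prod {g : State Y × Y → β}
    (h : ∀ i, Measurable fun z : (Fin i.2.2.2 → Y) × Y => g (stateOf i z.1, z.2)) :
    Measurable g := by
  intro B hB
  have : g ⁻¹' B = ⋃ i, Prod.map (stateOf i) id ''
      ((fun z : (Fin i.2.2.2 → Y) × Y => g (stateOf i z.1, z.2)) ⁻¹' B) := by
    ext ⟨s, y⟩
    obtain ⟨i, x, rfl⟩ := exists_stateOf s
    refine ⟨fun hx => Set.mem_iUnion.2 ⟨i, (x, y), hx, rfl⟩, fun hx => ?_⟩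
    obtain ⟨k, z, hz, h1⟩ := Set.mem_iUnion.1 hx
    rw [← h1]
    exact hz
  rw [this]
  exact MeasurableSet.iUnion fun i =>
    ((measurableEmbedding_stateOf i).prodMap MeasurableEmbedding.id).measurableSet_image.2 (h i hB)

/-- The state after a move from node `(l + 1, j)`. -/
def moveTo (L l : ℕ) (D : Finset ℕ) (j : ℕ) : Move → State Y
  | Move.left => ⟨D, l, 2 * j, []⟩
  | Move.right => ⟨D, l, 2 * j + 1, []⟩
  | Move.up => toParent L ⟨D, l + 1, j, []⟩

variable {m : Model Y Θ} {mle : ℕ → List Y → Θ} {n : ℕ → ℕ} {N L K : ℕ} {c : ℝ}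

lemma step_leaf (D : Finset ℕ) (j : ℕ) (buf : List Y) (y : Y) :
    step m mle n N L c ⟨D, 0, j, buf⟩ y =
      if (buf ++ [y]).length ≤ N then ⟨D, 0, j, buf ++ [y]⟩
      else if Real.log ((L : ℝ) / c) < allr m mle N (buf ++ [y]) then atRoot L (insert j D)
      else if allr m mle N (buf ++ [y]) < 0 then toParent L ⟨D, 0, j, []⟩
      else ⟨D, 0, j, buf ++ [y]⟩ := rfl

lemma step_internal (H : Finset ℕ) (ϑ : Query → Θ) (D : Finset ℕ) (l j : ℕ) (buf : List Y)
    (y : Y) :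
    step m mle n N L c ⟨D, l + 1, j, buf⟩ y =
      if (buf ++ [y]).length < Child.testLength (n l) (childState H ϑ D l (2 * j))
          (childState H ϑ D l (2 * j + 1)) then ⟨D, l + 1, j, buf ++ [y]⟩
      else moveTo L l D j (Child.testMove m mle l (n l) (childState H ϑ D l (2 * j))
        (childState H ϑ D l (2 * j + 1)) (buf ++ [y])) := by
  rw [← testSize_eq H ϑ D l j buf]
  simp only [step]
  congr 1
  simp only [finishInternal, Child.testMove, childState]
  split_ifs <;> simp only [Option.map_some, Option.map_none] <;> split <;>
    simp_all [moveTo, toParent]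

lemma law_nextQuery_internal (H : Finset ℕ) (ϑ : Query → Θ) (D : Finset ℕ) (l j : ℕ)
    (buf : List Y) (h : Present D l (2 * j) ∨ Present D l (2 * j + 1)) :
    m.law (nextQuery n ⟨D, l + 1, j, buf⟩).level (ϑ (nextQuery n ⟨D, l + 1, j, buf⟩)) =
      Child.testLaw m l (n l) (childState H ϑ D l (2 * j)) (childState H ϑ D l (2 * j + 1))
        buf.length := by
  simp only [nextQuery, Child.testLaw, childState]
  split_ifs <;> simp_all

lemma measurable_step (hmle : m.IsMLE mle) (hfin : ∀ l, (m.params l 1).Finite) :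
    Measurable fun z : State Y × Y => step m mle n N L c z.1 z.2 := by
  have hstate : ∀ D l j, ListMeasurable fun xs : List Y => (⟨D, l, j, xs⟩ : State Y) :=
    fun D l j k => measurable_stateOf (D, l, j, k)
  refine measurable_state_prod fun ⟨D, l, j, k⟩ => ?_
  rcases l with _ | l
  · simp only [stateOf, step_leaf]
    have hS := listMeasurable_allr hmle (hfin 0) N
    have h : ListMeasurable fun xs : List Y =>
        (if xs.length ≤ N then ⟨D, 0, j, xs⟩
        else if Real.log ((L : ℝ) / c) < allr m mle N xs then atRoot L (insert j D)
        else if allr m mle N xs < 0 then toParent L ⟨D, 0, j, []⟩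
        else ⟨D, 0, j, xs⟩ : State Y) := fun k => by
      simp only [List.length_ofFn]
      refine Measurable.ite (MeasurableSet.const _) (hstate D 0 j k) ?_
      refine Measurable.ite (measurableSet_lt measurable_const (hS k)) measurable_const ?_
      exact Measurable.ite (measurableSet_lt (hS k) measurable_const) measurable_const
        (hstate D 0 j k)
    exact h.append_singleton k
  · -- the truth is irrelevant for the move; any parameters of the children will do
    let H : Finset ℕ := ∅
    let ϑ : Query → Θ := fun _ => m.θ₀ 0
    simp only [stateOf, step_internal H ϑ]
    have h : ListMeasurable fun xs : List Y =>
        (if xs.length < Child.testLength (n l) (childState H ϑ D l (2 * j))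
          (childState H ϑ D l (2 * j + 1)) then ⟨D, l + 1, j, xs⟩
        else moveTo L l D j (Child.testMove m mle l (n l) (childState H ϑ D l (2 * j))
          (childState H ϑ D l (2 * j + 1)) xs) : State Y) := fun k => by
      simp only [List.length_ofFn]
      exact Measurable.ite (MeasurableSet.const _) (hstate D (l + 1) j k)
        (listMeasurable_val_testMove hmle (hfin l) (moveTo L l D j) (n l) _ _ k)
    exact h.append_singleton k

lemma measurableSet_nextQuery (q : Query) :
    MeasurableSet {s : State Y | nextQuery n s = q} := by
  refine measurableSet_state_iff.2 fun ⟨D, l, j, k⟩ => ?_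
  -- the next query depends on the samples only through their number
  have : ∀ x : Fin k → Y, nextQuery n ⟨D, l, j, List.ofFn x⟩ =
      match l with
      | 0 => ⟨D, 0, j⟩
      | l + 1 => if Present D l (2 * j) ∧ (Present D l (2 * j + 1) → k < n l) then ⟨D, l, 2 * j⟩
          else ⟨D, l, 2 * j + 1⟩ := by
    intro x
    rcases l with _ | l <;> simp [nextQuery]
  simp only [Set.preimage_ofPred_eq, stateOf, this]
  exact MeasurableSet.const _

lemma measurableSet_card_declared (K : ℕ) : MeasurableSet {s : State Y | s.declared.card = K} :=
  measurableSet_state_iff.2 fun i => MeasurableSet.const (i.1.card = K)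

end States

/-! ### The risk of the search and potentials of its states -/

section Risk

variable {Y Θ : Type*} [MeasurableSpace Y] {m : Model Y Θ} {mle : ℕ → List Y → Θ} {n : ℕ → ℕ}
  {N L K : ℕ} {c : ℝ}

/-- The chain of the states of the search. -/
def searchState (m : Model Y Θ) (mle : ℕ → List Y → Θ) (n : ℕ → ℕ) (N L K : ℕ) (c : ℝ)
    (ω : ℕ × Query → Y) (t : ℕ) : State Y :=
  trajectory {s : State Y | s.declared.card = K} (nextQuery n) (step m mle n N L c) (atRoot L ∅) ω t

lemma foldl_history (ω : ℕ × Query → Y) (t : ℕ) :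
    (history (hds m mle n N L K c) ω t).foldl (step m mle n N L c) (atRoot L ∅) =
      searchState m mle n N L K c ω t := by
  induction t with
  | zero => rfl
  | succ t ih =>
    rw [history]
    by_cases h : (searchState m mle n N L K c ω t).declared.card = K
    · have h1 : hds m mle n N L K c (history (hds m mle n N L K c) ω t) =
          Sum.inr (searchState m mle n N L K c ω t).declared := by
        simp only [hds, ih, h, if_true]
      simp only [h1, ih]
      exact (if_pos h).symm
    · have h1 : hds m mle n N L K c (history (hds m mle n N L K c) ω t) =
          Sum.inl (nextQuery n (searchState m mle n N L K c ω t)) := by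
        simp only [hds, ih, h, if_false]
      simp only [h1, List.foldl_append, ih, List.foldl_cons, List.foldl_nil]
      exact (if_neg h).symm

lemma hds_history (ω : ℕ × Query → Y) (t : ℕ) :
    hds m mle n N L K c (history (hds m mle n N L K c) ω t) =
      if (searchState m mle n N L K c ω t).declared.card = K then
        Sum.inr (searchState m mle n N L K c ω t).declared
      else Sum.inl (nextQuery n (searchState m mle n N L K c ω t)) := by
  rw [← foldl_history]
  rfl

lemma stopTime_le_tsum (ω : ℕ × Query → Y) :
    stopTime (hds m mle n N L K c) ω ≤
      ∑' t, Set.indicator {ω | (searchState m mle n N L K c ω t).declared.card ≠ K} 1 ω := by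
  classical
  by_cases h : ∃ t, (searchState m mle n N L K c ω t).declared.card = K
  · have h1 : stopTime (hds m mle n N L K c) ω ≤ (Nat.find h : ℝ≥0∞) := by
      refine iInf₂_le (Nat.find h) ?_
      rw [hds_history, if_pos (Nat.find_spec h)]
      rfl
    refine h1.trans ?_
    calc (Nat.find h : ℝ≥0∞) = ∑ t ∈ Finset.range (Nat.find h), 1 := by simp
      _ ≤ ∑ t ∈ Finset.range (Nat.find h),
          Set.indicator {ω | (searchState m mle n N L K c ω t).declared.card ≠ K} 1 ω := by
          refine Finset.sum_le_sum fun t ht => ?_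
          have := Nat.find_min h (Finset.mem_range.1 ht)
          simp [this]
      _ ≤ _ := ENNReal.sum_le_tsum _
  · push Not at h
    have : ∀ t, Set.indicator {ω | (searchState m mle n N L K c ω t).declared.card ≠ K}
        (1 : (ℕ × Query → Y) → ℝ≥0∞) ω = 1 := fun t => by simp [h t]
    simp [this]

/-- A potential of the states of the search bounds the risk conditional on the truth. -/
theorem errorProb_add_le_potential (hmle : m.IsMLE mle) (hfin : ∀ l, (m.params l 1).Finite)
    (hc : 0 < c) {H : Finset ℕ} {ϑ : Query → Θ} {Inv : State Y → Prop} (h0 : Inv (atRoot L ∅))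
    (hinv : ∀ s, Inv s → s.declared.card ≠ K → ∀ y, Inv (step m mle n N L c s y))
    {V : State Y → ℝ≥0∞} (hV : Measurable V)
    (hdrift : ∀ s, Inv s → s.declared.card ≠ K →
      1 + ∫⁻ y, V (step m mle n N L c s y)
        ∂m.law (nextQuery n s).level (ϑ (nextQuery n s)) ≤ V s)
    (hbad : ∀ s, s.declared.card = K → s.declared ≠ H → ENNReal.ofReal (1 / c) ≤ V s)
    (hVfin : V (atRoot L ∅) ≠ ⊤) :
    errorProb m (hds m mle n N L K c) H ϑ +
      ENNReal.ofReal c * sampleComplexity m (hds m mle n N L K c) ϑ ≤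
      ENNReal.ofReal c * V (atRoot L ∅) := by
  set P := obsLaw m ϑ with hP
  have hterm := measurableSet_card_declared (Y := Y) K
  have hstep := measurable_step (n := n) (N := N) (L := L) (c := c) hmle hfin
  have hX : ∀ t, Measurable fun ω => searchState m mle n N L K c ω t := fun t =>
    measurable_trajectory hterm measurableSet_nextQuery hstep t
  have hchain := tsum_measure_add_le_potential (fun q : Query => m.law q.level (ϑ q)) hterm
    measurableSet_nextQuery hstep h0 hinv hV hdrift
    (bad := {s : State Y | s.declared ≠ H}) (fun s hs => hbad s hs.1 hs.2)
    ENNReal.ofReal_ne_top hVfin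
  have htime : sampleComplexity m (hds m mle n N L K c) ϑ ≤
      ∑' t, P {ω | (searchState m mle n N L K c ω t).declared.card ≠ K} := by
    have hm : ∀ t, MeasurableSet {ω | (searchState m mle n N L K c ω t).declared.card ≠ K} :=
      fun t => hX t hterm.compl
    calc _ ≤ ∫⁻ ω, ∑' t, Set.indicator
          {ω | (searchState m mle n N L K c ω t).declared.card ≠ K} 1 ω ∂P :=
          lintegral_mono stopTime_le_tsum
      _ = _ := by
          rw [lintegral_tsum fun t => (measurable_one.indicator (hm t)).aemeasurable]
          exact tsum_congr fun t => lintegral_indicator_one (hm t)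
  have herr : errorProb m (hds m mle n N L K c) H ϑ ≤
      P {ω | ∀ t, (searchState m mle n N L K c ω t).declared.card = K →
        (searchState m mle n N L K c ω t).declared ≠ H} := by
    refine measure_mono fun ω hω t ht hH => hω ⟨t, ?_⟩
    rw [hds_history, if_pos ht, hH]
  have hcc : ENNReal.ofReal c * ENNReal.ofReal (1 / c) = 1 := by
    rw [← ENNReal.ofReal_mul hc.le, mul_one_div_cancel hc.ne', ENNReal.ofReal_one]
  calc _ ≤ ENNReal.ofReal c * ENNReal.ofReal (1 / c) *
        P {ω | ∀ t, (searchState m mle n N L K c ω t).declared.card = K →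
          (searchState m mle n N L K c ω t).declared ≠ H} +
        ENNReal.ofReal c *
          ∑' t, P {ω | (searchState m mle n N L K c ω t).declared.card ≠ K} := by
        rw [hcc, one_mul]
        gcongr
    _ = ENNReal.ofReal c * (∑' t, P {ω | (searchState m mle n N L K c ω t).declared.card ≠ K} +
        ENNReal.ofReal (1 / c) * P {ω | ∀ t, (searchState m mle n N L K c ω t).declared.card = K →
          (searchState m mle n N L K c ω t).declared ≠ H}) := by ring
    _ ≤ _ := by
        gcongr
        exact hchain

end Risk

/-! ### The invariant of the search -/

section Invariant

/-- Node `(l, j)` is in the tree of height `L` and still contains a process. -/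
def ValidNode (L : ℕ) (D : Finset ℕ) (l j : ℕ) : Prop :=
  l ≤ L ∧ j < 2 ^ (L - l) ∧ Present D l j

variable {L l j K : ℕ} {D U H : Finset ℕ}

lemma validNode_root (h : D.card < 2 ^ L) : ValidNode L D L 0 := by
  refine ⟨le_rfl, by simp, fun hsub => ?_⟩
  rw [leaves_root] at hsub
  have := Finset.card_le_card hsub
  simp only [Finset.card_range] at this
  omega

lemma ValidNode.parent (h : ValidNode L D l j) (hl : l < L) : ValidNode L D (l + 1) (j / 2) := by
  obtain ⟨-, h2, h3⟩ := h
  refine ⟨hl, ?_, fun hsub => h3 ((leaves_subset_parent l j).trans hsub)⟩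
  have : L - l = L - (l + 1) + 1 := by omega
  rw [this, pow_succ] at h2
  omega

lemma ValidNode.child (h : ValidNode L D (l + 1) j) {i : ℕ} (hi : i / 2 = j)
    (hp : Present D l i) : ValidNode L D l i := by
  obtain ⟨h1, h2, -⟩ := h
  refine ⟨by omega, ?_, hp⟩
  have : L - l = L - (l + 1) + 1 := by omega
  rw [this, pow_succ]
  omega

lemma ValidNode.present_children (h : ValidNode L D (l + 1) j) :
    Present D l (2 * j) ∨ Present D l (2 * j + 1) := by
  by_contra! hc
  refine h.2.2 ?_
  rw [leaves_succ]
  exact Finset.union_subset (not_not.1 hc.1) (not_not.1 hc.2)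

lemma ValidNode.notMem_of_leaf (h : ValidNode L D 0 j) : j ∉ D := by
  have := h.2.2
  rwa [Present, leaves_zero, Finset.singleton_subset_iff] at this

lemma ValidNode.mem_range_of_leaf (h : ValidNode L D 0 j) : j ∈ Finset.range (2 ^ L) := by
  simpa using h.2.1

lemma contains_leaf_iff : Contains U 0 j ↔ j ∈ U := by
  rw [Contains, leaves_zero]
  constructor
  · rintro ⟨i, hi⟩
    obtain ⟨h1, h2⟩ := Finset.mem_inter.1 hi
    rwa [← Finset.mem_singleton.1 h2]
  · exact fun h => ⟨j, by simpa using h⟩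

lemma Contains.present (h : Contains (H \ D) l j) : Present D l j := by
  obtain ⟨i, hi⟩ := h
  simp only [Finset.mem_inter, Finset.mem_sdiff] at hi
  exact fun hsub => hi.1.2 (hsub hi.2)

variable {Y Θ : Type*}

/-- The parent of a node, its validity and its distance from the closest process of `U`. -/
lemma exists_toParent (hv : ValidNode L D l j) (hU : Contains U L 0) (buf : List Y) :
    ∃ l' j', toParent L ⟨D, l, j, buf⟩ = ⟨D, l', j', []⟩ ∧ ValidNode L D l' j' ∧
      treeDist U l' j' ≤ treeDist U l j + 1 ∧
      (¬ Contains U l j → treeDist U l' j' + 1 = treeDist U l j) := by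
  rcases hv.1.eq_or_lt with rfl | hl
  · have hj : j = 0 := by simpa using hv.2.1
    subst hj
    exact ⟨l, 0, by simp [toParent, atRoot], hv, by omega, fun h => absurd hU h⟩
  · exact ⟨l + 1, j / 2, by simp [toParent, hl], hv.parent hl,
      treeDist_parent_le hU hv.1 hv.2.1, treeDist_parent hU hv.1 hv.2.1⟩

lemma anomalous_childState_iff (ϑ : Query → Θ) :
    (childState H ϑ D l j).Anomalous ↔ Contains (H \ D) l j := by
  by_cases h : Present D l j
  · simp only [childState, h, if_true, Child.Anomalous, Nat.one_le_iff_ne_zero, Finset.card_ne_zero]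
    rfl
  · simp only [childState, h, if_false, Child.Anomalous, false_iff]
    exact fun hc => h hc.present

/-- A correct move brings the walk closer to an anomaly, and every move takes it at most one step
farther away. -/
lemma exists_moveTo (hv : ValidNode L D (l + 1) j) (hU : Contains (H \ D) L 0) (ϑ : Query → Θ)
    (mv : Move) :
    ∃ l' j', (moveTo L l D j mv : State Y) = ⟨D, l', j', []⟩ ∧
      ((mv = Move.left → Present D l (2 * j)) → (mv = Move.right → Present D l (2 * j + 1)) →
        ValidNode L D l' j') ∧
      treeDist (H \ D) l' j' ≤ treeDist (H \ D) (l + 1) j + 1 ∧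
      (Move.Correct (childState H ϑ D l (2 * j)) (childState H ϑ D l (2 * j + 1)) mv →
        treeDist (H \ D) l' j' + 1 = treeDist (H \ D) (l + 1) j) := by
  have hl : 2 * j / 2 = j := by omega
  have hr : (2 * j + 1) / 2 = j := by omega
  cases mv with
  | left =>
    have h := treeDist_child hU hv.1 hv.2.1 hl
    exact ⟨l, 2 * j, rfl, fun h1 _ => hv.child hl (h1 rfl), h.2,
      fun hc => h.1 ((anomalous_childState_iff ϑ).1 hc)⟩
  | right =>
    have h := treeDist_child hU hv.1 hv.2.1 hr
    exact ⟨l, 2 * j + 1, rfl, fun _ h1 => hv.child hr (h1 rfl), h.2,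
      fun hc => h.1 ((anomalous_childState_iff ϑ).1 hc)⟩
  | up =>
    obtain ⟨l', j', h1, h2, h3, h4⟩ := exists_toParent hv hU ([] : List Y)
    refine ⟨l', j', h1, fun _ _ => h2, h3, fun hc => h4 ?_⟩
    rw [contains_succ, not_or]
    exact ⟨fun h => hc.1 ((anomalous_childState_iff ϑ).2 h),
      fun h => hc.2 ((anomalous_childState_iff ϑ).2 h)⟩

variable [MeasurableSpace Y] {m : Model Y Θ} {mle : ℕ → List Y → Θ} {n : ℕ → ℕ} {N : ℕ} {c : ℝ}

lemma present_of_testMove (ϑ : Query → Θ) (xs : List Y) :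
    (Child.testMove m mle l (n l) (childState H ϑ D l (2 * j)) (childState H ϑ D l (2 * j + 1)) xs =
      Move.left → Present D l (2 * j)) ∧
    (Child.testMove m mle l (n l) (childState H ϑ D l (2 * j)) (childState H ϑ D l (2 * j + 1)) xs =
      Move.right → Present D l (2 * j + 1)) := by
  simp only [Child.testMove, childState]
  split_ifs with h1 h2 h2 <;> simp only [Option.map_some, Option.map_none, decideMove] <;>
    grind

/-- The current test is not finished. -/
def InProgress (m : Model Y Θ) (mle : ℕ → List Y → Θ) (n : ℕ → ℕ) (N L : ℕ) (c : ℝ) (D : Finset ℕ)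
    (l j : ℕ) (buf : List Y) : Prop :=
  (l = 0 → 0 ≤ allr m mle N buf ∧ allr m mle N buf ≤ Real.log (L / c)) ∧
    ∀ k, l = k + 1 → buf.length < testSize n k ⟨D, l, j, buf⟩

lemma inProgress_nil (hn : ∀ l, 1 ≤ n l) (hA : 0 ≤ Real.log (L / c)) :
    InProgress m mle n N L c D l j [] := by
  refine ⟨fun _ => by simpa [allr_nil] using hA, fun k _ => ?_⟩
  have := hn k
  simp only [List.length_nil, testSize]
  split_ifs <;> omega

/-- The states that the search can reach. -/
def SearchInv (m : Model Y Θ) (mle : ℕ → List Y → Θ) (n : ℕ → ℕ) (N L K : ℕ) (c : ℝ)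
    (s : State Y) : Prop :=
  s.declared ⊆ Finset.range (2 ^ L) ∧ (s.declared.card = K ∨ s.declared.card < K ∧
    ValidNode L s.declared s.level s.index ∧
    InProgress m mle n N L c s.declared s.level s.index s.buf)

lemma searchInv_step (hn : ∀ l, 1 ≤ n l) (hA : 0 ≤ Real.log (L / c)) (hK : K ≤ 2 ^ L)
    {s : State Y} (hs : SearchInv m mle n N L K c s) (hsK : s.declared.card ≠ K) (y : Y) :
    SearchInv m mle n N L K c (step m mle n N L c s y) := by
  obtain ⟨hD, hs⟩ := hs
  obtain ⟨hcard, hv, -⟩ := hs.resolve_left hsK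
  obtain ⟨D, l, j, buf⟩ := s
  simp only at hD hcard hv
  have hroot : Contains (Finset.range (2 ^ L)) L 0 :=
    contains_root ⟨0, by simp⟩ subset_rfl
  rcases l with _ | l
  · rw [step_leaf]
    split_ifs with h1 h2 h3
    · exact ⟨hD, Or.inr ⟨hcard, hv, fun _ => by simpa [allr_eq_zero m mle h1] using hA,
        fun k hk => by simp at hk⟩⟩
    · have hcard' : (insert j D).card = D.card + 1 := Finset.card_insert_of_notMem hv.notMem_of_leaf
      refine ⟨Finset.insert_subset hv.mem_range_of_leaf hD, ?_⟩
      rcases (show D.card + 1 ≤ K from hcard).eq_or_lt with h | h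
      · exact Or.inl (hcard'.trans h)
      · exact Or.inr ⟨hcard'.trans_lt h, validNode_root (hcard'.trans_lt (h.trans_le hK)),
          inProgress_nil hn hA⟩
    · obtain ⟨l', j', h4, h5, -⟩ := exists_toParent hv hroot ([] : List Y)
      rw [h4]
      exact ⟨hD, Or.inr ⟨hcard, h5, inProgress_nil hn hA⟩⟩
    · exact ⟨hD, Or.inr ⟨hcard, hv, fun _ => ⟨not_lt.1 h3, not_lt.1 h2⟩,
        fun k hk => by simp at hk⟩⟩
  · let ϑ : Query → Θ := fun _ => m.θ₀ 0
    -- the range of all processes may take the place of the anomalies, which do not matter here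
    have hU : Contains (Finset.range (2 ^ L) \ D) L 0 := by
      refine contains_root (Finset.sdiff_nonempty.2 fun hsub => ?_) Finset.sdiff_subset
      have := Finset.card_le_card hsub
      simp only [Finset.card_range] at this
      omega
    rw [step_internal (Finset.range (2 ^ L)) ϑ]
    split_ifs with h1
    · refine ⟨hD, Or.inr ⟨hcard, hv, fun h => by simp at h, fun k hk => ?_⟩⟩
      obtain rfl : l = k := by simpa using hk
      change (buf ++ [y]).length < testSize n l ⟨D, l + 1, j, buf ++ [y]⟩
      rwa [testSize_eq (Finset.range (2 ^ L)) ϑ]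
    · obtain ⟨l', j', h4, h5, -⟩ := exists_moveTo (Y := Y) hv hU ϑ
        (Child.testMove m mle l (n l) (childState (Finset.range (2 ^ L)) ϑ D l (2 * j))
          (childState (Finset.range (2 ^ L)) ϑ D l (2 * j + 1)) (buf ++ [y]))
      have hp := present_of_testMove (m := m) (mle := mle) (n := n) (l := l) (j := j) (D := D)
        (H := Finset.range (2 ^ L)) ϑ (buf ++ [y])
      rw [h4]
      exact ⟨hD, Or.inr ⟨hcard, h5 hp.1 hp.2, inProgress_nil hn hA⟩⟩

end Invariant

/-! ### Potentials of the nodes -/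

section Nodes

/-- A bound on the expected number of samples of a walk that starts a new test at distance `d` from
the closest anomaly. -/
def nodeCost (a r : ℝ≥0) (d : ℕ) : ℝ≥0 := a * d + r

lemma nodeCost_succ (a r : ℝ≥0) (d : ℕ) : nodeCost a r (d + 1) = nodeCost a r d + a := by
  rw [nodeCost, nodeCost]
  push_cast
  ring

lemma nodeCost_mono (a r : ℝ≥0) {d d' : ℕ} (h : d ≤ d') : nodeCost a r d ≤ nodeCost a r d' := by
  unfold nodeCost
  gcongr

/-- The cost of a wrong declaration, in samples. -/
def penalty (c : ℝ) (H D : Finset ℕ) : ℝ≥0∞ := if D ⊆ H then 0 else ENNReal.ofReal (1 / c)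

/-- The bound for everything but the current walk, if the processes of `D` have been declared: the
walks that are still to come, and the penalty if there is a wrong declaration in `D`. -/
def baseCost (a r : ℝ≥0) (L K : ℕ) (c : ℝ) (H D : Finset ℕ) : ℝ≥0∞ :=
  ((K - D.card - 1 : ℕ) : ℝ≥0∞) * nodeCost a r L + penalty c H D

variable {Y Θ : Type*}

/-- The bound for the rest of the search in a state in which a new test starts. -/
def freshCost (a r : ℝ≥0) (L K : ℕ) (c : ℝ) (H : Finset ℕ) (s : State Y) : ℝ≥0∞ :=
  if s.declared.card < K then
    baseCost a r L K c H s.declared + nodeCost a r (treeDist (H \ s.declared) s.level s.index)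
  else penalty c H s.declared

variable {a r : ℝ≥0} {L K : ℕ} {c : ℝ} {H D : Finset ℕ} {l j : ℕ}

lemma contains_root_sdiff (hH : H ⊆ Finset.range (2 ^ L)) (hD : D.card < H.card) :
    Contains (H \ D) L 0 :=
  contains_root (Finset.sdiff_nonempty.2 fun h => absurd (Finset.card_le_card h) (not_le.2 hD))
    (Finset.sdiff_subset.trans hH)

lemma freshCost_atRoot (hH : H ⊆ Finset.range (2 ^ L)) (hK : H.card = K) (hD : D.card ≤ K) :
    freshCost a r L K c H (atRoot L D : State Y) =
      ((K - D.card : ℕ) : ℝ≥0∞) * nodeCost a r L + penalty c H D := by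
  rcases hD.eq_or_lt with h | h
  · simp [freshCost, atRoot, h]
  · have h1 : K - D.card = (K - D.card - 1) + 1 := by omega
    rw [freshCost, atRoot, if_pos h, treeDist_of_contains (contains_root_sdiff hH (hK ▸ h)),
      baseCost, h1]
    push_cast
    ring

lemma freshCost_nil (hD : D.card < K) (l j : ℕ) :
    freshCost a r L K c H (⟨D, l, j, []⟩ : State Y) =
      baseCost a r L K c H D + nodeCost a r (treeDist (H \ D) l j) := by
  rw [freshCost, if_pos hD]

lemma penalty_insert_le (c : ℝ) (H D : Finset ℕ) (j : ℕ) :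
    penalty c H (insert j D) ≤ penalty c H D + ENNReal.ofReal (1 / c) := by
  unfold penalty
  split_ifs <;> simp

lemma penalty_insert_of_mem (c : ℝ) (hj : j ∈ H) : penalty c H (insert j D) = penalty c H D := by
  simp [penalty, Finset.insert_subset_iff, hj]

/-- A walk that declares leaf `j` leaves the walks that are still to come, and possibly a wrong
declaration. -/
lemma freshCost_declare (hH : H ⊆ Finset.range (2 ^ L)) (hK : H.card = K) (hD : D.card < K)
    (hj : j ∉ D) :
    freshCost a r L K c H (atRoot L (insert j D) : State Y) =
      ((K - D.card - 1 : ℕ) : ℝ≥0∞) * nodeCost a r L + penalty c H (insert j D) := by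
  have h := Finset.card_insert_of_notMem hj
  rw [freshCost_atRoot hH hK (by omega), h, Nat.sub_sub]

variable [MeasurableSpace Y] {m : Model Y Θ} {mle : ℕ → List Y → Θ} {n : ℕ → ℕ} {N : ℕ}
  {ϑ : Query → Θ}

/-- `Φ` is, as a function of the samples of the current test at node `(l, j)`, a potential of the
current walk. -/
structure IsNodePotential (m : Model Y Θ) (mle : ℕ → List Y → Θ) (n : ℕ → ℕ) (N L K : ℕ) (c : ℝ)
    (H : Finset ℕ) (ϑ : Query → Θ) (a r : ℝ≥0) (D : Finset ℕ) (l j : ℕ)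
    (Φ : List Y → ℝ≥0∞) : Prop where
  listMeasurable : ListMeasurable Φ
  nil_le : Φ [] ≤ nodeCost a r (treeDist (H \ D) l j)
  drift : ∀ buf, InProgress m mle n N L c D l j buf →
    1 + ∫⁻ y, Φ (buf ++ [y]) ∂m.law (nextQuery n ⟨D, l, j, buf⟩).level
      (ϑ (nextQuery n ⟨D, l, j, buf⟩)) ≤ Φ buf
  step_eq_or : ∀ buf, InProgress m mle n N L c D l j buf → ∀ y,
    step m mle n N L c ⟨D, l, j, buf⟩ y = ⟨D, l, j, buf ++ [y]⟩ ∨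
      (step m mle n N L c ⟨D, l, j, buf⟩ y).buf = [] ∧
      freshCost a r L K c H (step m mle n N L c ⟨D, l, j, buf⟩ y) ≤
        baseCost a r L K c H D + Φ (buf ++ [y])

lemma zero_le_log_div (hL : 1 ≤ L) (hc : 0 < c) (hc1 : c < 1) : 0 ≤ Real.log (L / c) := by
  refine Real.log_nonneg ?_
  rw [le_div_iff₀ hc]
  have : (1 : ℝ) ≤ L := by exact_mod_cast hL
  linarith

/-- At a normal leaf the test ends, after a bounded expected number of samples, with a move to the
parent, up to a false declaration of probability at most `c / L`. -/
lemma exists_isNodePotential_normalLeaf (hL : 1 ≤ L) (hc : 0 < c)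
    (hH : H ⊆ Finset.range (2 ^ L)) (hK : H.card = K) (hD : D.card < K) (hv : ValidNode L D 0 j)
    (hϑ : ϑ ⟨D, 0, j⟩ = m.θ₀ 0) (hj : j ∉ H \ D) {T : ℝ≥0} (ha : N + T + 1 ≤ a)
    (hpot : ∀ A pen : ℝ, 0 ≤ pen → ∃ Φ : List Y → ℝ≥0∞, ListMeasurable Φ ∧
      Φ [] ≤ N + T + ENNReal.ofReal (pen * Real.exp (-A)) ∧
      (∀ xs, A < allr m mle N xs → ENNReal.ofReal pen ≤ Φ xs) ∧
      ∀ xs, 0 ≤ allr m mle N xs →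
        1 + ∫⁻ y, Φ (xs ++ [y]) ∂m.law 0 (m.θ₀ 0) ≤ Φ xs) :
    ∃ Φ, IsNodePotential m mle n N L K c H ϑ a r D 0 j Φ := by
  have hL' : (1 : ℝ) ≤ L := by exact_mod_cast hL
  obtain ⟨Φ, hm, h0, hdecl, hdrift⟩ := hpot (Real.log (L / c)) (1 / c) (by positivity)
  obtain ⟨l', j', hpar, -, -, hdist⟩ := exists_toParent hv
    (contains_root_sdiff hH (hK ▸ hD)) ([] : List Y)
  replace hdist := hdist (contains_leaf_iff.not.2 hj)
  set d := treeDist (H \ D) l' j'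
  have hexp : 1 / c * Real.exp (-Real.log (L / c)) ≤ 1 := by
    rw [Real.exp_neg, Real.exp_log (by positivity), inv_div, one_div, inv_mul_eq_div,
      div_div_cancel_left' hc.ne']
    exact inv_le_one_of_one_le₀ hL'
  refine ⟨fun xs => nodeCost a r d + Φ xs, fun k => measurable_const.add (hm k), ?_, ?_, ?_⟩
  · rw [← hdist, nodeCost_succ, ENNReal.coe_add]
    gcongr
    calc Φ [] ≤ N + T + ENNReal.ofReal (1 / c * Real.exp (-Real.log (L / c))) := h0
      _ ≤ N + T + 1 := by
        gcongr
        exact ENNReal.ofReal_le_one.2 hexp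
      _ ≤ a := by exact_mod_cast ha
  · intro buf hbuf
    change 1 + ∫⁻ y, (nodeCost a r d + Φ (buf ++ [y])) ∂m.law 0 (ϑ ⟨D, 0, j⟩) ≤ _
    rw [hϑ, lintegral_add_left measurable_const, lintegral_const, measure_univ, mul_one,
      add_left_comm]
    gcongr
    exact hdrift buf (hbuf.1 rfl).1
  · intro buf _ y
    rw [step_leaf]
    split_ifs with h1 h2 h3
    · exact Or.inl rfl
    · refine Or.inr ⟨rfl, ?_⟩
      rw [freshCost_declare hH hK hD hv.notMem_of_leaf, baseCost, add_assoc]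
      gcongr
      calc _ ≤ penalty c H D + ENNReal.ofReal (1 / c) := penalty_insert_le c H D j
        _ ≤ _ := by
          gcongr
          exact (hdecl _ h2).trans le_add_self
    · refine Or.inr ⟨by rw [hpar], ?_⟩
      rw [hpar, freshCost_nil hD]
      gcongr
      exact le_self_add
    · exact Or.inl rfl

/-- At an anomalous leaf the test needs about `log (L / c) / D` samples before it declares the leaf;
the probability `h < 1` of a move to the parent enters through a geometric series. -/
lemma exists_isNodePotential_anomalousLeaf
    (hH : H ⊆ Finset.range (2 ^ L)) (hK : H.card = K) (hD : D.card < K) (hv : ValidNode L D 0 j)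
    (hj : j ∈ H \ D) {h G B : ℝ≥0} {b : ℝ} (hr : b.toNNReal + B = r)
    (hB : N + G + h * (a + B) ≤ B)
    (hpot : ∀ e : ℝ≥0, ∃ Φ : List Y → ℝ≥0∞, ListMeasurable Φ ∧
      Φ [] ≤ ENNReal.ofReal b + N + G + h * e ∧
      (∀ xs, N < xs.length → allr m mle N xs < 0 → ENNReal.ofReal b + e ≤ Φ xs) ∧
      ∀ xs, 0 ≤ allr m mle N xs → allr m mle N xs ≤ Real.log (L / c) →
        1 + ∫⁻ y, Φ (xs ++ [y]) ∂m.law 0 (ϑ ⟨D, 0, j⟩) ≤ Φ xs) :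
    ∃ Φ, IsNodePotential m mle n N L K c H ϑ a r D 0 j Φ := by
  obtain ⟨Φ, hm, h0, hup, hdrift⟩ := hpot (a + B)
  have hcont : Contains (H \ D) 0 j := contains_leaf_iff.2 hj
  obtain ⟨l', j', hpar, -, hdist, -⟩ := exists_toParent hv
    (contains_root_sdiff hH (hK ▸ hD)) ([] : List Y)
  rw [treeDist_of_contains hcont] at hdist
  refine ⟨Φ, hm, ?_, fun buf hbuf => hdrift buf (hbuf.1 rfl).1 (hbuf.1 rfl).2, ?_⟩
  · calc Φ [] ≤ ENNReal.ofReal b + N + G + h * (a + B : ℝ≥0) := h0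
      _ = ((b.toNNReal + (N + G + h * (a + B)) : ℝ≥0) : ℝ≥0∞) := by
        rw [ENNReal.ofReal]
        push_cast
        ring
      _ ≤ _ := by
        rw [ENNReal.coe_le_coe, ← hr, treeDist_of_contains hcont, nodeCost]
        simpa using hB
  · intro buf _ y
    rw [step_leaf]
    split_ifs with h1 h2 h3
    · exact Or.inl rfl
    · refine Or.inr ⟨rfl, ?_⟩
      rw [freshCost_declare hH hK hD hv.notMem_of_leaf,
        penalty_insert_of_mem c (Finset.mem_sdiff.1 hj).1]
      exact le_self_add
    · refine Or.inr ⟨by rw [hpar], ?_⟩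
      rw [hpar, freshCost_nil hD]
      gcongr
      refine le_trans ?_ (hup _ (not_le.1 h1) h3)
      rw [ENNReal.ofReal, ← ENNReal.coe_add, ENNReal.coe_le_coe]
      refine (nodeCost_mono a r hdist).trans (le_of_eq ?_)
      rw [nodeCost, ← hr]
      push_cast
      ring
    · exact Or.inl rfl

lemma possible_childState (hT : IsTruth m L H ϑ) (hD : D ⊆ Finset.range (2 ^ L)) {i : ℕ}
    (hv : ValidNode L D (l + 1) j) (hi : i / 2 = j) : (childState H ϑ D l i).Possible m l := by
  unfold childState
  split_ifs with hp
  · obtain ⟨h1, h2, -⟩ := hv.child hi hp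
    have h := hT D hD l h1 i h2
    by_cases h0 : ((H \ D) ∩ leaves l i).card = 0
    · exact Or.inl ⟨h0, h.1 h0⟩
    · refine Or.inr ⟨Nat.one_le_iff_ne_zero.2 h0, ?_, h.2 h0⟩
      rw [← card_leaves l i]
      exact Finset.card_le_card Finset.inter_subset_right
  · trivial

/-- At an internal node the expected progress of a move, which is positive by admissibility, pays
for the samples of the test. -/
lemma exists_isNodePotential_internal (hmle : m.IsMLE mle) (hfin : (m.params l 1).Finite)
    (hT : IsTruth m L H ϑ) (hH : H ⊆ Finset.range (2 ^ L)) (hK : H.card = K)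
    (hDL : D ⊆ Finset.range (2 ^ L)) (hD : D.card < K) (hv : ValidNode L D (l + 1) j) {p : ℝ}
    (hp : 0 ≤ p) (hp1 : p ≤ 1) (ha : 2 * (n l : ℝ) ≤ a * (2 * p - 1))
    (hcorrect : ∀ a b : Child Θ, a.Possible m l → b.Possible m l → (a.isSome ∨ b.isSome) →
      ENNReal.ofReal p ≤ ((a.sampleLaw m l (n l)).prod (b.sampleLaw m l (n l)))
        {x | Move.Correct a b (decideMove
          (a.map fun _ => gllr m mle l (List.ofFn x.1))
          (b.map fun _ => gllr m mle l (List.ofFn x.2)))}) :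
    ∃ Φ, IsNodePotential m mle n N L K c H ϑ a r D (l + 1) j Φ := by
  set ca := childState H ϑ D l (2 * j) with hca
  set cb := childState H ϑ D l (2 * j + 1) with hcb
  have hU := contains_root_sdiff hH (hK ▸ hD)
  have hab : ca.isSome ∨ cb.isSome := by
    refine hv.present_children.imp (fun h => ?_) fun h => ?_
    · simp [hca, childState, h]
    · simp [hcb, childState, h]
  have hdpos : ∃ d, treeDist (H \ D) (l + 1) j = d + 1 :=
    ⟨l + 2 * sInf {k | Contains (H \ D) (l + 1 + k) (j / 2 ^ k)}, by rw [treeDist]; ring⟩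
  obtain ⟨d, hd⟩ := hdpos
  set val : Move → ℝ≥0∞ := fun mv => nodeCost a r
    (treeDist (H \ D) (moveTo L l D j mv : State Y).level (moveTo L l D j mv : State Y).index)
  have hval : ∀ mv, Move.Correct ca cb mv → val mv ≤ nodeCost a r d := by
    intro mv hmv
    obtain ⟨l', j', h1, -, -, h2⟩ := exists_moveTo (Y := Y) hv hU ϑ mv
    have h3 := h2 hmv
    simp only [val, h1]
    exact_mod_cast nodeCost_mono a r (by omega)
  have hval' : ∀ mv, val mv ≤ nodeCost a r d + (2 * a : ℝ≥0) := by
    intro mv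
    obtain ⟨l', j', h1, -, h2, -⟩ := exists_moveTo (Y := Y) hv hU ϑ mv
    simp only [val, h1]
    have : nodeCost a r (treeDist (H \ D) l' j') ≤ nodeCost a r d + 2 * a :=
      (nodeCost_mono a r (show _ ≤ d + 1 + 1 by omega)).trans
        (le_of_eq (by rw [nodeCost_succ, nodeCost_succ]; ring))
    exact_mod_cast this
  obtain ⟨Φ, hm, h0, hend, hdrift⟩ := exists_internalTest_potential (n := n l) hmle hfin hp hab
    (hcorrect ca cb (possible_childState hT hDL hv (by omega))
      (possible_childState hT hDL hv (by omega)) hab) hval hval'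
  have hlen : ∀ {buf : List Y}, InProgress m mle n N L c D (l + 1) j buf →
      buf.length < Child.testLength (n l) ca cb := fun {buf} hbuf => by
    rw [hca, hcb, ← testSize_eq H ϑ D l j buf]
    exact hbuf.2 l rfl
  refine ⟨Φ, hm, ?_, ?_, ?_⟩
  · refine h0.trans ?_
    have hT2 : (Child.testLength (n l) ca cb : ℝ) ≤ 2 * n l := by
      unfold Child.testLength
      split_ifs <;> push_cast <;> nlinarith [(n l).cast_nonneg (α := ℝ)]
    -- a wrong move, two steps worse than a correct one, has probability at most `1 - p`
    have key : (Child.testLength (n l) ca cb : ℝ≥0) +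
        (nodeCost a r d + 2 * a * (1 - p).toNNReal) ≤ nodeCost a r (d + 1) := by
      rw [nodeCost_succ, ← NNReal.coe_le_coe]
      push_cast
      rw [Real.coe_toNNReal _ (by linarith)]
      nlinarith
    rw [hd, ENNReal.ofReal]
    exact_mod_cast key
  · intro buf hbuf
    rw [law_nextQuery_internal H ϑ D l j buf hv.present_children]
    exact hdrift buf (hlen hbuf)
  · intro buf hbuf y
    rw [step_internal H ϑ]
    split_ifs with h1
    · exact Or.inl rfl
    · have hlen' : (buf ++ [y]).length = Child.testLength (n l) ca cb := by
        have h2 := hlen hbuf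
        rw [List.length_append, List.length_singleton] at h1 ⊢
        change ¬ _ < Child.testLength (n l) ca cb at h1
        omega
      have h3 := hend _ hlen'
      obtain ⟨l', j', h4, -⟩ := exists_moveTo (Y := Y) hv hU ϑ
        (Child.testMove m mle l (n l) ca cb (buf ++ [y]))
      simp only [val, h4] at h3
      refine Or.inr ⟨by rw [h4], ?_⟩
      rw [h4, freshCost_nil hD]
      gcongr

end Nodes

/-! ### The bound for the risk -/

section Bound

variable {Y Θ : Type*} [MeasurableSpace Y] {m : Model Y Θ} {mle : ℕ → List Y → Θ} {n : ℕ → ℕ}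
  {N L K : ℕ} {c : ℝ} {H : Finset ℕ} {ϑ : Query → Θ} {a r : ℝ≥0}

/-- Potentials of the nodes combine to a potential of the states of the search. -/
theorem errorProb_add_le_of_isNodePotential (hmle : m.IsMLE mle)
    (hfin : ∀ l, (m.params l 1).Finite) (hn : ∀ l, 1 ≤ n l) (hc : 0 < c) (hc1 : c < 1)
    (hL : 1 ≤ L) (hK1 : 1 ≤ K) (hH : H ⊆ Finset.range (2 ^ L)) (hK : H.card = K)
    (hpot : ∀ D ⊆ Finset.range (2 ^ L), D.card < K → ∀ l j, ValidNode L D l j →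
      ∃ Φ, IsNodePotential m mle n N L K c H ϑ a r D l j Φ) :
    errorProb m (hds m mle n N L K c) H ϑ +
      ENNReal.ofReal c * sampleComplexity m (hds m mle n N L K c) ϑ ≤
      ENNReal.ofReal c * (K * nodeCost a r L) := by
  classical
  have hA := zero_le_log_div hL hc hc1
  have hK2 : K ≤ 2 ^ L := by simpa [hK] using Finset.card_le_card hH
  choose! Φ hΦ using hpot
  set V : State Y → ℝ≥0∞ := fun s =>
    if s.declared.card < K ∧ s.declared ⊆ Finset.range (2 ^ L) ∧
        ValidNode L s.declared s.level s.index then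
      baseCost a r L K c H s.declared + Φ s.declared s.level s.index s.buf
    else penalty c H s.declared with hVdef
  have hV : Measurable V := by
    refine measurable_state_iff.2 fun D l j => ?_
    by_cases h : D.card < K ∧ D ⊆ Finset.range (2 ^ L) ∧ ValidNode L D l j
    · simp only [V, if_pos h]
      exact fun k => measurable_const.add ((hΦ D h.2.1 h.1 l j h.2.2).listMeasurable k)
    · simp only [V, if_neg h]
      exact fun k => measurable_const
  have hfresh : ∀ s, SearchInv m mle n N L K c s → s.buf = [] → V s ≤ freshCost a r L K c H s := by
    rintro ⟨D, l, j, buf⟩ ⟨hD, hs⟩ hbuf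
    simp only at hD hs hbuf
    subst hbuf
    rcases hs with h | ⟨h1, h2, -⟩
    · simp [V, freshCost, h]
    · rw [freshCost, if_pos h1]
      refine (if_pos ⟨h1, hD, h2⟩).trans_le ?_
      gcongr
      exact (hΦ D hD h1 l j h2).nil_le
  have h0 : SearchInv m mle n N L K c (atRoot L ∅ : State Y) :=
    ⟨Finset.empty_subset _, Or.inr ⟨hK1, validNode_root (by positivity), inProgress_nil hn hA⟩⟩
  have hVroot : V (atRoot L ∅) ≤ K * nodeCost a r L := by
    refine (hfresh _ h0 rfl).trans (le_of_eq ?_)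
    rw [freshCost_atRoot hH hK (by simp)]
    simp [penalty]
  refine (errorProb_add_le_potential hmle hfin hc (V := V) h0
    (fun s hs hsK y => searchInv_step hn hA hK2 hs hsK y) hV ?_ ?_ ?_).trans (by gcongr)
  · intro s hs hsK
    obtain ⟨h1, h2, h3⟩ := hs.2.resolve_left hsK
    have hpot := hΦ s.declared hs.1 h1 s.level s.index h2
    have hVs : ∀ buf, V ⟨s.declared, s.level, s.index, buf⟩ =
        baseCost a r L K c H s.declared + Φ s.declared s.level s.index buf := fun buf =>
      if_pos ⟨h1, hs.1, h2⟩
    have hnext : ∀ y, V (step m mle n N L c s y) ≤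
        baseCost a r L K c H s.declared + Φ s.declared s.level s.index (s.buf ++ [y]) := by
      intro y
      rcases hpot.step_eq_or s.buf h3 y with h | ⟨h, h'⟩
      · rw [← hVs]
        exact (congrArg V h).le
      · exact (hfresh _ (searchInv_step hn hA hK2 hs hsK y) h).trans h'
    calc _ ≤ 1 + ∫⁻ y, (baseCost a r L K c H s.declared +
          Φ s.declared s.level s.index (s.buf ++ [y]))
          ∂m.law (nextQuery n s).level (ϑ (nextQuery n s)) := by
          gcongr with y
          exact hnext y
      _ = baseCost a r L K c H s.declared + (1 + ∫⁻ y, Φ s.declared s.level s.index (s.buf ++ [y])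
          ∂m.law (nextQuery n s).level (ϑ (nextQuery n s))) := by
          rw [lintegral_add_left measurable_const, lintegral_const, measure_univ, mul_one,
            add_left_comm]
      _ ≤ baseCost a r L K c H s.declared + Φ s.declared s.level s.index s.buf := by
          gcongr
          exact hpot.drift s.buf h3
      _ = V s := (hVs s.buf).symm
  · intro s hs hsH
    have h1 : ¬ s.declared ⊆ H := fun h =>
      hsH (Finset.eq_of_subset_of_card_le h (hK.trans hs.symm).le)
    simp [V, hs, penalty, h1]
  · exact ne_top_of_le_ne_top (ENNReal.mul_ne_top (by simp) ENNReal.coe_ne_top) hVroot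

lemma AdmissibleSizes.one_le (hmle : m.IsMLE mle) (h : AdmissibleSizes m mle n) (l : ℕ) :
    1 ≤ n l := by
  obtain ⟨-, p, hp, h⟩ := h
  by_contra! h0
  have hn : n l = 0 := by omega
  -- without samples, an anomaly below a single remaining child is never found
  have h1 := h l (some (1, mle l [])) none
    (Or.inr ⟨le_rfl, Nat.one_le_two_pow, (hmle.1 l []).1⟩) trivial (by simp)
  have h2 : ∀ x : Fin (n l) → Y, List.ofFn x = [] := fun x => by simp [hn]
  simp only [h2, Option.map_some, Option.map_none, decideMove, gllr, List.map_nil, List.sum_nil,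
    lt_irrefl, if_false, Move.Correct, Child.Anomalous, le_refl, not_true_eq_false, false_and,
    Set.ofPred_false, measure_empty] at h1
  simp at h1
  linarith

/-- The bound for the risk conditional on the truth. -/
theorem exists_errorProb_add_le (hmle : m.IsMLE mle) (hfin : ∀ l, (m.params l 1).Finite)
    (hmom : m.FiniteMoments) {Δ : ℝ≥0} (hΔ : 0 < Δ) (hdist : m.Distinguishable Δ) :
    ∃ N₀ : ℕ, ∀ N : ℕ, N₀ ≤ N → ∀ n : ℕ → ℕ, AdmissibleSizes m mle n →
      ∃ C : ℝ, ∀ (L K : ℕ) (c : ℝ), 1 ≤ L → 1 ≤ K → 0 < c → c < 1 →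
        ∀ H ⊆ Finset.range (2 ^ L), H.card = K → ∀ ϑ, IsTruth m L H ϑ → ∀ θ₁ ∈ m.params 0 1,
          (∀ D ⊆ Finset.range (2 ^ L), ∀ i ∈ H \ D,
            m.kl 0 θ₁ (m.θ₀ 0) ≤ m.kl 0 (ϑ ⟨D, 0, i⟩) (m.θ₀ 0)) →
          errorProb m (hds m mle n N L K c) H ϑ +
            ENNReal.ofReal c * sampleComplexity m (hds m mle n N L K c) ϑ ≤
            ENNReal.ofReal (c * K * C * L +
              c * K * Real.log (L / c) / (m.kl 0 θ₁ (m.θ₀ 0)).toReal) := by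
  have hanom := fun θ hθ => exists_anomalousLeaf_potential hmle (hfin 0) hmom hΔ hdist (θ := θ) hθ
  choose! h hh M G hpot using hanom
  obtain ⟨T, hT⟩ := exists_normalLeaf_potential hmle (hfin 0) hmom hΔ hdist
  set S := (hfin 0).toFinset
  refine ⟨S.sup M, fun N hN n hadm => ?_⟩
  have hn := hadm.one_le hmle
  obtain ⟨⟨Q, hQ⟩, p₀, hp₀, hcorrect⟩ := hadm
  set p := min p₀ 1
  have hp : 1 / 2 < p := lt_min hp₀ (by norm_num)
  set a : ℝ≥0 := N + T + 1 + (2 * Q / (2 * p - 1)).toNNReal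
  -- the number of tests of an anomalous leaf is at most geometric, with failure probability `h θ`
  set B : ℝ≥0 := S.sup fun θ => (N + G θ + h θ * a) / (1 - h θ)
  have hB : ∀ θ ∈ m.params 0 1, N + G θ + h θ * (a + B) ≤ B := by
    intro θ hθ
    have h1 : (N + G θ + h θ * a) / (1 - h θ) ≤ B :=
      Finset.le_sup (f := fun θ => (N + G θ + h θ * a) / (1 - h θ)) ((hfin 0).mem_toFinset.2 hθ)
    have h2 := hh θ hθ
    rw [div_le_iff₀ (tsub_pos_of_lt h2)] at h1
    rw [← NNReal.coe_le_coe] at h1 ⊢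
    push_cast [NNReal.coe_sub h2.le] at h1 ⊢
    linarith
  have ha : 2 * (Q : ℝ) ≤ a * (2 * p - 1) := by
    rw [← div_le_iff₀ (by linarith)]
    push_cast [a]
    rw [Real.coe_toNNReal _ (div_nonneg (by positivity) (by linarith))]
    have : (0 : ℝ) ≤ N + T + 1 := by positivity
    linarith
  refine ⟨a + S.sup G + B, fun L K c hL hK1 hc hc1 H hH hK ϑ hϑ θ₁ hθ₁ hmin => ?_⟩
  have hA := zero_le_log_div hL hc hc1
  set A := Real.log (L / c)
  set E := (m.kl 0 θ₁ (m.θ₀ 0)).toReal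
  set b : ℝ := A / E + S.sup G
  have hE : 0 < E := (NNReal.coe_pos.2 hΔ).trans_le (hmom.le_toReal_kl hdist hθ₁)
  have hb : 0 ≤ b := by positivity
  have hbound := errorProb_add_le_of_isNodePotential (N := N) (ϑ := ϑ) (a := a)
    (r := b.toNNReal + B) hmle hfin hn hc hc1 hL hK1 hH hK fun D hD hDK l j hv => ?_
  · refine hbound.trans ?_
    have hcost : (K : ℝ≥0∞) * nodeCost a (b.toNNReal + B) L =
        ENNReal.ofReal (K * (a * L + (b + B))) := by
      rw [ENNReal.ofReal_mul (by positivity), ENNReal.ofReal_natCast]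
      congr 1
      rw [← ENNReal.ofReal_coe_nnreal, nodeCost]
      push_cast
      rw [Real.coe_toNNReal _ hb]
    rw [hcost, ← ENNReal.ofReal_mul hc.le]
    refine ENNReal.ofReal_le_ofReal ?_
    have hL' : (1 : ℝ) ≤ L := by exact_mod_cast hL
    have h1 : ((S.sup G : ℝ≥0) : ℝ) + B ≤ (S.sup G + B) * L :=
      le_mul_of_one_le_right (by positivity) hL'
    calc c * (K * (a * L + (b + B))) = c * K * (a * L + (S.sup G + B)) + c * K * A / E := by
          simp only [b]
          ring
      _ ≤ c * K * (a * L + (S.sup G + B) * L) + c * K * A / E := by gcongr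
      _ = _ := by ring
  · rcases l with _ | l
    · have htruth := hϑ D hD 0 (Nat.zero_le _) j hv.2.1
      rw [leaves_zero] at htruth
      by_cases hj : j ∈ H \ D
      · rw [Finset.inter_singleton_of_mem hj, Finset.card_singleton] at htruth
        have hθ := htruth.2 one_ne_zero
        set θ := ϑ ⟨D, 0, j⟩ with hθdef
        have hEθ : E ≤ (m.kl 0 θ (m.θ₀ 0)).toReal :=
          ENNReal.toReal_mono (hmom.1 0 θ hθ).2 (hmin D hD j hj)
        have hMN : M θ ≤ N := (Finset.le_sup ((hfin 0).mem_toFinset.2 hθ)).trans hN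
        refine exists_isNodePotential_anomalousLeaf hH hK hDK hv hj rfl (hB θ hθ) fun e => ?_
        refine hpot θ hθ N hMN A hA e b (add_le_add (by gcongr) ?_)
        exact_mod_cast Finset.le_sup (f := G) ((hfin 0).mem_toFinset.2 hθ)
      · rw [Finset.inter_singleton_of_notMem hj] at htruth
        exact exists_isNodePotential_normalLeaf hL hc hH hK hDK hv (htruth.1 rfl) hj le_self_add
          (hT N)
    · refine exists_isNodePotential_internal hmle (hfin l) hϑ hH hK hD hDK hv (p := p)
        (by linarith) (min_le_right _ _) (le_trans ?_ ha) fun ca cb h1 h2 h3 => ?_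
      · have : (n l : ℝ) ≤ Q := by exact_mod_cast hQ l
        linarith
      · exact (ENNReal.ofReal_le_ofReal (min_le_left _ _)).trans (hcorrect l ca cb h1 h2 h3)

lemma bayesRisk_le {p : Finset ℕ → ℝ≥0∞} {ϑ : Finset ℕ → Query → Θ} {π : Policy Y} {R : ℝ≥0∞}
    (hp : ∑ H ∈ (Finset.range (2 ^ L)).powersetCard K, p H = 1)
    (h : ∀ H ∈ (Finset.range (2 ^ L)).powersetCard K,
      errorProb m π H (ϑ H) + ENNReal.ofReal c * sampleComplexity m π (ϑ H) ≤ R) :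
    bayesRisk m L K c p ϑ π ≤ R := by
  rw [bayesRisk, Finset.mul_sum, ← Finset.sum_add_distrib]
  calc _ ≤ ∑ H ∈ (Finset.range (2 ^ L)).powersetCard K, p H * R := by
        refine Finset.sum_le_sum fun H hH => ?_
        rw [mul_left_comm, ← mul_add]
        gcongr
        exact h H hH
    _ = R := by rw [← Finset.sum_mul, hp, one_mul]

end Bound

end HDS

end

theorem theorem2 {Y Θ : Type*} [MeasurableSpace Y] (m : HDS.Model Y Θ)
    (mle : ℕ → List Y → Θ) (hmle : m.IsMLE mle)
    (hfin : ∃ B : ℕ, ∀ l, (m.params l 1).encard ≤ (B : ℕ∞))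
    (hmom : m.FiniteMoments)
    (hdist : ∃ Δ : ℝ≥0, 0 < Δ ∧ m.Distinguishable Δ ∧ m.MultiDistinguishable Δ) :
    (∃ n : ℕ → ℕ, HDS.AdmissibleSizes m mle n) ∧
    ∃ N₀ : ℕ, ∀ N : ℕ, N₀ ≤ N → ∀ n : ℕ → ℕ, HDS.AdmissibleSizes m mle n →
      ∃ C C' : ℝ, ∀ (L K : ℕ) (c : ℝ), 1 ≤ L → 1 ≤ K → K ≤ 2 ^ L → 0 < c → c < 1 →
        ∀ (p : Finset ℕ → ℝ≥0∞) (ϑ : Finset ℕ → HDS.Query → Θ),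
          (∑ H ∈ (Finset.range (2 ^ L)).powersetCard K, p H = 1) →
          (∀ H ∈ (Finset.range (2 ^ L)).powersetCard K, HDS.IsTruth m L H (ϑ H)) →
          ∀ θ₁ ∈ m.params 0 1,
            (∀ H ∈ (Finset.range (2 ^ L)).powersetCard K, ∀ D ⊆ Finset.range (2 ^ L),
              ∀ i ∈ H \ D, m.kl 0 θ₁ (m.θ₀ 0) ≤ m.kl 0 (ϑ H ⟨D, 0, i⟩) (m.θ₀ 0)) →
            HDS.bayesRisk m L K c p ϑ (HDS.hds m mle n N L K c) ≤
              ENNReal.ofReal (c * K * C * L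
                + c * K * Real.log (L / c) / (m.kl 0 θ₁ (m.θ₀ 0)).toReal
                + C' * c) := by
  have hfin' : ∀ l, (m.params l 1).Finite := fun l =>
    Set.finite_of_encard_le_coe (hfin.choose_spec l)
  refine ⟨HDS.exists_admissibleSizes hmle hfin hmom hdist, ?_⟩
  obtain ⟨Δ, hΔ, hd, -⟩ := hdist
  obtain ⟨N₀, hN₀⟩ := HDS.exists_errorProb_add_le hmle hfin' hmom hΔ hd
  refine ⟨N₀, fun N hN n hn => ?_⟩
  obtain ⟨C, hC⟩ := hN₀ N hN n hn
  refine ⟨C, 0, fun L K c hL hK _ hc hc1 p ϑ hp hϑ θ₁ hθ₁ hmin => ?_⟩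
  rw [zero_mul, add_zero]
  refine HDS.bayesRisk_le hp fun H hH => ?_
  obtain ⟨hH1, hH2⟩ := Finset.mem_powersetCard.1 hH
  exact hC L K c hL hK hc hc1 H hH1 hH2 (ϑ H) (hϑ H hH) θ₁ hθ₁ (hmin H hH)
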